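/- Let $\theta\in(-\frac{\pi}{2},\frac{\pi}{2})$ and $m\ge 0$. In the Hilbert space $L^2(\mathbb{R})^4$ consider the operator $$H_\theta=-i\,\alpha_1e^{-i\theta/2}\partial_x-\alpha_2e^{i\theta/2}x+m\,\alpha_3$$ with domain $\mathcal{D}^4$, $\mathcal{D}=H^1(\mathbb{R})\cap L^2(\mathbb{R},x^2\,dx)$, where $\alpha_k=\begin{pmatrix}0&\sigma_k\\ \sigma_k&0\end{pmatrix}$ and $\sigma_1,\sigma_2,\sigma_3$ are the Pauli matrices. Let $\rho(H_\theta)=\mathbb{C}\setminus\sigma(H_\theta)$ be the resolvent set and, for $\varepsilon>0$, let $$\sigma_\varepsilon(H_\theta)=\sigma(H_\theta)\cup\Big\{z\notin\sigma(H_\theta):\ \|(H_\theta-z)^{-1}\|>\frac1\varepsilon\Big\}$$ be the $\varepsilon$-pseudospectrum. Then the following hold. (i) For every $\delta>0$ there exist $C_1,C_2>0$ such that for all $\varepsilon>0$ $$\Big\{z\in\mathbb{C}:\ |z^2-m^2|\ge C_1,\ |\arg(z^2-m^2)|\le|\theta|-\delta,\ |z^2-m^2|>C_2\log\frac1{\varepsilon^2}\Big\}\subset\sigma_\varepsilon(H_\theta),$$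 where $\arg$ is the principal argument with values in $(-\pi,\pi]$. (ii) For all $\varepsilon>0$ $$\sigma_\varepsilon(H_\theta)\subset\Big\{z\in\mathbb{C}:\ \big(1-|\tan\tfrac\theta2|\big)|\operatorname{Im}z|\le(|\operatorname{Re}z|+m)\,|\tan\tfrac\theta2|+\varepsilon\Big\}.$$ (iii) If $|\tan\frac\theta2|\,(m+|\operatorname{Re}z|)<(1-|\tan\frac\theta2|)\,|\operatorname{Im}z|$, then $z\in\rho(H_\theta)$ and $$\|(H_\theta-z)^{-1}\|\le\frac{1}{(1-|\tan\frac\theta2|)\,|\operatorname{Im}z|-|\tan\frac\theta2|\,(m+|\operatorname{Re}z|)}.$$ (iv) If $0<|\vartheta|<\frac{|\theta|}{2}$, then for each $s\in\{m,-m\}$ and for $r\to+\infty$ as well as for $r\to-\infty$, the point $s+re^{i\vartheta}$ lies in $\rho(H_\theta)$ for all sufficiently large $|r|$ and $$\big\|\big(H_\theta-s-re^{i\vartheta}\big)^{-1}\big\|\to\infty .$$ -/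

import Mathlib

open MeasureTheory Filter Topology
open scoped ENNReal SchwartzMap

noncomputable section

/-! ### Spectrum, resolvent and pseudospectra of an unbounded operator -/

namespace UnboundedOperator

variable {E : Type*} [NormedAddCommGroup E] [NormedSpace ℂ E]

/-- The bounded operator `R` is the inverse `(T - z)⁻¹` of `T - z : D(T) → E`. -/
structure IsResolventAt (T : E →ₗ.[ℂ] E) (z : ℂ) (R : E →L[ℂ] E) : Prop where
  mem_domain : ∀ f : E, R f ∈ T.domain
  right_inv : ∀ f : E, T ⟨R f, mem_domain f⟩ - z • R f = f
  left_inv : ∀ ψ : T.domain, R (T ψ - z • (ψ : E)) = (ψ : E)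

theorem IsResolventAt.unique {T : E →ₗ.[ℂ] E} {z : ℂ} {R R' : E →L[ℂ] E}
    (h : IsResolventAt T z R) (h' : IsResolventAt T z R') : R = R' := by
  ext f
  have h1 := h.left_inv ⟨R' f, h'.mem_domain f⟩
  rw [h'.right_inv f] at h1
  exact h1

/-- The resolvent set `ρ(T)`: all `z` such that `T - z : D(T) → E` is bijective with bounded
inverse. -/
def resolventSet (T : E →ₗ.[ℂ] E) : Set ℂ :=
  {z | ∃ R : E →L[ℂ] E, IsResolventAt T z R}

/-- The spectrum `σ(T) = ℂ \ ρ(T)`. -/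
def spectrum (T : E →ₗ.[ℂ] E) : Set ℂ := (resolventSet T)ᶜ

open Classical in
/-- The resolvent `(T - z)⁻¹` for `z ∈ ρ(T)` (and `0` by convention for `z ∈ σ(T)`). -/
def resolvent (T : E →ₗ.[ℂ] E) (z : ℂ) : E →L[ℂ] E :=
  if h : z ∈ resolventSet T then h.choose else 0

theorem IsResolventAt.resolvent_eq {T : E →ₗ.[ℂ] E} {z : ℂ} {R : E →L[ℂ] E}
    (h : IsResolventAt T z R) : resolvent T z = R := by
  have hz : z ∈ resolventSet T := ⟨R, h⟩
  rw [resolvent, dif_pos hz]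
  exact hz.choose_spec.unique h

/-- The `ε`-pseudospectrum `σ(T) ∪ {z ∉ σ(T) : ‖(T - z)⁻¹‖ > 1 / ε}`. -/
def pseudospectrum (T : E →ₗ.[ℂ] E) (ε : ℝ) : Set ℂ :=
  spectrum T ∪ {z | z ∉ spectrum T ∧ 1 / ε < ‖resolvent T z‖}

end UnboundedOperator

/-! ### The relativistic rotated harmonic oscillator -/

namespace RelativisticOscillator

/-- The Hilbert space `L²(ℝ)` of complex-valued functions. -/
abbrev L2 : Type := Lp ℂ 2 (volume : Measure ℝ)

/-- The spinorial Hilbert space `L²(ℝ)⁴`, with `‖ψ‖² = ∑ j, ‖ψ j‖²`. -/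
abbrev SpinorL2 : Type := PiLp 2 (fun _ : Fin 4 => L2)

/-- `g ∈ L²(ℝ)` is the weak (distributional) derivative of `f ∈ L²(ℝ)`. -/
def HasWeakDeriv (f g : L2) : Prop :=
  TemperedDistribution.derivCLM ℂ (f : 𝓢'(ℝ, ℂ)) = (g : 𝓢'(ℝ, ℂ))

theorem HasWeakDeriv.unique {f g g' : L2} (h : HasWeakDeriv f g) (h' : HasWeakDeriv f g') :
    g = g' := by
  have hinj := LinearMap.ker_eq_bot.mp
    (Lp.ker_toTemperedDistributionCLM_eq_bot (E := ℝ) (F := ℂ) (μ := volume) (p := 2))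
  exact hinj (h.symm.trans h')

theorem HasWeakDeriv.add {f f' g g' : L2} (h : HasWeakDeriv f g) (h' : HasWeakDeriv f' g') :
    HasWeakDeriv (f + f') (g + g') := by
  have e (u v : L2) : ((u + v : L2) : 𝓢'(ℝ, ℂ)) = (u : 𝓢'(ℝ, ℂ)) + (v : 𝓢'(ℝ, ℂ)) :=
    map_add (Lp.toTemperedDistributionCLM ℂ volume 2) u v
  unfold HasWeakDeriv at *
  rw [e, e, map_add, h, h']

theorem HasWeakDeriv.smul {f g : L2} (c : ℂ) (h : HasWeakDeriv f g) :
    HasWeakDeriv (c • f) (c • g) := by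
  have e (u : L2) : ((c • u : L2) : 𝓢'(ℝ, ℂ)) = c • (u : 𝓢'(ℝ, ℂ)) :=
    map_smul (Lp.toTemperedDistributionCLM ℂ volume 2) c u
  unfold HasWeakDeriv at *
  rw [e, e, map_smul, h]

theorem mul_add_ae (f g : L2) :
    (fun x : ℝ => (x : ℂ) * (f + g : L2) x) =ᵐ[volume]
      (fun x : ℝ => (x : ℂ) * f x) + fun x : ℝ => (x : ℂ) * g x := by
  filter_upwards [Lp.coeFn_add f g] with x hx
  simp only [hx, Pi.add_apply, mul_add]

theorem mul_smul_ae (c : ℂ) (f : L2) :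
    (fun x : ℝ => (x : ℂ) * (c • f : L2) x) =ᵐ[volume] c • fun x : ℝ => (x : ℂ) * f x := by
  filter_upwards [Lp.coeFn_smul c f] with x hx
  simp only [hx, Pi.smul_apply, smul_eq_mul]
  ring

/-- `𝒟 = H¹(ℝ) ∩ L²(ℝ, x² dx)`. -/
def formDomain : Submodule ℂ L2 where
  carrier := {f | (∃ g : L2, HasWeakDeriv f g) ∧ MemLp (fun x : ℝ => (x : ℂ) * f x) 2 volume}
  add_mem' := by
    rintro f f' ⟨⟨g, hg⟩, hx⟩ ⟨⟨g', hg'⟩, hx'⟩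
    exact ⟨⟨g + g', hg.add hg'⟩, (memLp_congr_ae (mul_add_ae f f')).2 (hx.add hx')⟩
  zero_mem' := by
    refine ⟨⟨0, ?_⟩, ?_⟩
    · have e : ((0 : L2) : 𝓢'(ℝ, ℂ)) = 0 := map_zero (Lp.toTemperedDistributionCLM ℂ volume 2)
      unfold HasWeakDeriv
      rw [e, map_zero]
    · have h : (fun x : ℝ => (x : ℂ) * (0 : L2) x) =ᵐ[volume] (0 : ℝ → ℂ) := by
        filter_upwards [Lp.coeFn_zero ℂ 2 (volume : Measure ℝ)] with x
        simp
      exact (memLp_congr_ae h).2 MemLp.zero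
  smul_mem' := by
    rintro c f ⟨⟨g, hg⟩, hx⟩
    exact ⟨⟨c • g, hg.smul c⟩, (memLp_congr_ae (mul_smul_ae c f)).2 (hx.const_smul c)⟩

/-- The weak derivative `∂ₓ : 𝒟 → L²(ℝ)`. -/
def weakDeriv : formDomain →ₗ[ℂ] L2 where
  toFun f := f.2.1.choose
  map_add' f g := (f + g).2.1.choose_spec.unique (f.2.1.choose_spec.add g.2.1.choose_spec)
  map_smul' c f := (c • f).2.1.choose_spec.unique (f.2.1.choose_spec.smul c)

theorem hasWeakDeriv_weakDeriv (f : formDomain) : HasWeakDeriv (f : L2) (weakDeriv f) :=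
  f.2.1.choose_spec

/-- Multiplication by the independent variable, `f(x) ↦ x f(x)`, as a map `𝒟 → L²(ℝ)`. -/
def mulX : formDomain →ₗ[ℂ] L2 where
  toFun f := f.2.2.toLp
  map_add' f g := by
    rw [← MemLp.toLp_add]
    exact MemLp.toLp_congr _ _ (mul_add_ae (f : L2) (g : L2))
  map_smul' c f := by
    rw [RingHom.id_apply, ← MemLp.toLp_const_smul]
    exact MemLp.toLp_congr _ _ (mul_smul_ae c (f : L2))

/-- The Dirac matrix `α₁ = [[0, σ₁], [σ₁, 0]]` (standard representation). -/
def α₁ : Matrix (Fin 4) (Fin 4) ℂ :=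
  !![0, 0, 0, 1;
     0, 0, 1, 0;
     0, 1, 0, 0;
     1, 0, 0, 0]

/-- The Dirac matrix `α₂ = [[0, σ₂], [σ₂, 0]]` (standard representation). -/
def α₂ : Matrix (Fin 4) (Fin 4) ℂ :=
  !![0, 0, 0, -Complex.I;
     0, 0, Complex.I, 0;
     0, -Complex.I, 0, 0;
     Complex.I, 0, 0, 0]

/-- The Dirac matrix `α₃ = [[0, σ₃], [σ₃, 0]]` (standard representation). -/
def α₃ : Matrix (Fin 4) (Fin 4) ℂ :=
  !![0, 0, 1, 0;
     0, 0, 0, -1;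
     1, 0, 0, 0;
     0, -1, 0, 0]

/-- The domain `𝒟⁴` as a subspace of `L²(ℝ)⁴`. -/
def spinorDomain : Submodule ℂ SpinorL2 where
  carrier := {ψ | ∀ j, ψ j ∈ formDomain}
  add_mem' hψ hφ j := formDomain.add_mem (hψ j) (hφ j)
  zero_mem' _ := formDomain.zero_mem
  smul_mem' c _ hψ j := formDomain.smul_mem c (hψ j)

/-- The `j`-th component `𝒟⁴ → 𝒟`. -/
def component (j : Fin 4) : spinorDomain →ₗ[ℂ] formDomain where
  toFun ψ := ⟨(ψ : SpinorL2) j, ψ.2 j⟩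
  map_add' _ _ := rfl
  map_smul' _ _ := rfl

/-- The action of a `4 × 4` matrix on a vector of `L²` functions. -/
def matrixAction (M : Matrix (Fin 4) (Fin 4) ℂ) (ψ : Fin 4 → L2) : SpinorL2 :=
  WithLp.toLp 2 fun j => ∑ k, M j k • ψ k

/-- The operator `H_θ = - i α₁ e^{-iθ/2} ∂ₓ - α₂ e^{iθ/2} x + m α₃` in `L²(ℝ)⁴` with domain
`𝒟⁴`. -/
def diracOscillator (θ m : ℝ) : SpinorL2 →ₗ.[ℂ] SpinorL2 where
  domain := spinorDomain
  toFun :=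
    { toFun := fun ψ =>
        (-Complex.I * Complex.exp (-Complex.I * θ / 2)) •
            matrixAction α₁ (fun k => weakDeriv (component k ψ))
          - Complex.exp (Complex.I * θ / 2) • matrixAction α₂ (fun k => mulX (component k ψ))
          + (m : ℂ) • matrixAction α₃ (fun k => (component k ψ : L2))
      map_add' := fun ψ φ => by
        ext1 j
        simp only [matrixAction, map_add, Submodule.coe_add, smul_add, Finset.sum_add_distrib,
          PiLp.add_apply, PiLp.sub_apply, PiLp.smul_apply]
        abel
      map_smul' := fun c ψ => by
        ext1 j
        simp only [matrixAction, map_smul, Submodule.coe_smul, PiLp.add_apply, PiLp.sub_apply,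
          PiLp.smul_apply, RingHom.id_apply, smul_add, smul_sub, Finset.smul_sum, smul_smul]
        congr 1
        · congr 1 <;> exact Finset.sum_congr rfl fun k _ => by congr 1; ring
        · exact Finset.sum_congr rfl fun k _ => by congr 1; ring }

end RelativisticOscillator

end

/-!
Passing to `ψ₀ ± ψ₂`, `ψ₁ ± ψ₃` splits `H_θ - z` into two `2 × 2` blocks
`(u, v) ↦ ((m - z) u + A' v, A u - (m + z) v)`, one for `z` and one (up to signs) for `-z`, where
`A = e^{-iθ/2} ∂ₓ + e^{iθ/2} x` and `A' = -e^{-iθ/2} ∂ₓ + e^{iθ/2} x` are rotated ladder operators.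

**Upper bound for the resolvent.** `pair_lower_bound` bounds a block below by
`(1 - |tan (θ/2)|) |Im z| - |tan (θ/2)| (m + |Re z|)`. In terms of the unrotated ladder operators
`a = ∂ₓ + x` and `a†`, a block is a symmetric operator plus `i sin (θ/2)` times a second one. If
`|Re z|` is large compared to `m`, the two are compared by the triangle inequality
(`selfAdjoint_comparison`), and the claim reduces to a polynomial inequality. Otherwise completing
the square in `A'` is enough (`rotated_lower_bound`). With closedness and dense range this yields
the resolvent, and a contrapositive reading yields the enclosure of the pseudospectra. Since the
resolvent is compact (its range has finite `a`-norm, and Hermite functions diagonalize `a† a`) and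
`H_θ - z` is injective for `z ∉ ℝ`, every nonreal `z` belongs to the resolvent set.

**The scalar equation.** Injectivity, dense range and the growth of the resolvent all rest on the
entire function `U(w) = ∫ exp (-e^{iθ} x² / 2 + w x) u(x) dx` (`gaussianTransform`). It intertwines
`A'` with a multiplication and `A` with a first order operator, so that the block equations become,
up to an explicit Gaussian factor, `t φ' - ν φ = g` with `ν = (z² - m²) / 2`
(`gaussianTransform_block`). For `g = 0` there is no nonzero entire solution unless `ν ∈ ℕ`.

**Lower bound for the resolvent.** The matrix elements of the resolvent between two Gaussians give
an entire solution of `t φ' - ν φ = e^{ζ t}` (`exists_solution_of_isResolventAt`), where `ζ` is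
proportional to the product of the two Gaussian parameters, and `φ 1`, normalized by the norms of
the Gaussians, is a lower bound for the norm of the resolvent. An entire solution is unique, and
its size can be read off at infinity: `t^{-ν} φ(t)` tends to `(-ζ)^ν Γ(-ν)` along rays on which
`e^{ζ t}` decays (`tendsto_cpow_neg_mul`), because its derivative is `t^{-ν-1} e^{ζ t}`, an
integrand of Gamma type. Integrating that derivative back along the ray and an arc of the unit
circle costs at most `(π + 1) e^{Re ν}` when `|ζ| = Re ν / cos θ` and `|arg ζ| = |θ|`
(`norm_Gamma_mul_le`), while Stirling-type bounds and the reflection formula show that the main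
term exceeds this by the factor `e^{|ν| (1 - cos δ)}`, up to a power, if `|arg ν| ≤ |θ| - δ`
(`exists_growth`). Translated Gaussians serve one sign of `Im ν` and modulated ones the other. The
outcome is `exists_exp_le_norm_resolvent`, from which the exponential pseudospectral inclusion and
the resolvent growth along rays follow.
-/

noncomputable section

namespace RelativisticOscillator

/-! ### Gaussians as Schwartz functions -/

theorem norm_pow_mul_cexp_quadratic_bounded {b : ℂ} (hb : b.re < 0) (c : ℂ) (k : ℕ) :
    ∃ C, ∀ x : ℝ, ‖x‖ ^ k * ‖Complex.exp (b * x ^ 2 + c * x)‖ ≤ C := by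
  have h := (cexp_neg_quadratic_isLittleO_abs_rpow_cocompact hb c (-(k : ℝ))).isBigO.bound
  obtain ⟨C, hC⟩ := h
  obtain ⟨K, hK, hKs⟩ := Filter.mem_cocompact.1 hC
  have hcont : Continuous fun x : ℝ => ‖x‖ ^ k * ‖Complex.exp (b * x ^ 2 + c * x)‖ := by
    fun_prop
  obtain ⟨M, hM⟩ := (hK.image hcont).bddAbove
  -- the last term accounts for `x = 0`, `k = 0`, where the negative power has a junk value
  refine ⟨max (max M C) ‖Complex.exp 0‖, fun x => ?_⟩
  by_cases hx : x ∈ K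
  · exact (hM ⟨x, hx, rfl⟩).trans ((le_max_left _ _).trans (le_max_left _ _))
  · have hx2 := hKs hx
    simp only [Set.mem_ofPred_eq] at hx2
    by_cases hx0 : x = 0
    · subst hx0
      refine le_trans ?_ (le_max_right _ _)
      simp only [norm_zero, Complex.ofReal_zero]
      rcases k with _ | k <;> simp
    · have hpos : 0 < |x| := abs_pos.2 hx0
      have : ‖|x| ^ (-(k : ℝ))‖ = (|x| ^ k)⁻¹ := by
        rw [Real.rpow_neg hpos.le, Real.rpow_natCast, Real.norm_of_nonneg (by positivity)]
      rw [this] at hx2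
      refine le_trans ?_ ((le_max_right _ _).trans (le_max_left _ _))
      rw [Real.norm_eq_abs]
      calc |x| ^ k * ‖Complex.exp (b * x ^ 2 + c * x)‖ ≤ |x| ^ k * (C * (|x| ^ k)⁻¹) := by gcongr
        _ = C := by field_simp

theorem hasDerivAt_cexp_quadratic (b c : ℂ) (x : ℝ) :
    HasDerivAt (fun x : ℝ => Complex.exp (b * x ^ 2 + c * x))
      (Complex.exp (b * x ^ 2 + c * x) * (b * (2 * x) + c)) x := by
  have h0 : HasDerivAt (fun y : ℂ => Complex.exp (b * y ^ 2 + c * y))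
      (Complex.exp (b * x ^ 2 + c * x) * (b * (2 * x) + c)) (x : ℂ) := by
    refine (((hasDerivAt_pow 2 (x : ℂ)).const_mul b).add
      ((hasDerivAt_id (x : ℂ)).const_mul c)).cexp.congr_deriv ?_
    simp
  exact h0.comp_ofReal

open Polynomial in
theorem iteratedDeriv_cexp_quadratic (b c : ℂ) (n : ℕ) :
    ∃ P : ℂ[X], ∀ x : ℝ, iteratedDeriv n (fun x : ℝ => Complex.exp (b * x ^ 2 + c * x)) x =
      P.eval (x : ℂ) * Complex.exp (b * x ^ 2 + c * x) := by
  induction n with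
  | zero => exact ⟨1, fun x => by simp⟩
  | succ n ih =>
    obtain ⟨P, hP⟩ := ih
    refine ⟨derivative P + P * (C (2 * b) * X + C c), fun x => ?_⟩
    rw [iteratedDeriv_succ, funext hP]
    have h1 : HasDerivAt (fun x : ℝ => P.eval (x : ℂ)) (P.derivative.eval (x : ℂ)) x :=
      (P.hasDerivAt (x : ℂ)).comp_ofReal
    have h2 : HasDerivAt (fun x : ℝ => Complex.exp (b * x ^ 2 + c * x))
        (Complex.exp (b * x ^ 2 + c * x) * (b * (2 * x) + c)) x := hasDerivAt_cexp_quadratic b c x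
    rw [HasDerivAt.deriv (h1.fun_mul h2)]
    simp only [eval_add, eval_mul, eval_C, eval_X]
    ring

open Polynomial in
/-- All Schwartz seminorms of a Gaussian are finite, since its derivatives are of this form. -/
theorem norm_pow_mul_polynomial_mul_cexp_quadratic_bounded {b : ℂ} (hb : b.re < 0) (c : ℂ)
    (k : ℕ) (P : ℂ[X]) :
    ∃ C, ∀ x : ℝ, ‖x‖ ^ k * ‖P.eval (x : ℂ) * Complex.exp (b * x ^ 2 + c * x)‖ ≤ C := by
  induction P using Polynomial.induction_on' with
  | add p q hp hq =>
    obtain ⟨C, hC⟩ := hp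
    obtain ⟨D, hD⟩ := hq
    refine ⟨C + D, fun x => ?_⟩
    rw [eval_add, add_mul]
    calc _ ≤ ‖x‖ ^ k * (‖p.eval (x : ℂ) * Complex.exp (b * x ^ 2 + c * x)‖
          + ‖q.eval (x : ℂ) * Complex.exp (b * x ^ 2 + c * x)‖) := by
          gcongr; exact norm_add_le _ _
      _ ≤ C + D := by rw [mul_add]; exact add_le_add (hC x) (hD x)
  | monomial n a =>
    obtain ⟨C, hC⟩ := norm_pow_mul_cexp_quadratic_bounded hb c (k + n)
    refine ⟨‖a‖ * C, fun x => ?_⟩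
    rw [eval_monomial, norm_mul, norm_mul, norm_pow, Complex.norm_real]
    calc _ = ‖a‖ * (‖x‖ ^ (k + n) * ‖Complex.exp (b * x ^ 2 + c * x)‖) := by ring
      _ ≤ ‖a‖ * C := by gcongr; exact hC x

/-- The Gaussian `x ↦ exp (b x² + c x)`, `Re b < 0`, as a Schwartz function. -/
def gaussian {b : ℂ} (hb : b.re < 0) (c : ℂ) : 𝓢(ℝ, ℂ) where
  toFun x := Complex.exp (b * x ^ 2 + c * x)
  smooth' := by
    have : ContDiff ℝ ((⊤ : ℕ∞) : WithTop ℕ∞) fun x : ℝ => (x : ℂ) := Complex.ofRealCLM.contDiff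
    fun_prop
  decay' k n := by
    obtain ⟨P, hP⟩ := iteratedDeriv_cexp_quadratic b c n
    obtain ⟨C, hC⟩ := norm_pow_mul_polynomial_mul_cexp_quadratic_bounded hb c k P
    refine ⟨C, fun x => ?_⟩
    rw [norm_iteratedFDeriv_eq_norm_iteratedDeriv, hP x]
    exact hC x

@[simp]
theorem gaussian_apply {b : ℂ} (hb : b.re < 0) (c : ℂ) (x : ℝ) :
    gaussian hb c x = Complex.exp (b * x ^ 2 + c * x) := rfl

/-- Multiplication of Schwartz functions by the independent variable. -/
def schwartzMulX : 𝓢(ℝ, ℂ) →L[ℂ] 𝓢(ℝ, ℂ) := SchwartzMap.smulLeftCLM ℂ fun x : ℝ => (x : ℂ)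

@[simp]
theorem schwartzMulX_apply (φ : 𝓢(ℝ, ℂ)) (x : ℝ) : schwartzMulX φ x = x * φ x := by
  rw [schwartzMulX, SchwartzMap.smulLeftCLM_apply_apply (by fun_prop),
    smul_eq_mul]

theorem schwartzMulX_pow_apply (φ : 𝓢(ℝ, ℂ)) (k : ℕ) (x : ℝ) :
    (schwartzMulX ^ k) φ x = (x : ℂ) ^ k * φ x := by
  induction k generalizing φ with
  | zero => simp
  | succ k ih =>
    rw [pow_succ, mul_apply_eq_comp, ih, schwartzMulX_apply]
    ring

theorem deriv_gaussian {b : ℂ} (hb : b.re < 0) (c : ℂ) :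
    SchwartzMap.derivCLM ℂ ℂ (gaussian hb c) =
      c • gaussian hb c + (2 * b) • schwartzMulX (gaussian hb c) := by
  ext x
  rw [SchwartzMap.derivCLM_apply]
  rw [show (gaussian hb c : ℝ → ℂ) = fun x : ℝ => Complex.exp (b * x ^ 2 + c * x) from rfl,
    (hasDerivAt_cexp_quadratic b c x).deriv]
  simp only [add_apply, smul_apply, schwartzMulX_apply, gaussian_apply,
    smul_eq_mul]
  ring

/-! ### Schwartz functions in the domain -/

theorem integrable_schwartz_mul (φ : 𝓢(ℝ, ℂ)) (u : L2) :
    Integrable (fun x => φ x * u x) := by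
  have := (φ.memLp 2 (volume : Measure ℝ)).integrable_mul (Lp.memLp u)
  exact this

theorem integral_schwartz_mul_weakDeriv (φ : 𝓢(ℝ, ℂ)) (u : formDomain) :
    ∫ x, φ x * weakDeriv u x = - ∫ x, SchwartzMap.derivCLM ℂ ℂ φ x * (u : L2) x := by
  have h := hasWeakDeriv_weakDeriv u
  unfold HasWeakDeriv at h
  have h2 := DFunLike.congr_fun h φ
  rw [TemperedDistribution.derivCLM_apply_apply, map_neg, Lp.toTemperedDistribution_apply,
    Lp.toTemperedDistribution_apply] at h2
  simp only [smul_eq_mul] at h2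
  exact h2.symm

theorem coeFn_mulX (u : formDomain) : (mulX u : ℝ → ℂ) =ᵐ[volume] fun x => (x : ℂ) * (u : L2) x :=
  MemLp.coeFn_toLp u.2.2

theorem integral_schwartz_mul_mulX (φ : 𝓢(ℝ, ℂ)) (u : formDomain) :
    ∫ x, φ x * mulX u x = ∫ x, schwartzMulX φ x * (u : L2) x := by
  refine integral_congr_ae ?_
  filter_upwards [coeFn_mulX u] with x hx
  rw [hx, schwartzMulX_apply]
  ring

/-- The class of a Schwartz function in `L²(ℝ)`. -/
abbrev schwartzL2 (φ : 𝓢(ℝ, ℂ)) : L2 := φ.toLp 2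

theorem hasWeakDeriv_schwartz (φ : 𝓢(ℝ, ℂ)) :
    HasWeakDeriv (schwartzL2 φ) (schwartzL2 (SchwartzMap.derivCLM ℂ ℂ φ)) := by
  unfold HasWeakDeriv
  rw [Lp.toTemperedDistribution_toLp_eq, Lp.toTemperedDistribution_toLp_eq]
  exact TemperedDistribution.derivCLM_toTemperedDistributionCLM_eq ℂ φ

theorem mulX_schwartz_ae (φ : 𝓢(ℝ, ℂ)) :
    (fun x : ℝ => (x : ℂ) * schwartzL2 φ x) =ᵐ[volume] schwartzMulX φ := by
  filter_upwards [φ.coeFn_toLp 2 (volume : Measure ℝ)] with x hx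
  rw [hx, schwartzMulX_apply]

/-- A Schwartz function as an element of the domain `𝒟`. -/
def schwartzDomain (φ : 𝓢(ℝ, ℂ)) : formDomain :=
  ⟨schwartzL2 φ, ⟨_, hasWeakDeriv_schwartz φ⟩,
    (memLp_congr_ae (mulX_schwartz_ae φ)).2 ((schwartzMulX φ).memLp 2 _)⟩

@[simp]
theorem coe_schwartzDomain (φ : 𝓢(ℝ, ℂ)) : (schwartzDomain φ : L2) = schwartzL2 φ := rfl

@[simp]
theorem weakDeriv_schwartzDomain (φ : 𝓢(ℝ, ℂ)) :
    weakDeriv (schwartzDomain φ) = schwartzL2 (SchwartzMap.derivCLM ℂ ℂ φ) :=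
  (hasWeakDeriv_weakDeriv _).unique (hasWeakDeriv_schwartz φ)

@[simp]
theorem mulX_schwartzDomain (φ : 𝓢(ℝ, ℂ)) :
    mulX (schwartzDomain φ) = schwartzL2 (schwartzMulX φ) := by
  apply Lp.ext
  filter_upwards [coeFn_mulX (schwartzDomain φ), mulX_schwartz_ae φ,
    (schwartzMulX φ).coeFn_toLp 2 (volume : Measure ℝ)] with x h1 h2 h3
  rw [h1, h3]
  exact h2

/-! ### The Gaussian transform -/

open FourierTransform in
/-- Injectivity of the Fourier transform on `L¹`, by duality with test functions. -/
theorem ae_eq_zero_of_fourier_eq_zero {f : ℝ → ℂ} (hf : Integrable f) (h : ∀ ξ, 𝓕 f ξ = 0) :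
    f =ᵐ[volume] 0 := by
  apply ae_eq_zero_of_integral_contDiff_smul_eq_zero hf.locallyIntegrable
  intro g hg hgc
  have hg₁ : HasCompactSupport (Complex.ofRealCLM ∘ g) := hgc.comp_left rfl
  have hg₂ : ContDiff ℝ ((⊤ : ℕ∞) : WithTop ℕ∞) (Complex.ofRealCLM ∘ g) := by fun_prop
  set G : 𝓢(ℝ, ℂ) := hg₁.toSchwartzMap hg₂ with hG
  have hGa : ∀ x, G x = (g x : ℂ) := fun x => rfl
  have h0 := VectorFourier.integral_fourierIntegral_smul_eq_flip (L := innerₗ ℝ)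
    Real.continuous_fourierChar continuous_inner hf ((𝓕⁻ G : 𝓢(ℝ, ℂ)).integrable (μ := volume))
  rw [flip_innerₗ] at h0
  have key : ∫ ξ, (𝓕 f ξ) • ((𝓕⁻ G : 𝓢(ℝ, ℂ)) ξ) = ∫ x, f x • (𝓕 (𝓕⁻ G : 𝓢(ℝ, ℂ)) x) := h0
  have h2 : 𝓕 (𝓕⁻ G : 𝓢(ℝ, ℂ)) = G := FourierTransform.fourier_fourierInv_eq G
  rw [h2] at key
  simp only [h, zero_smul, integral_zero] at key
  rw [key]
  refine integral_congr_ae (Eventually.of_forall fun x => ?_)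
  simp only [hGa, smul_eq_mul, Complex.real_smul]
  ring

section GaussianTransform

variable {b : ℂ} (hb : b.re < 0)

/-- The weighted moments `∫ xᵏ exp (b x² + c x) u(x) dx` of a function `u ∈ L²(ℝ)`. -/
def gaussianMoment (u : L2) (k : ℕ) (c : ℂ) : ℂ :=
  ∫ x, (schwartzMulX ^ k) (gaussian hb c) x * u x

/-- The Gaussian transform `c ↦ ∫ exp (b x² + c x) u(x) dx` of `u ∈ L²(ℝ)`, a Bargmann transform
without its Gaussian prefactor. -/
def gaussianTransform (u : L2) (c : ℂ) : ℂ := ∫ x, gaussian hb c x * u x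

theorem gaussianMoment_zero (u : L2) : gaussianMoment hb u 0 = gaussianTransform hb u := by
  ext c
  simp [gaussianMoment, gaussianTransform]

/-- A bound uniform in the parameter, used to differentiate under the integral sign. -/
theorem norm_cexp_quadratic_le (b : ℂ) {c c' : ℂ} (h : c' ∈ Metric.ball c 1) (x : ℝ) :
    ‖Complex.exp (b * x ^ 2 + c' * x)‖ ≤
      ‖Complex.exp (b * x ^ 2 + (c + 1) * x)‖ + ‖Complex.exp (b * x ^ 2 + (c - 1) * x)‖ := by
  have hre : |(c' - c).re| ≤ 1 :=
    (Complex.abs_re_le_norm _).trans (by rw [← dist_eq_norm]; exact (Metric.mem_ball.1 h).le)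
  simp only [Complex.norm_exp]
  rw [Complex.sub_re, abs_le] at hre
  simp only [Complex.add_re, Complex.re_mul_ofReal, Complex.sub_re, Complex.one_re]
  rcases le_total 0 x with hx | hx
  · refine le_trans (Real.exp_le_exp.2 ?_) (le_add_of_nonneg_right (Real.exp_pos _).le)
    nlinarith
  · refine le_trans (Real.exp_le_exp.2 ?_) (le_add_of_nonneg_left (Real.exp_pos _).le)
    nlinarith

theorem hasDerivAt_gaussianMoment (u : L2) (k : ℕ) (c : ℂ) :
    HasDerivAt (gaussianMoment hb u k) (gaussianMoment hb u (k + 1) c) c := by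
  set bound : ℝ → ℝ := fun x =>
    ‖(schwartzMulX ^ (k + 1)) (gaussian hb (c + 1)) x * u x‖ +
      ‖(schwartzMulX ^ (k + 1)) (gaussian hb (c - 1)) x * u x‖
  refine (hasDerivAt_integral_of_dominated_loc_of_deriv_le (bound := bound)
    (F := fun c x => (schwartzMulX ^ k) (gaussian hb c) x * u x)
    (F' := fun c x => (schwartzMulX ^ (k + 1)) (gaussian hb c) x * u x)
    (Metric.ball_mem_nhds c one_pos) (Eventually.of_forall fun c' =>
      (integrable_schwartz_mul _ u).aestronglyMeasurable) (integrable_schwartz_mul _ u)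
    (integrable_schwartz_mul _ u).aestronglyMeasurable
    (Eventually.of_forall fun x c' hc' => ?_)
    ((integrable_schwartz_mul _ u).norm.add (integrable_schwartz_mul _ u).norm)
    (Eventually.of_forall fun x c' _ => ?_)).2
  · simp only [bound, schwartzMulX_pow_apply, gaussian_apply, norm_mul]
    rw [← add_mul, ← mul_add]
    gcongr
    exact norm_cexp_quadratic_le b hc' x
  · simp only [schwartzMulX_pow_apply, gaussian_apply]
    have h1 : HasDerivAt (fun c : ℂ => Complex.exp (b * x ^ 2 + c * x))
        (Complex.exp (b * x ^ 2 + c' * x) * x) c' := by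
      have := (((hasDerivAt_id c').mul_const (x : ℂ)).const_add (b * x ^ 2)).cexp
      simpa using this
    refine ((h1.const_mul ((x : ℂ) ^ k)).mul_const (u x)).congr_deriv ?_
    ring

theorem hasDerivAt_gaussianTransform (u : L2) (c : ℂ) :
    HasDerivAt (gaussianTransform hb u) (gaussianMoment hb u 1 c) c := by
  rw [← gaussianMoment_zero]
  exact hasDerivAt_gaussianMoment hb u 0 c

theorem differentiable_gaussianTransform (u : L2) : Differentiable ℂ (gaussianTransform hb u) :=
  fun c => (hasDerivAt_gaussianTransform hb u c).differentiableAt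

theorem iteratedDeriv_gaussianTransform (u : L2) (k : ℕ) :
    iteratedDeriv k (gaussianTransform hb u) = gaussianMoment hb u k := by
  induction k with
  | zero => rw [iteratedDeriv_zero, gaussianMoment_zero]
  | succ k ih =>
    rw [iteratedDeriv_succ, ih]
    ext c
    exact (hasDerivAt_gaussianMoment hb u k c).deriv

open FourierTransform in
/-- On the imaginary axis the Gaussian transform is the Fourier transform of
`exp (b x²) u(x)`. -/
theorem eq_zero_of_gaussianTransform_eq_zero {u : L2} (h : ∀ c, gaussianTransform hb u c = 0) :
    u = 0 := by
  have h0 : (fun x => gaussian hb 0 x * u x) =ᵐ[volume] 0 := by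
    refine ae_eq_zero_of_fourier_eq_zero (integrable_schwartz_mul _ u) fun ξ => ?_
    refine Eq.trans ?_ (h (-2 * Real.pi * ξ * Complex.I))
    rw [Real.fourier_real_eq_integral_exp_smul, gaussianTransform]
    refine integral_congr_ae (Eventually.of_forall fun x => ?_)
    simp only [gaussian_apply, smul_eq_mul, ← mul_assoc, ← Complex.exp_add]
    congr 2
    push_cast
    ring
  rw [Lp.eq_zero_iff_ae_eq_zero]
  filter_upwards [h0] with x hx
  simpa using hx

/-- An `L²` function orthogonal to all `xᵏ exp (b x²)` vanishes: these are the Taylor coefficients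
of its entire Gaussian transform. -/
theorem eq_zero_of_gaussianMoment_eq_zero {u : L2} (h : ∀ k, gaussianMoment hb u k 0 = 0) :
    u = 0 := by
  refine eq_zero_of_gaussianTransform_eq_zero hb fun c => ?_
  have hT := Complex.hasSum_taylorSeries_of_entire (differentiable_gaussianTransform hb u) 0 c
  simp only [iteratedDeriv_gaussianTransform, h, smul_zero] at hT
  exact hT.unique hasSum_zero

theorem gaussianTransform_mulX (u : formDomain) (c : ℂ) :
    gaussianTransform hb (mulX u) c = deriv (gaussianTransform hb (u : L2)) c := by
  rw [(hasDerivAt_gaussianTransform hb _ c).deriv, gaussianTransform,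
    integral_schwartz_mul_mulX, gaussianMoment, pow_one]

theorem gaussianTransform_weakDeriv (u : formDomain) (c : ℂ) :
    gaussianTransform hb (weakDeriv u) c =
      -(c * gaussianTransform hb (u : L2) c)
        - 2 * b * deriv (gaussianTransform hb (u : L2)) c := by
  rw [(hasDerivAt_gaussianTransform hb _ c).deriv, gaussianTransform,
    integral_schwartz_mul_weakDeriv, gaussianTransform, gaussianMoment, pow_one, deriv_gaussian,
    ← integral_const_mul, ← integral_const_mul, ← integral_neg, ← integral_neg, ← integral_sub]
  · refine integral_congr_ae (Eventually.of_forall fun x => ?_)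
    simp only [add_apply, smul_apply, smul_eq_mul]
    ring
  · exact ((integrable_schwartz_mul _ _).const_mul _).neg
  · exact (integrable_schwartz_mul _ _).const_mul _

theorem gaussianTransform_add (u v : L2) (c : ℂ) :
    gaussianTransform hb (u + v) c = gaussianTransform hb u c + gaussianTransform hb v c := by
  rw [gaussianTransform, gaussianTransform, gaussianTransform,
    ← integral_add (integrable_schwartz_mul _ _) (integrable_schwartz_mul _ _)]
  refine integral_congr_ae ?_
  filter_upwards [Lp.coeFn_add u v] with x hx
  rw [hx, Pi.add_apply, mul_add]

theorem gaussianTransform_smul (a : ℂ) (u : L2) (c : ℂ) :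
    gaussianTransform hb (a • u) c = a * gaussianTransform hb u c := by
  rw [gaussianTransform, gaussianTransform, ← integral_const_mul]
  refine integral_congr_ae ?_
  filter_upwards [Lp.coeFn_smul a u] with x hx
  rw [hx, Pi.smul_apply, smul_eq_mul]
  ring

theorem gaussianTransform_sub (u v : L2) (c : ℂ) :
    gaussianTransform hb (u - v) c = gaussianTransform hb u c - gaussianTransform hb v c := by
  rw [show u - v = u + (-1 : ℂ) • v by simp [sub_eq_add_neg], gaussianTransform_add,
    gaussianTransform_smul]
  ring

end GaussianTransform

/-! ### An Euler equation for entire functions -/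

/-- The Euler equation `c W' = ν W` has a nonzero entire solution only for `ν ∈ ℕ`: the Taylor
coefficients `wₙ` satisfy `(n - ν) wₙ = 0`. -/
theorem eq_zero_of_mul_deriv_eq {W : ℂ → ℂ} (hW : Differentiable ℂ W) {ν : ℂ}
    (hν : ∀ n : ℕ, ν ≠ n) (h : ∀ c, c * deriv W c = ν * W c) (c : ℂ) : W c = 0 := by
  have hn : ∀ n : ℕ, ∀ c, c * iteratedDeriv (n + 1) W c = (ν - n) * iteratedDeriv n W c := by
    intro n
    induction n with
    | zero => intro c; simpa using h c
    | succ n ih =>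
      intro c
      have hd : ∀ k : ℕ, Differentiable ℂ (iteratedDeriv k W) := fun k =>
        (hW.contDiff (n := ((⊤ : ℕ∞) : WithTop ℕ∞))).differentiable_iteratedDeriv k
          (by exact_mod_cast WithTop.coe_lt_top _)
      have e : (fun c => c * iteratedDeriv (n + 1) W c) = fun c => (ν - n) * iteratedDeriv n W c :=
        funext ih
      have h1 := ((hasDerivAt_id c).mul (hd (n + 1) c).hasDerivAt).deriv
      have h2 := ((hd n c).hasDerivAt.const_mul (ν - n)).deriv
      have h3 : deriv (fun c => c * iteratedDeriv (n + 1) W c) c =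
        deriv (fun c => (ν - n) * iteratedDeriv n W c) c := by rw [e]
      rw [h2] at h3
      change deriv (fun c => c * iteratedDeriv (n + 1) W c) c = _ at h1
      rw [h1, ← iteratedDeriv_succ, ← iteratedDeriv_succ] at h3
      simp only [id] at h3
      push_cast
      linear_combination h3
  have hz : ∀ n : ℕ, iteratedDeriv n W 0 = 0 := fun n => by
    have := hn n 0
    rw [zero_mul, eq_comm, mul_eq_zero] at this
    exact this.resolve_left (sub_ne_zero.2 (hν n))
  have hT := Complex.hasSum_taylorSeries_of_entire hW 0 c
  simp only [hz, smul_zero] at hT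
  exact hT.unique hasSum_zero

/-! ### Ladder operators -/

/-- The annihilation operator `∂ₓ + x : 𝒟 → L²(ℝ)`. -/
def lower : formDomain →ₗ[ℂ] L2 := weakDeriv + mulX

/-- The creation operator `-∂ₓ + x : 𝒟 → L²(ℝ)`. -/
def raise : formDomain →ₗ[ℂ] L2 := mulX - weakDeriv

theorem lower_apply (u : formDomain) : lower u = weakDeriv u + mulX u := rfl

theorem raise_apply (u : formDomain) : raise u = mulX u - weakDeriv u := rfl

/-- The annihilation operator on Schwartz functions. -/
def schwartzLower : 𝓢(ℝ, ℂ) →L[ℂ] 𝓢(ℝ, ℂ) := SchwartzMap.derivCLM ℂ ℂ + schwartzMulX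

/-- The creation operator on Schwartz functions. -/
def schwartzRaise : 𝓢(ℝ, ℂ) →L[ℂ] 𝓢(ℝ, ℂ) := schwartzMulX - SchwartzMap.derivCLM ℂ ℂ

theorem schwartzLower_apply (φ : 𝓢(ℝ, ℂ)) :
    schwartzLower φ = SchwartzMap.derivCLM ℂ ℂ φ + schwartzMulX φ := rfl

theorem schwartzRaise_apply (φ : 𝓢(ℝ, ℂ)) :
    schwartzRaise φ = schwartzMulX φ - SchwartzMap.derivCLM ℂ ℂ φ := rfl

theorem deriv_schwartzMulX (φ : 𝓢(ℝ, ℂ)) :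
    SchwartzMap.derivCLM ℂ ℂ (schwartzMulX φ) =
      φ + schwartzMulX (SchwartzMap.derivCLM ℂ ℂ φ) := by
  ext x
  have e : (schwartzMulX φ : ℝ → ℂ) = fun x : ℝ => (x : ℂ) * φ x :=
    funext fun x => schwartzMulX_apply φ x
  have h1 : HasDerivAt (fun x : ℝ => (x : ℂ)) 1 x := Complex.ofRealCLM.hasDerivAt
  rw [SchwartzMap.derivCLM_apply, e, (h1.fun_mul (φ.hasDerivAt x)).deriv, add_apply,
    schwartzMulX_apply, SchwartzMap.derivCLM_apply, one_mul]

/-- The canonical commutation relation `[a, a†] = 2`. -/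
theorem schwartzLower_schwartzRaise (φ : 𝓢(ℝ, ℂ)) :
    schwartzLower (schwartzRaise φ) = schwartzRaise (schwartzLower φ) + (2 : ℂ) • φ := by
  simp only [schwartzLower_apply, schwartzRaise_apply, map_add, map_sub, deriv_schwartzMulX,
    two_smul]
  abel

/-- Complex conjugation of Schwartz functions. -/
def schwartzConj : 𝓢(ℝ, ℂ) →L[ℝ] 𝓢(ℝ, ℂ) :=
  SchwartzMap.postcompCLM (Complex.conjCLE : ℂ →L[ℝ] ℂ)

@[simp]
theorem schwartzConj_apply (φ : 𝓢(ℝ, ℂ)) (x : ℝ) : schwartzConj φ x = starRingEnd ℂ (φ x) := by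
  simp [schwartzConj, SchwartzMap.postcompCLM_apply]

theorem inner_schwartz (φ : 𝓢(ℝ, ℂ)) (u : L2) :
    inner ℂ (schwartzL2 φ) u = ∫ x, schwartzConj φ x * u x := by
  rw [L2.inner_def]
  refine integral_congr_ae ?_
  filter_upwards [φ.coeFn_toLp 2 (volume : Measure ℝ)] with x hx
  rw [RCLike.inner_apply, hx, schwartzConj_apply, mul_comm]

theorem derivCLM_schwartzConj (φ : 𝓢(ℝ, ℂ)) :
    SchwartzMap.derivCLM ℂ ℂ (schwartzConj φ) = schwartzConj (SchwartzMap.derivCLM ℂ ℂ φ) := by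
  ext x
  have e : (schwartzConj φ : ℝ → ℂ) = fun x => star (φ x) := funext fun x => by
    rw [schwartzConj_apply, starRingEnd_apply]
  rw [schwartzConj_apply, SchwartzMap.derivCLM_apply, SchwartzMap.derivCLM_apply, e,
    deriv.star, starRingEnd_apply]

theorem schwartzMulX_schwartzConj (φ : 𝓢(ℝ, ℂ)) :
    schwartzMulX (schwartzConj φ) = schwartzConj (schwartzMulX φ) := by
  ext x
  simp

theorem inner_schwartz_weakDeriv (φ : 𝓢(ℝ, ℂ)) (u : formDomain) :
    inner ℂ (schwartzL2 φ) (weakDeriv u) =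
      -inner ℂ (schwartzL2 (SchwartzMap.derivCLM ℂ ℂ φ)) (u : L2) := by
  rw [inner_schwartz, inner_schwartz, integral_schwartz_mul_weakDeriv, derivCLM_schwartzConj]

theorem inner_schwartz_mulX (φ : 𝓢(ℝ, ℂ)) (u : formDomain) :
    inner ℂ (schwartzL2 φ) (mulX u) = inner ℂ (schwartzL2 (schwartzMulX φ)) (u : L2) := by
  rw [inner_schwartz, inner_schwartz, integral_schwartz_mul_mulX, schwartzMulX_schwartzConj]

theorem schwartzL2_add (φ ψ : 𝓢(ℝ, ℂ)) : schwartzL2 (φ + ψ) = schwartzL2 φ + schwartzL2 ψ :=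
  map_add (SchwartzMap.toLpCLM ℂ ℂ 2 volume) φ ψ

theorem schwartzL2_sub (φ ψ : 𝓢(ℝ, ℂ)) : schwartzL2 (φ - ψ) = schwartzL2 φ - schwartzL2 ψ :=
  map_sub (SchwartzMap.toLpCLM ℂ ℂ 2 volume) φ ψ

theorem schwartzL2_smul (c : ℂ) (φ : 𝓢(ℝ, ℂ)) : schwartzL2 (c • φ) = c • schwartzL2 φ :=
  map_smul (SchwartzMap.toLpCLM ℂ ℂ 2 volume) c φ

theorem schwartzL2_zero : schwartzL2 0 = 0 :=
  map_zero (SchwartzMap.toLpCLM ℂ ℂ 2 volume)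

theorem inner_schwartz_lower (φ : 𝓢(ℝ, ℂ)) (u : formDomain) :
    inner ℂ (schwartzL2 φ) (lower u) = inner ℂ (schwartzL2 (schwartzRaise φ)) (u : L2) := by
  rw [lower_apply, schwartzRaise_apply, schwartzL2_sub, inner_add_right, inner_sub_left,
    inner_schwartz_weakDeriv, inner_schwartz_mulX]
  ring

theorem inner_schwartz_raise (φ : 𝓢(ℝ, ℂ)) (u : formDomain) :
    inner ℂ (schwartzL2 φ) (raise u) = inner ℂ (schwartzL2 (schwartzLower φ)) (u : L2) := by
  rw [raise_apply, schwartzLower_apply, schwartzL2_add, inner_sub_right, inner_add_left,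
    inner_schwartz_weakDeriv, inner_schwartz_mulX]
  ring

theorem lower_schwartzDomain (φ : 𝓢(ℝ, ℂ)) :
    lower (schwartzDomain φ) = schwartzL2 (schwartzLower φ) := by
  rw [lower_apply, weakDeriv_schwartzDomain, mulX_schwartzDomain, ← schwartzL2_add]
  rfl

/-! ### Hermite functions -/

theorem neg_half_re_neg : (-(1 / 2) : ℂ).re < 0 := by norm_num

/-- The normalized Hermite functions. -/
def hermite : ℕ → 𝓢(ℝ, ℂ)
  | 0 => ((Real.sqrt (Real.sqrt Real.pi))⁻¹ : ℂ) • gaussian neg_half_re_neg 0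
  | n + 1 => ((Real.sqrt (2 * (n + 1)))⁻¹ : ℂ) • schwartzRaise (hermite n)

theorem sqrt_two_mul_succ_pos (n : ℕ) : 0 < Real.sqrt (2 * (n + 1)) :=
  Real.sqrt_pos.2 (by positivity)

theorem schwartzRaise_hermite (n : ℕ) :
    schwartzRaise (hermite n) = (Real.sqrt (2 * (n + 1)) : ℂ) • hermite (n + 1) := by
  have h : (Real.sqrt (2 * (n + 1)) : ℂ) ≠ 0 := by
    exact_mod_cast (sqrt_two_mul_succ_pos n).ne'
  rw [hermite, smul_smul, mul_inv_cancel₀ h, one_smul]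

theorem schwartzLower_hermite_zero : schwartzLower (hermite 0) = 0 := by
  rw [hermite, map_smul, schwartzLower_apply, deriv_gaussian]
  simp

theorem ofReal_sqrt_mul_self (n : ℕ) :
    (Real.sqrt (2 * (n + 1)) : ℂ) * (Real.sqrt (2 * (n + 1)) : ℂ) = 2 * (n + 1) := by
  rw [← Complex.ofReal_mul, Real.mul_self_sqrt (by positivity)]
  push_cast
  ring

theorem schwartzLower_hermite_succ (n : ℕ) :
    schwartzLower (hermite (n + 1)) = (Real.sqrt (2 * (n + 1)) : ℂ) • hermite n := by
  have h : ∀ n : ℕ, (Real.sqrt (2 * (n + 1)) : ℂ) ≠ 0 := fun n => by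
    exact_mod_cast (sqrt_two_mul_succ_pos n).ne'
  -- `a† a` is twice the number operator
  have key : schwartzRaise (schwartzLower (hermite n)) = (2 * n : ℂ) • hermite n := by
    induction n with
    | zero => rw [schwartzLower_hermite_zero]; simp
    | succ n ih =>
      rw [hermite, map_smul, map_smul, schwartzLower_schwartzRaise, ih, map_add, map_smul,
        map_smul, ← add_smul, smul_comm]
      push_cast
      congr 1
      ring
  rw [hermite, map_smul, schwartzLower_schwartzRaise, key, ← add_smul, smul_smul]
  congr 1
  rw [inv_mul_eq_iff_eq_mul₀ (h n), ofReal_sqrt_mul_self]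
  ring

theorem inner_self_eq_ofReal (u : L2) : inner ℂ u u = ((‖u‖ ^ 2 : ℝ) : ℂ) := by
  rw [inner_self_eq_norm_sq_to_K]
  norm_cast

theorem hermite_succ (n : ℕ) :
    hermite (n + 1) = ((Real.sqrt (2 * (n + 1)))⁻¹ : ℂ) • schwartzRaise (hermite n) := rfl

theorem norm_schwartzL2_hermite_zero : ‖schwartzL2 (hermite 0)‖ = 1 := by
  have h : inner ℂ (schwartzL2 (hermite 0)) (schwartzL2 (hermite 0)) = (1 : ℂ) := by
    refine (SchwartzMap.inner_toL2_toL2_eq (hermite 0) (hermite 0) volume).trans ?_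
    have e : ∀ x : ℝ, inner ℂ (hermite 0 x) (hermite 0 x) =
        (((Real.sqrt Real.pi)⁻¹ * Real.exp (-1 * x ^ 2) : ℝ) : ℂ) := by
      intro x
      have hn : ‖hermite 0 x‖ ^ 2 = (Real.sqrt Real.pi)⁻¹ * Real.exp (-1 * x ^ 2) := by
        have hre : (-(1 / 2) * (x : ℂ) ^ 2 + 0 * (x : ℂ)).re = -(1 / 2) * x ^ 2 := by
          norm_cast
          norm_num
          norm_cast
        rw [hermite, smul_apply, gaussian_apply, norm_smul, Complex.norm_exp, norm_inv,
          Complex.norm_real, mul_pow, inv_pow, Real.norm_of_nonneg (Real.sqrt_nonneg _),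
          Real.sq_sqrt (Real.sqrt_nonneg _), ← Real.exp_nat_mul, hre]
        congr 2
        push_cast
        ring
      rw [inner_self_eq_norm_sq_to_K, ← hn]
      norm_cast
    simp_rw [e]
    rw [integral_complex_ofReal, integral_const_mul, integral_gaussian, div_one,
      inv_mul_cancel₀ (Real.sqrt_ne_zero'.2 Real.pi_pos), Complex.ofReal_one]
  rw [inner_self_eq_ofReal] at h
  have h2 : ‖schwartzL2 (hermite 0)‖ ^ 2 = 1 := by exact_mod_cast h
  exact (pow_eq_one_iff_of_nonneg (norm_nonneg _) two_ne_zero).1 h2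

theorem inner_schwartzRaise_left (φ ψ : 𝓢(ℝ, ℂ)) :
    inner ℂ (schwartzL2 (schwartzRaise φ)) (schwartzL2 ψ) =
      inner ℂ (schwartzL2 φ) (schwartzL2 (schwartzLower ψ)) := by
  rw [← lower_schwartzDomain, inner_schwartz_lower, coe_schwartzDomain]

theorem orthonormal_hermite : Orthonormal ℂ fun n => schwartzL2 (hermite n) := by
  have key : ∀ n m : ℕ, inner ℂ (schwartzL2 (hermite n)) (schwartzL2 (hermite m)) =
      if n = m then (1 : ℂ) else 0 := by
    have h0 : ∀ n : ℕ, (Real.sqrt (2 * (n + 1)) : ℂ) ≠ 0 := fun n => by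
      exact_mod_cast (sqrt_two_mul_succ_pos n).ne'
    have hz : ∀ n : ℕ, inner ℂ (schwartzL2 (hermite (n + 1))) (schwartzL2 (hermite 0))
        = (0 : ℂ) := fun n => by
      rw [hermite_succ, schwartzL2_smul, inner_smul_left, inner_schwartzRaise_left,
        schwartzLower_hermite_zero, schwartzL2_zero, inner_zero_right, mul_zero]
    intro n
    induction n with
    | zero =>
      intro m
      rcases m with _ | m
      · rw [inner_self_eq_norm_sq_to_K, norm_schwartzL2_hermite_zero]; simp
      · rw [← inner_conj_symm, hz, map_zero]; simp
    | succ n ih =>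
      intro m
      rcases m with _ | m
      · rw [hz]; simp
      · rw [hermite_succ, schwartzL2_smul, inner_smul_left, inner_schwartzRaise_left,
          schwartzLower_hermite_succ, schwartzL2_smul, inner_smul_right, ih]
        by_cases hnm : n = m
        · subst hnm
          rw [if_pos rfl, if_pos rfl, mul_one, map_inv₀, Complex.conj_ofReal,
            inv_mul_cancel₀ (h0 n)]
        · rw [if_neg hnm, if_neg (by omega), mul_zero, mul_zero]
  rw [orthonormal_iff_ite]
  exact key

theorem schwartzMulX_eq (φ : 𝓢(ℝ, ℂ)) :
    schwartzMulX φ = (1 / 2 : ℂ) • (schwartzRaise φ + schwartzLower φ) := by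
  rw [schwartzRaise_apply, schwartzLower_apply]
  ext x
  simp only [smul_apply, add_apply, sub_apply, smul_eq_mul]
  ring

/-- Completeness of the Hermite functions: multiplication by `x` preserves their span, hence
orthogonality to them makes all Gaussian moments vanish. -/
theorem eq_zero_of_inner_hermite_eq_zero {u : L2}
    (h : ∀ n, inner ℂ (schwartzL2 (hermite n)) u = (0 : ℂ)) : u = 0 := by
  have h1 : ∀ k n, inner ℂ (schwartzL2 ((schwartzMulX ^ k) (hermite n))) u = (0 : ℂ) := by
    intro k
    induction k with
    | zero => intro n; simpa using h n
    | succ k ih =>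
      intro n
      rw [pow_succ, mul_apply_eq_comp, schwartzMulX_eq, map_smul, map_add, schwartzRaise_hermite,
        map_smul, schwartzL2_smul, schwartzL2_add, schwartzL2_smul, inner_smul_left,
        inner_add_left, inner_smul_left, ih, mul_zero, zero_add]
      rcases n with _ | n
      · rw [schwartzLower_hermite_zero, map_zero, schwartzL2_zero, inner_zero_left, mul_zero]
      · rw [schwartzLower_hermite_succ, map_smul, schwartzL2_smul, inner_smul_left, ih, mul_zero,
          mul_zero]
  refine eq_zero_of_gaussianMoment_eq_zero neg_half_re_neg fun k => ?_
  have h2 := h1 k 0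
  have h0 : ((Real.sqrt (Real.sqrt Real.pi))⁻¹ : ℂ) ≠ 0 := by
    refine inv_ne_zero ?_
    exact_mod_cast (Real.sqrt_pos.2 (Real.sqrt_pos.2 Real.pi_pos)).ne'
  rw [hermite, map_smul, schwartzL2_smul, inner_smul_left, mul_eq_zero, map_eq_zero] at h2
  have h3 := h2.resolve_left h0
  rw [inner_schwartz] at h3
  refine Eq.trans ?_ h3
  rw [gaussianMoment]
  refine integral_congr_ae (Eventually.of_forall fun x => ?_)
  simp only [schwartzConj_apply, schwartzMulX_pow_apply, gaussian_apply, map_mul, map_pow,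
    Complex.conj_ofReal, ← Complex.exp_conj, map_add, map_neg, map_zero, map_div₀, map_one,
    map_ofNat]

/-- The Hermite functions as a Hilbert basis of `L²(ℝ)`. -/
def hermiteBasis : HilbertBasis ℕ ℂ L2 :=
  HilbertBasis.mkOfOrthogonalEqBot orthonormal_hermite <| by
    rw [Submodule.eq_bot_iff]
    intro u hu
    refine eq_zero_of_inner_hermite_eq_zero fun n => ?_
    exact (Submodule.mem_orthogonal _ _).1 hu _ (Submodule.subset_span ⟨n, rfl⟩)

@[simp]
theorem hermiteBasis_apply (n : ℕ) : hermiteBasis n = schwartzL2 (hermite n) := by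
  rw [hermiteBasis, HilbertBasis.coe_mkOfOrthogonalEqBot]

/-! ### Identities on the domain -/

/-- The `n`-th Hermite coefficient. -/
def coef (n : ℕ) (u : L2) : ℂ := inner ℂ (schwartzL2 (hermite n)) u

theorem coef_lower (n : ℕ) (u : formDomain) :
    coef n (lower u) = Real.sqrt (2 * (n + 1)) * coef (n + 1) u := by
  rw [coef, inner_schwartz_lower, schwartzRaise_hermite, schwartzL2_smul, inner_smul_left,
    Complex.conj_ofReal, coef]

theorem coef_raise_zero (u : formDomain) : coef 0 (raise u) = 0 := by
  rw [coef, inner_schwartz_raise, schwartzLower_hermite_zero, schwartzL2_zero, inner_zero_left]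

theorem coef_raise_succ (n : ℕ) (u : formDomain) :
    coef (n + 1) (raise u) = Real.sqrt (2 * (n + 1)) * coef n u := by
  rw [coef, inner_schwartz_raise, schwartzLower_hermite_succ, schwartzL2_smul, inner_smul_left,
    Complex.conj_ofReal, coef]

theorem hasSum_inner (u v : L2) :
    HasSum (fun n => starRingEnd ℂ (coef n u) * coef n v) (inner ℂ u v) := by
  have h := hermiteBasis.hasSum_inner_mul_inner u v
  simpa only [hermiteBasis_apply, ← inner_conj_symm u, coef] using h

theorem hasSum_norm_sq (u : L2) : HasSum (fun n => ‖coef n u‖ ^ 2) (‖u‖ ^ 2) := by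
  have h := hasSum_inner u u
  rw [inner_self_eq_ofReal] at h
  have e : ∀ n, starRingEnd ℂ (coef n u) * coef n u = ((‖coef n u‖ ^ 2 : ℝ) : ℂ) := fun n => by
    rw [mul_comm, Complex.mul_conj, Complex.normSq_eq_norm_sq]
  simp only [e] at h
  exact Complex.hasSum_ofReal.1 h

/-- The creation operator is the adjoint of the annihilation operator. -/
theorem inner_raise_left (u v : formDomain) :
    inner ℂ (raise u) (v : L2) = inner ℂ (u : L2) (lower v) := by
  have h1 := (hasSum_nat_add_iff' 1).2 (hasSum_inner (raise u) (v : L2))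
  have h2 := hasSum_inner (u : L2) (lower v)
  simp only [Finset.range_one, Finset.sum_singleton, coef_raise_zero, map_zero, zero_mul,
    sub_zero, coef_raise_succ, map_mul, Complex.conj_ofReal] at h1
  simp only [coef_lower] at h2
  refine h1.unique (h2.congr_fun ?_)
  intro n
  ring

theorem inner_lower_left (u v : formDomain) :
    inner ℂ (lower u) (v : L2) = inner ℂ (u : L2) (raise v) := by
  rw [← inner_conj_symm, ← inner_raise_left, inner_conj_symm]

theorem hasSum_norm_sq_lower (u : formDomain) :
    HasSum (fun n : ℕ => 2 * n * ‖coef n (u : L2)‖ ^ 2) (‖lower u‖ ^ 2) := by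
  have h := hasSum_norm_sq (lower u)
  have h2 : HasSum (fun n : ℕ => 2 * ((n + 1 : ℕ) : ℝ) * ‖coef (n + 1) (u : L2)‖ ^ 2)
      (‖lower u‖ ^ 2) := by
    refine h.congr_fun fun n => ?_
    rw [coef_lower, norm_mul, mul_pow, Complex.norm_real,
      Real.norm_of_nonneg (Real.sqrt_nonneg _), Real.sq_sqrt (by positivity)]
    push_cast
    ring
  refine (hasSum_nat_add_iff' 1).1 ?_
  simpa using h2

/-- The commutation relation on the whole domain. -/
theorem norm_sq_raise (u : formDomain) :
    ‖raise u‖ ^ 2 = ‖lower u‖ ^ 2 + 2 * ‖(u : L2)‖ ^ 2 := by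
  have h := (hasSum_norm_sq_lower u).add ((hasSum_norm_sq (u : L2)).mul_left 2)
  have h1 := (hasSum_nat_add_iff' 1).2 (hasSum_norm_sq (raise u))
  simp only [Finset.range_one, Finset.sum_singleton, coef_raise_zero, norm_zero,
    coef_raise_succ] at h1
  have h2 := h1.unique (h.congr_fun fun n => ?_)
  · simpa using h2
  · rw [norm_mul, mul_pow, Complex.norm_real,
      Real.norm_of_nonneg (Real.sqrt_nonneg _), Real.sq_sqrt (by positivity)]
    ring

/-! ### Lower bounds for the `2 × 2` blocks -/

section abstractBound

variable {E : Type*} [NormedAddCommGroup E] [InnerProductSpace ℂ E]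

theorem sq_sub_sq_mul_le_norm_add_sq (X Y : E) (τ : ℝ) :
    (1 - τ ^ 2) * (‖X‖ ^ 2 - ‖Y‖ ^ 2) ≤ ‖X + (Complex.I * τ) • Y‖ ^ 2 := by
  rw [norm_add_sq (𝕜 := ℂ), norm_smul, norm_mul, Complex.norm_I, Complex.norm_real]
  have h : |RCLike.re (inner ℂ X ((Complex.I * τ) • Y))| ≤ ‖X‖ * (|τ| * ‖Y‖) := by
    refine (RCLike.abs_re_le_norm _).trans ((norm_inner_le_norm _ _).trans (le_of_eq ?_))
    rw [norm_smul, norm_mul, Complex.norm_I, Complex.norm_real, one_mul, Real.norm_eq_abs]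
  have h2 := neg_abs_le (RCLike.re (inner ℂ X ((Complex.I * τ) • Y)))
  rw [one_mul, Real.norm_eq_abs]
  nlinarith [sq_nonneg (|τ| * ‖X‖ - ‖Y‖), sq_abs τ]

theorem re_inner_smul_I (p q : E) (r : ℝ) :
    RCLike.re (inner ℂ p ((Complex.I * r) • q)) = -(r * (inner ℂ p q).im) := by
  rw [inner_smul_right]
  simp

/-- The norms of the rotated ladder operators, expressed through the unrotated ones. -/
theorem norm_sq_rotated_sub (p q : E) (c s : ℝ) :
    ‖(c : ℂ) • q - (Complex.I * s) • p‖ ^ 2 - ‖(c : ℂ) • p + (Complex.I * s) • q‖ ^ 2 =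
      (c ^ 2 - s ^ 2) * (‖q‖ ^ 2 - ‖p‖ ^ 2) := by
  have e (x y : E) (r : ℝ) : RCLike.re (inner ℂ ((c : ℂ) • x) ((Complex.I * r) • y)) =
      -(c * r * (inner ℂ x y).im) := by
    rw [re_inner_smul_I, inner_smul_left, Complex.conj_ofReal]
    simp [Complex.mul_im]
    ring
  have n (x : E) (r : ℝ) : ‖(Complex.I * (r : ℂ)) • x‖ ^ 2 = r ^ 2 * ‖x‖ ^ 2 := by
    rw [norm_smul, norm_mul, Complex.norm_I, Complex.norm_real, one_mul, mul_pow,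
      Real.norm_eq_abs, sq_abs]
  have n' (x : E) : ‖(c : ℂ) • x‖ ^ 2 = c ^ 2 * ‖x‖ ^ 2 := by
    rw [norm_smul, Complex.norm_real, mul_pow, Real.norm_eq_abs, sq_abs]
  have hs : (inner ℂ q p).im = -(inner ℂ p q).im := by
    rw [← inner_conj_symm, Complex.conj_im]
  rw [norm_add_sq (𝕜 := ℂ), norm_sub_sq (𝕜 := ℂ), e, e, n, n, n', n', hs]
  ring

/-- A lower bound that is effective when `z` is not too far from the imaginary axis: completing
the square after passing to the rotated ladder operators. -/
theorem rotated_lower_bound {u v p q Q : E} {c s : ℝ} (hcs : c ^ 2 + s ^ 2 = 1)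
    (hG : 0 < c ^ 2 - s ^ 2) (hpq : ‖q‖ ^ 2 = ‖p‖ ^ 2 + 2 * ‖v‖ ^ 2)
    (hadj : inner ℂ ((c : ℂ) • q - (Complex.I * s) • p) u = inner ℂ v Q) (m a b : ℝ) (z : ℂ)
    (hz : z = a + b * Complex.I) :
    (c ^ 2 - s ^ 2) ^ 2 * ((m - a) ^ 2 + b ^ 2) * ‖u‖ ^ 2 +
      (2 * (c ^ 2 - s ^ 2) * (1 + m ^ 2 - a ^ 2 + b ^ 2) -
        (c ^ 2 - s ^ 2) ^ 2 * ((m - a) ^ 2 + b ^ 2)) * ‖v‖ ^ 2 ≤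
      ‖((m : ℂ) - z) • u + ((c : ℂ) • q + (Complex.I * s) • p)‖ ^ 2 +
        ‖Q - ((m : ℂ) + z) • v‖ ^ 2 := by
  set G := c ^ 2 - s ^ 2 with hGdef
  set f := ((m : ℂ) - z) • u + ((c : ℂ) • q + (Complex.I * s) • p) with hf
  set W := (c : ℂ) • q - (Complex.I * s) • p with hW
  set Y := (c : ℂ) • p + (Complex.I * s) • q with hY
  have hcs' : (c : ℂ) ^ 2 + (s : ℂ) ^ 2 = 1 := by exact_mod_cast hcs
  -- for `p = a v` and `q = a† v`, `Y` is the rotated annihilation operator applied to `v`, and `W`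
  -- is its adjoint applied to `v`
  have hf1 : (G : ℂ) • f = (W + ((G : ℂ) * (m - z)) • u) +
      (Complex.I * ((2 * c * s : ℝ) : ℂ)) • Y := by
    have e1 : (G : ℂ) * c = c - 2 * c * s ^ 2 := by
      rw [hGdef]
      push_cast
      linear_combination (c : ℂ) * hcs'
    have e2 : (G : ℂ) * s = -s + 2 * c ^ 2 * s := by
      rw [hGdef]
      push_cast
      linear_combination (-s : ℂ) * hcs'
    have e3 : (Complex.I * ((2 * c * s : ℝ) : ℂ)) * (Complex.I * s) = -(2 * c * s ^ 2) := by
      push_cast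
      linear_combination (2 * c * s ^ 2 : ℂ) * Complex.I_sq
    rw [hf, hW, hY, smul_add, smul_add, smul_add, smul_smul, smul_smul, smul_smul, smul_smul,
      smul_smul, e1, e3, mul_left_comm (G : ℂ), e2]
    push_cast
    module
  have h1 : ‖W + ((G : ℂ) * (m - z)) • u‖ ^ 2 - ‖Y‖ ^ 2 ≤ ‖f‖ ^ 2 := by
    have h := sq_sub_sq_mul_le_norm_add_sq (W + ((G : ℂ) * (m - z)) • u) Y (2 * c * s)
    have e : 1 - (2 * c * s) ^ 2 = G ^ 2 := by
      rw [hGdef]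
      linear_combination (-(1 + c ^ 2 + s ^ 2)) * hcs
    rw [e, ← hf1, norm_smul, Complex.norm_real, mul_pow, Real.norm_eq_abs, sq_abs] at h
    exact le_of_mul_le_mul_left h (by positivity)
  have hn1 : ‖(m : ℂ) - z‖ ^ 2 = (m - a) ^ 2 + b ^ 2 := by
    rw [hz, Complex.sq_norm, Complex.normSq_apply]
    simp
    ring
  have hn2 : ‖(m : ℂ) + z‖ ^ 2 = (m + a) ^ 2 + b ^ 2 := by
    rw [hz, Complex.sq_norm, Complex.normSq_apply]
    simp
    ring
  have h2 := norm_sq_rotated_sub p q c s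
  rw [← hW, ← hY, hpq] at h2
  rw [norm_add_sq (𝕜 := ℂ), inner_smul_right, hadj, norm_smul, norm_mul, Complex.norm_real,
    mul_pow, mul_pow, hn1, Real.norm_eq_abs, sq_abs] at h1
  have h3 : ‖Q - ((m : ℂ) + z) • v‖ ^ 2 = ‖Q‖ ^ 2 -
      2 * (starRingEnd ℂ ((m : ℂ) + z) * inner ℂ v Q).re + ((m + a) ^ 2 + b ^ 2) * ‖v‖ ^ 2 := by
    rw [norm_sub_sq (𝕜 := ℂ), norm_smul, mul_pow, hn2, ← inner_conj_symm, inner_smul_left,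
      RCLike.conj_re]
    rfl
  set K : ℂ := (G : ℂ) * (m - z) - starRingEnd ℂ ((m : ℂ) + z) with hK
  have h4 : RCLike.re ((G : ℂ) * (m - z) * inner ℂ v Q) -
      (starRingEnd ℂ ((m : ℂ) + z) * inner ℂ v Q).re = (K * inner ℂ v Q).re := by
    rw [hK, sub_mul, Complex.sub_re]
    rfl
  have h5 : -(‖K‖ * (‖v‖ * ‖Q‖)) ≤ (K * inner ℂ v Q).re := by
    have h := Complex.abs_re_le_norm (K * inner ℂ v Q)
    rw [norm_mul] at h
    have h' := mul_le_mul_of_nonneg_left (norm_inner_le_norm (𝕜 := ℂ) v Q) (norm_nonneg K)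
    linarith [neg_abs_le (K * inner ℂ v Q).re]
  have h6 : ‖K‖ ^ 2 = G ^ 2 * ((m - a) ^ 2 + b ^ 2) + ((m + a) ^ 2 + b ^ 2) -
      2 * G * (m ^ 2 - a ^ 2 + b ^ 2) := by
    rw [hK, hz, Complex.sq_norm, Complex.normSq_apply]
    simp
    ring
  -- the cross terms in `⟪v, Q⟫` combine with the coefficient `K` and are absorbed in `‖Q‖²`
  rw [h3]
  nlinarith [sq_nonneg (‖Q‖ - ‖K‖ * ‖v‖)]

end abstractBound

theorem quadratic_nonneg_of_discrim {L M C x : ℝ} (hL : 0 < L) (h : M ^ 2 ≤ L * C) :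
    0 ≤ L * x ^ 2 - 2 * M * x + C := by
  have h1 : 0 ≤ L * (L * x ^ 2 - 2 * M * x + C) := by nlinarith [sq_nonneg (L * x - M)]
  exact nonneg_of_mul_nonneg_right h1 hL

theorem discrim_le_of_one_half_le_sq {A β : ℝ} (hA : 0 < A) (hβ : 0 < β) (hA2 : 1 / 2 ≤ A ^ 2) :
    β ^ 2 * (A ^ 2 + 1) ^ 2 ≤ A * (A ^ 2 + 2 * A * β) * (A * (β ^ 2 + 2 * A * β)) := by
  have h1 : 2 * A ^ 2 + 1 ≤ 8 * A ^ 4 := by nlinarith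
  have h2 : 8 * A ^ 4 * β ≤ 2 * A ^ 3 * (A + β) ^ 2 := by
    have := mul_nonneg (pow_pos hA 3).le (sq_nonneg (A - β))
    nlinarith
  have h3 : β * (A ^ 2 + 1) ^ 2 ≤ A ^ 3 * (2 * A ^ 2 + 5 * A * β + 2 * β ^ 2) := by nlinarith
  nlinarith [mul_le_mul_of_nonneg_left h3 hβ.le]

/-- The inequality of `mul_sq_le_of_compression` for `a ≤ 0` and for `1 ≤ a`, with `A = |a|`. Once
`κ` is eliminated it is quadratic in `x`, with nonpositive discriminant. -/
theorem mul_sq_le_of_one_half_le_sq {A β m x κ q : ℝ} (hA : 0 < A) (hβ : 0 < β) (hm : 0 ≤ m)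
    (hA2 : 1 / 2 ≤ A ^ 2) (hq0 : 0 ≤ q) (hq1 : q ≤ 1)
    (hκ : A * κ ≤ x - m ∨ (A * κ ≤ x + m ∧ 1 ≤ A * (A + m + β))) :
    β ^ 2 * ((x + A) ^ 2 - m ^ 2 + 2 * q * κ) ≤ (A + m + β) ^ 2 * (x ^ 2 + β ^ 2) := by
  have hL : A ^ 2 + 2 * A * β ≤ (A + m + β) ^ 2 - β ^ 2 := by
    nlinarith [mul_nonneg hm hA.le, mul_nonneg hm hβ.le]
  have hC : β ^ 2 + 2 * A * β ≤ (A + m + β) ^ 2 - A ^ 2 := by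
    nlinarith [mul_nonneg hm hA.le, mul_nonneg hm hβ.le]
  have hL0 : 0 < A ^ 2 + 2 * A * β := by positivity
  have hC0 : 0 < β ^ 2 + 2 * A * β := by positivity
  have hd := discrim_le_of_one_half_le_sq hA hβ hA2
  rcases le_or_gt (q * κ) 0 with h0 | h0
  · have h := quadratic_nonneg_of_discrim (L := (A + m + β) ^ 2 - β ^ 2) (M := β ^ 2 * A)
      (C := β ^ 2 * ((A + m + β) ^ 2 - A ^ 2 + m ^ 2)) (x := x) (hL0.trans_le hL) (by
        have := mul_le_mul hL hC hC0.le (hL0.le.trans hL)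
        have h2 : A ^ 2 * β ^ 2 ≤ (A ^ 2 + 2 * A * β) * (β ^ 2 + 2 * A * β) := by
          nlinarith [mul_pos hA hβ, mul_pos (mul_pos hA hβ) (mul_pos hA hA),
            mul_pos (mul_pos hA hβ) (mul_pos hβ hβ), sq_nonneg (A * β)]
        have h3 := mul_nonneg (hL0.le.trans hL) (sq_nonneg m)
        have h4 : A ^ 2 * β ^ 2 ≤
            ((A + m + β) ^ 2 - β ^ 2) * ((A + m + β) ^ 2 - A ^ 2 + m ^ 2) := by
          linarith
        nlinarith [mul_le_mul_of_nonneg_left h4 (sq_nonneg β)])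
    nlinarith [mul_nonneg (sq_nonneg β) (neg_nonneg.2 h0)]
  · -- multiply by `A`
    have hC' : ∃ D, A * (β ^ 2 + 2 * A * β) ≤ D ∧
        D + 2 * (A * (q * κ)) ≤ A * ((A + m + β) ^ 2 - A ^ 2 + m ^ 2) + 2 * x := by
      have hκ0 : 0 < κ := pos_of_mul_pos_right h0 hq0
      have h1 : A * (q * κ) ≤ A * κ := by nlinarith [mul_pos hA hκ0]
      rcases hκ with hκ | ⟨hκ, hA3⟩
      · refine ⟨A * ((A + m + β) ^ 2 - A ^ 2 + m ^ 2) + 2 * m, ?_, by linarith⟩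
        nlinarith [mul_le_mul_of_nonneg_left hC hA.le, mul_nonneg hA.le (sq_nonneg m)]
      · refine ⟨A * ((A + m + β) ^ 2 - A ^ 2 + m ^ 2) - 2 * m, ?_, by linarith⟩
        nlinarith [mul_le_mul_of_nonneg_left hA3 hm]
    obtain ⟨D, hD1, hD2⟩ := hC'
    have h := quadratic_nonneg_of_discrim (L := A * ((A + m + β) ^ 2 - β ^ 2))
      (M := β ^ 2 * (A ^ 2 + 1)) (C := β ^ 2 * D) (x := x) (by nlinarith [mul_pos hA hL0]) (by
        have h1 : A * (A ^ 2 + 2 * A * β) * (A * (β ^ 2 + 2 * A * β)) ≤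
            A * ((A + m + β) ^ 2 - β ^ 2) * D :=
          mul_le_mul (mul_le_mul_of_nonneg_left hL hA.le) hD1 (by positivity)
            (mul_nonneg hA.le (hL0.le.trans hL))
        nlinarith [mul_le_mul_of_nonneg_left (hd.trans h1) (sq_nonneg β)])
    have h2 := mul_le_mul_of_nonneg_left hD2 (sq_nonneg β)
    have h3 : 0 ≤ A * ((A + m + β) ^ 2 * (x ^ 2 + β ^ 2) -
        β ^ 2 * ((x + A) ^ 2 - m ^ 2 + 2 * q * κ)) := by nlinarith
    linarith [nonneg_of_mul_nonneg_right h3 hA]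

theorem discrim_le_of_two_thirds_le_sq {a β : ℝ} (ha1 : a ≤ 1) (ha2 : 2 / 3 ≤ a ^ 2) (ha0 : 0 < a)
    (hβ : 1 / 10 ≤ β) :
    β ^ 2 * (a ^ 2 + 1) ^ 2 ≤ a * (a ^ 2 + 2 * a * β) * (a * (β ^ 2 + 2 * a * β) - a / 12) := by
  have h1 : (a ^ 2 + 1) ^ 2 ≤ 25 / 6 * a ^ 2 := by
    have : a ^ 2 ≤ 1 := by nlinarith
    nlinarith [mul_nonneg (sub_nonneg.2 ha2) (sub_nonneg.2 this)]
  have ha3 : 4 / 5 ≤ a := by nlinarith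
  have hmul : (a ^ 2 + 8 / 5 * β) * (β ^ 2 + 8 / 5 * β - 1 / 12) ≤
      (a ^ 2 + 2 * a * β) * (β ^ 2 + 2 * a * β - 1 / 12) :=
    mul_le_mul (by nlinarith) (by nlinarith) (by nlinarith) (by positivity)
  have h2 : 25 / 6 * β ^ 2 ≤ (2 / 3 + 8 / 5 * β) * (β ^ 2 + 8 / 5 * β - 1 / 12) := by
    nlinarith [mul_nonneg (by linarith : (0 : ℝ) ≤ β) (sq_nonneg (β - 3 / 10)),
      sq_nonneg (β - 3 / 10),
      mul_nonneg (by linarith : (0 : ℝ) ≤ β) (sub_nonneg.2 hβ)]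
  have h3 : (2 / 3 + 8 / 5 * β) * (β ^ 2 + 8 / 5 * β - 1 / 12) ≤
      (a ^ 2 + 8 / 5 * β) * (β ^ 2 + 8 / 5 * β - 1 / 12) :=
    mul_le_mul_of_nonneg_right (by linarith) (by nlinarith)
  have h4 := mul_le_mul_of_nonneg_left (h2.trans (h3.trans hmul)) (sq_nonneg a)
  nlinarith [mul_le_mul_of_nonneg_left h1 (sq_nonneg β)]

theorem four_fifths_le {a : ℝ} (ha0 : 0 < a) (ha2 : 2 / 3 ≤ a ^ 2) : 4 / 5 ≤ a := by nlinarith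

theorem two_fifths_le_sub {a m : ℝ} (ha0 : 4 / 5 ≤ a) (ha1 : a < 1)
    (hcase : 2 + (m + a) ^ 2 < 4 * a ^ 2) : 2 / 5 ≤ a - m := by
  by_contra! hd
  nlinarith

theorem le_of_sq_le_mul {σ β q : ℝ} (hσ : 4 / 5 ≤ σ) (hβ : β < 1 / 10) (hβ0 : 0 < β)
    (hq : σ ^ 2 ≤ q * (σ ^ 2 + β ^ 2)) : 98 / 100 ≤ q := by
  by_contra! hq2
  have h1 : 64 / 100 ≤ σ ^ 2 := by nlinarith
  have h2 : β ^ 2 ≤ 1 / 100 := by nlinarith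
  have h3 : q * (σ ^ 2 + β ^ 2) ≤ 98 / 100 * (σ ^ 2 + β ^ 2) :=
    mul_le_mul_of_nonneg_right hq2.le (by positivity)
  linarith

/-- For `0 < a < 1` and small `β`, the hypothesis `hgap` keeps `x` away from `0`: were `x < 3β/5`,
then `κ` would be too far below `1` for `hgap` to hold, `a` being at least `2/5` above `m`. -/
theorem three_fifths_mul_le_of_gap {a β m x κ q U : ℝ} (ha0 : 0 < a) (ha1 : a < 1)
    (hβ : β < 1 / 10) (hβ0 : 0 < β)
    (hm : 0 ≤ m) (hx0 : 0 ≤ x) (hκ1 : κ ≤ 1)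
    (ha2 : 2 / 3 ≤ a ^ 2) (hcase : 2 + (m + a) ^ 2 < 4 * a ^ 2) (hκ : a * κ ≤ x + m)
    (hq : (a + m + β) ^ 2 ≤ q * ((a + m + β) ^ 2 + β ^ 2))
    (hU : 0 ≤ U) (hUκ : 2 * U ^ 2 = 1 + κ) (hgap : q * (1 - κ) ≤ (x + (a - m) * U) ^ 2) :
    3 / 5 * β ≤ x := by
  by_contra! hx
  have ha3 := four_fifths_le ha0 ha2
  have hd := two_fifths_le_sub ha3 ha1 hcase
  have hU1 : U ≤ 1 := by
    rw [← sq_le_one_iff₀ hU]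
    linarith
  have hq2 : 98 / 100 ≤ q := le_of_sq_le_mul (by linarith) hβ hβ0 hq
  have hx1 : x < 6 / 100 := by linarith
  obtain ⟨d, rfl⟩ : ∃ d, m = a - d := ⟨a - m, by ring⟩
  have hd1 : d ≤ 1 := by linarith
  have e1 : a - (a - d) = d := by ring
  rw [e1] at hgap hd
  have h1 := mul_le_mul_of_nonneg_left hgap (by linarith : 0 ≤ 2 * a)
  have h2 : 2 * q * (d - x) ≤ 2 * a * (q * (1 - κ)) := by
    have := mul_le_mul_of_nonneg_left (by linarith : d - x ≤ a * (1 - κ))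
      (by linarith : 0 ≤ 2 * q)
    linarith
  have hd0 : 0 ≤ d := by linarith
  have hxd := mul_nonneg hx0 hd0
  have h3 : 2 * a * (x + d * U) ^ 2 ≤ 2 * x ^ 2 + 4 * (x * d) + d ^ 2 * (2 * a - d + x) := by
    have h4 : a * U * (x * d) ≤ 1 * (x * d) :=
      mul_le_mul_of_nonneg_right (mul_le_one₀ ha1.le hU hU1) hxd
    have h5 : 2 * a * U ^ 2 = a + a * κ := by linear_combination a * hUκ
    have h6 : d ^ 2 * (2 * a * U ^ 2) ≤ d ^ 2 * (2 * a - d + x) :=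
      mul_le_mul_of_nonneg_left (by linarith) (sq_nonneg d)
    have h7 : a * x ^ 2 ≤ 1 * x ^ 2 := mul_le_mul_of_nonneg_right ha1.le (sq_nonneg x)
    have e : 2 * a * (x + d * U) ^ 2 =
      2 * (a * x ^ 2) + 4 * (a * U * (x * d)) + d ^ 2 * (2 * a * U ^ 2) := by ring
    rw [e]
    linarith
  have h7 : d ^ 2 * (2 * a - d + x) ≤ d + x * d := by
    have h8 : d * (2 * a - d) ≤ 1 := by nlinarith [sq_nonneg (a - d)]
    have h9 := mul_le_mul_of_nonneg_left h8 hd0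
    have h10 := mul_le_mul_of_nonneg_right hd1 hxd
    have e : d ^ 2 * (2 * a - d + x) = d * (d * (2 * a - d)) + d * (x * d) := by ring
    rw [e]
    linarith
  have h11 : 98 / 100 * (d - x) ≤ q * (d - x) := mul_le_mul_of_nonneg_right hq2 (by linarith)
  have h12 : x * x ≤ 6 / 100 * x := mul_le_mul_of_nonneg_right hx1.le hx0
  have h13 : x * d ≤ 6 / 100 * d := mul_le_mul_of_nonneg_right hx1.le hd0
  linarith

/-- The inequality of `mul_sq_le_of_compression` for `0 < a < 1`. It is again quadratic in `x`; the
loss `a / 12` bounds the terms linear in `m`. For `1 / 10 ≤ β` its discriminant is nonpositive, and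
for smaller `β` it is nonnegative on `x ≥ 3β/5`. -/
theorem mul_sq_le_of_lt_one {a β m x κ q : ℝ} (ha0 : 0 < a) (ha1 : a < 1) (hβ0 : 0 < β)
    (hm : 0 ≤ m) (hq0 : 0 ≤ q) (hq1 : q ≤ 1) (hx : 3 / 5 * β ≤ x ∨ 1 / 10 ≤ β) (hx0 : 0 ≤ x)
    (ha2 : 2 / 3 ≤ a ^ 2) (hκ : a * κ ≤ x + m) :
    β ^ 2 * ((x + a) ^ 2 - m ^ 2 + 2 * q * κ) ≤ (a + m + β) ^ 2 * (x ^ 2 + β ^ 2) := by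
  have ha3 := four_fifths_le ha0 ha2
  have hL : a ^ 2 + 2 * a * β ≤ (a + m + β) ^ 2 - β ^ 2 := by
    nlinarith [mul_nonneg hm ha0.le, mul_nonneg hm hβ0.le]
  have hD : a * (β ^ 2 + 2 * a * β) - a / 12 ≤
      a * ((a + m + β) ^ 2 - a ^ 2 + m ^ 2) - 2 * m := by
    have h1 : a * (2 * m * (1 - a ^ 2 - a * m)) ≤ a ^ 2 / 12 := by
      have h2 : (1 - a ^ 2) ^ 2 ≤ a ^ 2 / 6 := by
        nlinarith [mul_nonneg (sub_nonneg.2 ha2) (by nlinarith : 0 ≤ 1 - a ^ 2)]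
      nlinarith [sq_nonneg (1 - a ^ 2 - 2 * a * m)]
    have h3 : 2 * m * (1 - a ^ 2 - a * m) ≤ a / 12 :=
      le_of_mul_le_mul_left (by linarith [h1]) ha0
    nlinarith [mul_nonneg (mul_nonneg hm hβ0.le) ha0.le]
  have hqκ : a * (q * κ) ≤ x + m := by
    rcases le_or_gt κ 0 with h | h
    · nlinarith [mul_nonneg (mul_nonneg ha0.le hq0) (neg_nonneg.2 h)]
    · nlinarith [mul_nonneg (mul_pos ha0 h).le (sub_nonneg.2 hq1)]
  have key : 0 ≤ a * (a ^ 2 + 2 * a * β) * x ^ 2 - 2 * (β ^ 2 * (a ^ 2 + 1)) * x +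
      β ^ 2 * (a * (β ^ 2 + 2 * a * β) - a / 12) := by
    by_cases hβ : 1 / 10 ≤ β
    · refine quadratic_nonneg_of_discrim (by positivity) ?_
      nlinarith [mul_le_mul_of_nonneg_left (discrim_le_of_two_thirds_le_sq ha1.le ha2 ha0 hβ)
        (sq_nonneg β)]
    · have hx := hx.resolve_right hβ
      push Not at hβ
      have ha5 : 2 / 3 * a ≤ a ^ 3 := by nlinarith
      have h1 : 0 ≤ 3 / 5 * (a * (a ^ 2 + 2 * a * β)) - 2 * β * (a ^ 2 + 1) := by nlinarith
      have h2 : 3 / 5 * β * x ≤ x ^ 2 := by nlinarith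
      have h3 : x * β * (3 / 5 * (a * (a ^ 2 + 2 * a * β)) - 2 * β * (a ^ 2 + 1)) ≤
          a * (a ^ 2 + 2 * a * β) * x ^ 2 - 2 * (β ^ 2 * (a ^ 2 + 1)) * x := by
        have h4 : 0 ≤ a * (a ^ 2 + 2 * a * β) := by positivity
        nlinarith [mul_le_mul_of_nonneg_left h2 h4]
      have h5 : 3 / 5 * β * β * (3 / 5 * (a * (a ^ 2 + 2 * a * β)) - 2 * β * (a ^ 2 + 1)) ≤
          x * β * (3 / 5 * (a * (a ^ 2 + 2 * a * β)) - 2 * β * (a ^ 2 + 1)) :=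
        mul_le_mul_of_nonneg_right (mul_le_mul_of_nonneg_right hx hβ0.le) h1
      have h6 : 0 ≤ 3 / 5 * (3 / 5 * (a * (a ^ 2 + 2 * a * β)) - 2 * β * (a ^ 2 + 1)) +
          (a * (β ^ 2 + 2 * a * β) - a / 12) := by
        nlinarith [mul_pos ha0 hβ0, mul_pos ha0 (mul_pos hβ0 hβ0)]
      nlinarith [mul_nonneg (sq_nonneg β) h6]
  have h3 : 0 ≤ a * ((a + m + β) ^ 2 * (x ^ 2 + β ^ 2) -
        β ^ 2 * ((x + a) ^ 2 - m ^ 2 + 2 * q * κ)) := by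
    have h4 := mul_le_mul_of_nonneg_left hD (sq_nonneg β)
    have h5 := mul_le_mul_of_nonneg_left hqκ (sq_nonneg β)
    have h6 := mul_le_mul_of_nonneg_left hL (mul_nonneg ha0.le (sq_nonneg x))
    nlinarith
  linarith [nonneg_of_mul_nonneg_right h3 ha0]

/-- The polynomial inequality behind `selfAdjoint_comparison`. There `x = ‖(S - a)ψ‖` for a unit
vector `ψ = (u, v)` and a symmetric operator `S`, `β = |Im z|`, `κ = ‖u‖² - ‖v‖²`, `U = ‖u‖` and
`q = cos² (θ/2)`. -/
theorem mul_sq_le_of_compression {a β m x κ q U : ℝ} (hβ : 0 < β) (hm : 0 ≤ m)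
    (hx : 0 ≤ x) (hκ1 : κ ≤ 1)
    (hκ : |m - a * κ| ≤ x) (hcase : 2 + (m + a) ^ 2 < 4 * a ^ 2) (hq0 : 0 ≤ q) (hq1 : q ≤ 1)
    (hq : (|a| + m + β) ^ 2 ≤ q * ((|a| + m + β) ^ 2 + β ^ 2))
    (hU : 0 ≤ U) (hUκ : 2 * U ^ 2 = 1 + κ)
    (hgap : m ≤ a → q * (1 - κ) ≤ (x + (a - m) * U) ^ 2) :
    β ^ 2 * ((x + |a|) ^ 2 - m ^ 2 + 2 * q * κ) ≤ (|a| + m + β) ^ 2 * (x ^ 2 + β ^ 2) := by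
  have hκ' := abs_le.1 hκ
  rcases le_or_gt a 0 with ha | ha
  · rw [abs_of_nonpos ha]
    exact mul_sq_le_of_one_half_le_sq (by nlinarith) hβ hm (by nlinarith) hq0 hq1
      (Or.inl (by linarith))
  · rw [abs_of_pos ha] at hq ⊢
    have ha2 : 2 / 3 ≤ a ^ 2 := by nlinarith
    rcases le_or_gt 1 a with ha1 | ha1
    · exact mul_sq_le_of_one_half_le_sq ha hβ hm (by nlinarith) hq0 hq1
        (Or.inr ⟨by linarith, by nlinarith⟩)
    · refine mul_sq_le_of_lt_one ha ha1 hβ hm hq0 hq1 ?_ hx ha2 (by linarith)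
      rcases le_or_gt (1 / 10) β with hb | hb
      · exact Or.inr hb
      · exact Or.inl (three_fifths_mul_le_of_gap ha ha1 hb hβ hm hx hκ1 ha2 hcase
          (by linarith) hq hU hUκ (hgap (by nlinarith)))

/-- A pair of square integrable functions as an element of `L²(ℝ) ⊕ L²(ℝ)`. -/
def pair (x y : L2) : WithLp 2 (L2 × L2) := WithLp.toLp 2 (x, y)

theorem norm_pair_sq (x y : L2) : ‖pair x y‖ ^ 2 = ‖x‖ ^ 2 + ‖y‖ ^ 2 :=
  WithLp.prod_norm_sq_eq_of_L2 _

theorem inner_pair (x y x' y' : L2) :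
    inner ℂ (pair x y) (pair x' y') = inner ℂ x x' + inner ℂ y y' :=
  WithLp.prod_inner_apply _ _

theorem re_inner_raise_left (u v : formDomain) :
    (inner ℂ (raise v) (u : L2)).re = (inner ℂ (lower u) (v : L2)).re := by
  rw [inner_raise_left, ← inner_conj_symm, Complex.conj_re]

theorem im_inner_raise_left (u v : formDomain) :
    (inner ℂ (raise v) (u : L2)).im = -(inner ℂ (lower u) (v : L2)).im := by
  rw [inner_raise_left, ← inner_conj_symm, Complex.conj_im]

/-- The triangle inequality `y ≤ N + |s| R` turned into a lower bound for `N`, with `y = ‖(S - z)ψ‖`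
and `R` the norm of the perturbation. If `c R ≤ |a| + m + |b|` this is immediate; otherwise the
polynomial inequality bounds `c R` by a multiple of `y`. -/
theorem scalar_comparison {a b m c s x y N U κ R : ℝ} (hc : 0 < c) (hcs : c ^ 2 + s ^ 2 = 1)
    (hm : 0 ≤ m) (hx : 0 ≤ x) (hy : 0 ≤ y) (hR : 0 ≤ R) (hU : 0 ≤ U) (hκ1 : κ ≤ 1)
    (hUκ : 2 * U ^ 2 = 1 + κ) (hcase : 2 + (m + a) ^ 2 < 4 * a ^ 2)
    (hl : 0 < |b| - |s| / c * (|a| + m + |b|)) (h1 : y ^ 2 = x ^ 2 + b ^ 2)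
    (h2 : y ≤ N + |s| * R) (h3 : c ^ 2 * R ^ 2 ≤ (x + |a|) ^ 2 - m ^ 2 + 2 * c ^ 2 * κ)
    (h4 : |m - a * κ| ≤ x) (h5 : m ≤ a → c ^ 2 * (1 - κ) ≤ (x + (a - m) * U) ^ 2) :
    |b| - |s| / c * (|a| + m + |b|) ≤ N := by
  have hσ' : 0 ≤ |a| + m + |b| := by positivity
  have ht : 0 ≤ |s| / c := by positivity
  have hb : 0 < |b| := by
    have := mul_nonneg ht hσ'
    linarith
  have hsσ : |s| * (|a| + m + |b|) ≤ c * |b| := by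
    have h : |s| / c * (|a| + m + |b|) * c = |s| * (|a| + m + |b|) := by field_simp
    rw [← h, mul_comm c]
    exact mul_le_mul_of_nonneg_right (by linarith) hc.le
  have hq : (|a| + m + |b|) ^ 2 ≤ c ^ 2 * ((|a| + m + |b|) ^ 2 + |b| ^ 2) := by
    have h : (|s| * (|a| + m + |b|)) ^ 2 ≤ (c * |b|) ^ 2 := by gcongr
    rw [mul_pow, mul_pow, sq_abs s] at h
    have e : (|a| + m + |b|) ^ 2 = (c ^ 2 + s ^ 2) * (|a| + m + |b|) ^ 2 := by rw [hcs, one_mul]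
    linarith
  have hp := mul_sq_le_of_compression hb hm hx hκ1 h4 hcase (sq_nonneg c)
    (by linarith [sq_nonneg s]) hq hU hUκ h5
  have hσ : 0 < |a| + m + |b| := by positivity
  set σ := |a| + m + |b|
  have hsr : |s| * R = |s| / c * (c * R) := by field_simp
  rw [hsr] at h2
  have hr0 : 0 ≤ c * R := by positivity
  have h6 : |b| * (c * R) ≤ σ * y := by
    refine le_of_sq_le_sq ?_ (by positivity)
    rw [mul_pow, mul_pow c, mul_pow σ, h1, ← sq_abs b]
    exact (mul_le_mul_of_nonneg_left h3 (sq_nonneg _)).trans hp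
  have h7 : |b| ≤ y := by
    refine le_of_sq_le_sq ?_ hy
    rw [h1, sq_abs]
    linarith [sq_nonneg x]
  rcases le_or_gt (c * R) σ with h | h
  · have := mul_le_mul_of_nonneg_left h ht
    linarith
  · have h8 : σ * (|b| - |s| / c * σ) ≤ c * R * (|b| - |s| / c * σ) :=
      mul_le_mul_of_nonneg_right h.le hl.le
    refine le_of_mul_le_mul_left ?_ hσ
    have := mul_le_mul_of_nonneg_left h2 hσ.le
    linarith

/-- The coefficients of `rotated_lower_bound` dominate the squared lower bound. -/
theorem scalar_rotated {a b m c s : ℝ} (hc : 0 < c) (hcs : c ^ 2 + s ^ 2 = 1) (hsc : |s| < c)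
    (hm : 0 ≤ m) (hcase : 4 * a ^ 2 ≤ 2 + (m + a) ^ 2)
    (hl : 0 < (1 - |s| / c) * |b| - |s| / c * (m + |a|)) :
    ((1 - |s| / c) * |b| - |s| / c * (m + |a|)) ^ 2 ≤
        (c ^ 2 - s ^ 2) ^ 2 * ((m - a) ^ 2 + b ^ 2) ∧
      ((1 - |s| / c) * |b| - |s| / c * (m + |a|)) ^ 2 ≤
        2 * (c ^ 2 - s ^ 2) * (1 + m ^ 2 - a ^ 2 + b ^ 2) -
          (c ^ 2 - s ^ 2) ^ 2 * ((m - a) ^ 2 + b ^ 2) := by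
  have ht0 : 0 ≤ |s| / c := by positivity
  have hst : |s| = |s| / c * c := by field_simp
  have ht1 : |s| / c < 1 := by rw [div_lt_one hc]; exact hsc
  have hs2 : s ^ 2 = (|s| / c) ^ 2 * c ^ 2 := by rw [← sq_abs s, ← mul_pow, ← hst]
  set t := |s| / c
  have e1 : c ^ 2 * (1 + t ^ 2) = 1 := by
    linear_combination hcs - hs2
  have hG1 : c ^ 2 - s ^ 2 ≤ 1 := by linarith [sq_nonneg s]
  have hGt : 1 - t ≤ c ^ 2 - s ^ 2 := by
    have h2 : 0 ≤ c ^ 2 * (t * (1 - t) ^ 2) := by positivity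
    have h3 : c ^ 2 - s ^ 2 - (1 - t) = c ^ 2 * (t * (1 - t) ^ 2) := by
      rw [hs2]
      linear_combination (1 - t) * e1
    linarith
  have hG : 0 < c ^ 2 - s ^ 2 := by linarith
  have hlG : (1 - t) * |b| - t * (m + |a|) ≤ (c ^ 2 - s ^ 2) * |b| := by
    have h1 : (1 - t) * |b| ≤ (c ^ 2 - s ^ 2) * |b| := mul_le_mul_of_nonneg_right hGt (abs_nonneg b)
    have h2 : 0 ≤ t * (m + |a|) := by positivity
    linarith
  have hl2 : ((1 - t) * |b| - t * (m + |a|)) ^ 2 ≤ (c ^ 2 - s ^ 2) ^ 2 * b ^ 2 := by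
    rw [← sq_abs b, ← mul_pow]
    gcongr
  set G := c ^ 2 - s ^ 2
  constructor
  · have : 0 ≤ G ^ 2 * (m - a) ^ 2 := by positivity
    linarith
  · have hGG : G ^ 2 ≤ G := by
      rw [sq]
      exact mul_le_of_le_one_left hG.le hG1
    have h1 : G ^ 2 * ((m - a) ^ 2 + b ^ 2) ≤ G * ((m - a) ^ 2 + b ^ 2) :=
      mul_le_mul_of_nonneg_right hGG (by positivity)
    have h2 : 0 ≤ G * (2 + (m + a) ^ 2 - 4 * a ^ 2) := mul_nonneg hG.le (by linarith)
    have h3 : G ^ 2 * b ^ 2 ≤ G * b ^ 2 := mul_le_mul_of_nonneg_right hGG (sq_nonneg b)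
    linarith

/-- A lower bound that is effective when `|a|` is not small compared to `m`: for `Q = (a† v, a u)`
and `Q' = (a v, a† u)`, a block is `S - z + i s Q'` with `S = c Q + m σ₃` symmetric, and the
triangle inequality is applied to `(S - z)ψ` and `Q'ψ`. -/
theorem selfAdjoint_comparison {u v : formDomain} {c s m a b : ℝ} (hc : 0 < c)
    (hcs : c ^ 2 + s ^ 2 = 1) (hm : 0 ≤ m) (huv : ‖(u : L2)‖ ^ 2 + ‖(v : L2)‖ ^ 2 = 1)
    (hcase : 2 + (m + a) ^ 2 < 4 * a ^ 2) {z : ℂ} (hz : z = a + b * Complex.I)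
    (hl : 0 < |b| - |s| / c * (|a| + m + |b|)) :
    (|b| - |s| / c * (|a| + m + |b|)) ^ 2 ≤
      ‖((m : ℂ) - z) • (u : L2) + ((c : ℂ) • raise v + (Complex.I * s) • lower v)‖ ^ 2 +
        ‖((c : ℂ) • lower u + (Complex.I * s) • raise u) - ((m : ℂ) + z) • (v : L2)‖ ^ 2 := by
  set ψ := pair u v with hψ
  set Q := pair (raise v) (lower u) with hQ
  set Q' := pair (lower v) (raise u) with hQ'
  set σψ := pair (u : L2) (-(v : L2)) with hσ
  set X := (c : ℂ) • Q + (m : ℂ) • σψ - (a : ℂ) • ψ with hX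
  set κ := ‖(u : L2)‖ ^ 2 - ‖(v : L2)‖ ^ 2 with hκ
  have nψ : ‖ψ‖ ^ 2 = 1 := by rw [hψ, norm_pair_sq, huv]
  have nψ' : ‖ψ‖ = 1 := (pow_eq_one_iff_of_nonneg (norm_nonneg _) two_ne_zero).1 nψ
  have nσ : ‖σψ‖ ^ 2 = 1 := by rw [hσ, norm_pair_sq, norm_neg, huv]
  have nσ' : ‖σψ‖ = 1 := (pow_eq_one_iff_of_nonneg (norm_nonneg _) two_ne_zero).1 nσ
  have nreal (r : ℝ) (w : WithLp 2 (L2 × L2)) : ‖(r : ℂ) • w‖ = |r| * ‖w‖ := by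
    rw [norm_smul, Complex.norm_real, Real.norm_eq_abs]
  have nI (r : ℝ) (w : WithLp 2 (L2 × L2)) : ‖(Complex.I * r) • w‖ = |r| * ‖w‖ := by
    rw [norm_smul, norm_mul, Complex.norm_I, one_mul, Complex.norm_real, Real.norm_eq_abs]
  have iQψ : (inner ℂ Q ψ).im = 0 := by
    rw [hQ, hψ, inner_pair, Complex.add_im, im_inner_raise_left]
    ring
  have iQσ : (inner ℂ Q σψ).re = 0 := by
    rw [hQ, hσ, inner_pair, Complex.add_re, inner_neg_right, Complex.neg_re, re_inner_raise_left]
    ring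
  have iσψ : inner ℂ σψ ψ = ((κ : ℝ) : ℂ) := by
    rw [hσ, hψ, inner_pair, inner_neg_left, inner_self_eq_ofReal, inner_self_eq_ofReal, hκ]
    push_cast
    ring
  have iψσ : inner ℂ ψ σψ = ((κ : ℝ) : ℂ) := by
    rw [← inner_conj_symm, iσψ, Complex.conj_ofReal]
  have iψψ : inner ℂ ψ ψ = (1 : ℂ) := by
    rw [hψ, inner_pair, inner_self_eq_ofReal, inner_self_eq_ofReal, ← Complex.ofReal_add, huv,
      Complex.ofReal_one]
  have iσσ : inner ℂ σψ σψ = (1 : ℂ) := by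
    rw [hσ, inner_pair, inner_neg_neg, inner_self_eq_ofReal, inner_self_eq_ofReal,
      ← Complex.ofReal_add, huv, Complex.ofReal_one]
  -- `X = (S - a)ψ`, and `S` is symmetric
  have h1 : ‖X - (Complex.I * b) • ψ‖ ^ 2 = ‖X‖ ^ 2 + b ^ 2 := by
    have : (inner ℂ X ψ).im = 0 := by
      rw [hX, inner_sub_left, inner_add_left, inner_smul_left, inner_smul_left, inner_smul_left,
        iσψ, iψψ]
      simp [-WithLp.prod_inner_apply, iQψ]
    rw [norm_sub_sq (𝕜 := ℂ), re_inner_smul_I, this, nI, nψ', mul_one, sq_abs]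
    ring
  have h2 : ‖X - (Complex.I * b) • ψ‖ ≤
      ‖X - (Complex.I * b) • ψ + (Complex.I * s) • Q'‖ + |s| * ‖Q'‖ := by
    rw [← nI]
    exact norm_le_add_norm_add _ _
  have hf : ‖X - (Complex.I * b) • ψ + (Complex.I * s) • Q'‖ ^ 2 =
      ‖((m : ℂ) - z) • (u : L2) + ((c : ℂ) • raise v + (Complex.I * s) • lower v)‖ ^ 2 +
        ‖((c : ℂ) • lower u + (Complex.I * s) • raise u) - ((m : ℂ) + z) • (v : L2)‖ ^ 2 := by
    rw [← norm_pair_sq]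
    congr 2
    have : X - (Complex.I * b) • ψ + (Complex.I * s) • Q' =
      pair ((c : ℂ) • raise v + (m : ℂ) • (u : L2) - (a : ℂ) • (u : L2) -
          (Complex.I * b) • (u : L2) + (Complex.I * s) • lower v)
        ((c : ℂ) • lower u + (m : ℂ) • (-(v : L2)) - (a : ℂ) • (v : L2) -
          (Complex.I * b) • (v : L2) + (Complex.I * s) • raise u) := rfl
    rw [this, hz]
    congr 1 <;> module
  have hQQ : ‖Q'‖ ^ 2 = ‖Q‖ ^ 2 + 2 * κ := by
    rw [hQ, hQ', norm_pair_sq, norm_pair_sq, norm_sq_raise, norm_sq_raise, hκ]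
    ring
  have h3 : c ^ 2 * ‖Q‖ ^ 2 + m ^ 2 ≤ (‖X‖ + |a|) ^ 2 := by
    have e : ‖X + (a : ℂ) • ψ‖ ^ 2 = c ^ 2 * ‖Q‖ ^ 2 + m ^ 2 := by
      have e1 : X + (a : ℂ) • ψ = (c : ℂ) • Q + (m : ℂ) • σψ := by rw [hX]; abel
      rw [e1, norm_add_sq (𝕜 := ℂ), inner_smul_left, inner_smul_right, nreal, nreal, nσ']
      simp only [Complex.conj_ofReal, RCLike.re_eq_complex_re, Complex.re_ofReal_mul, iQσ,
        mul_pow, sq_abs]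
      ring
    rw [← e]
    have := norm_add_le X ((a : ℂ) • ψ)
    rw [nreal, nψ', mul_one] at this
    gcongr
  have h4 : |m - a * κ| ≤ ‖X‖ := by
    have e : (inner ℂ X σψ).re = m - a * κ := by
      rw [hX, inner_sub_left, inner_add_left, inner_smul_left, inner_smul_left, inner_smul_left,
        iψσ, iσσ]
      simp [-WithLp.prod_inner_apply, iQσ]
    rw [← e]
    refine (Complex.abs_re_le_norm _).trans ((norm_inner_le_norm _ _).trans ?_)
    rw [nσ', mul_one]
  -- the first component of `X` and `‖a† v‖² ≥ 2 ‖v‖²`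
  have h5 : m ≤ a → c ^ 2 * (1 - κ) ≤ (‖X‖ + (a - m) * ‖(u : L2)‖) ^ 2 := by
    intro hma
    have e1 : ‖(c : ℂ) • raise v‖ ^ 2 = c ^ 2 * ‖raise v‖ ^ 2 := by
      rw [norm_smul, Complex.norm_real, mul_pow, Real.norm_eq_abs, sq_abs]
    have e2 : c ^ 2 * (1 - κ) ≤ ‖(c : ℂ) • raise v‖ ^ 2 := by
      rw [e1, norm_sq_raise]
      have : 0 ≤ c ^ 2 * ‖lower v‖ ^ 2 := by positivity
      rw [hκ, ← huv]
      linarith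
    refine e2.trans ?_
    have e3 : (c : ℂ) • raise v = ((c : ℂ) • raise v + ((m - a : ℝ) : ℂ) • (u : L2)) +
        ((a - m : ℝ) : ℂ) • (u : L2) := by
      push_cast
      module
    have e4 : ‖(c : ℂ) • raise v + ((m - a : ℝ) : ℂ) • (u : L2)‖ ≤ ‖X‖ := by
      have : X = pair ((c : ℂ) • raise v + ((m - a : ℝ) : ℂ) • (u : L2))
          ((c : ℂ) • lower u + (m : ℂ) • (-(v : L2)) - (a : ℂ) • (v : L2)) := by
        have : X = pair ((c : ℂ) • raise v + (m : ℂ) • (u : L2) - (a : ℂ) • (u : L2))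
          ((c : ℂ) • lower u + (m : ℂ) • (-(v : L2)) - (a : ℂ) • (v : L2)) := rfl
        rw [this]
        congr 1
        push_cast
        module
      rw [this]
      refine le_of_sq_le_sq ?_ (norm_nonneg _)
      rw [norm_pair_sq]
      linarith [sq_nonneg ‖(c : ℂ) • lower u + (m : ℂ) • (-(v : L2)) - (a : ℂ) • (v : L2)‖]
    have e5 : ‖((a - m : ℝ) : ℂ) • (u : L2)‖ = (a - m) * ‖(u : L2)‖ := by
      rw [norm_smul, Complex.norm_real, Real.norm_of_nonneg (sub_nonneg.2 hma)]
    have e6 : ‖(c : ℂ) • raise v‖ ≤ ‖X‖ + (a - m) * ‖(u : L2)‖ := by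
      rw [e3, ← e5]
      exact (norm_add_le _ _).trans (by gcongr)
    gcongr
  rw [← hf]
  have hκ1 : κ ≤ 1 := by
    rw [hκ, ← huv]
    linarith [sq_nonneg ‖(v : L2)‖]
  have hκ2 : 2 * ‖(u : L2)‖ ^ 2 = 1 + κ := by
    rw [hκ, ← huv]
    ring
  have h3' : c ^ 2 * ‖Q'‖ ^ 2 ≤ (‖X‖ + |a|) ^ 2 - m ^ 2 + 2 * c ^ 2 * κ := by
    rw [hQQ]
    linarith
  have hN := scalar_comparison hc hcs hm (norm_nonneg X) (norm_nonneg _) (norm_nonneg Q')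
    (norm_nonneg (u : L2)) hκ1 hκ2 hcase hl h1 h2 h3' h4 h5
  gcongr

/-- The lower bound for a block, with `c = cos (θ/2)` and `s = sin (θ/2)`. The two methods overlap;
the case distinction is where the scalar inequalities of both are available. -/
theorem pair_lower_bound (u v : formDomain) {c s m : ℝ} (hc : 0 < c)
    (hcs : c ^ 2 + s ^ 2 = 1) (hsc : |s| < c) (hm : 0 ≤ m) (z : ℂ)
    (hl : 0 < (1 - |s| / c) * |z.im| - |s| / c * (m + |z.re|)) :
    ((1 - |s| / c) * |z.im| - |s| / c * (m + |z.re|)) ^ 2 *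
        (‖(u : L2)‖ ^ 2 + ‖(v : L2)‖ ^ 2) ≤
      ‖((m : ℂ) - z) • (u : L2) + ((c : ℂ) • raise v + (Complex.I * s) • lower v)‖ ^ 2 +
        ‖((c : ℂ) • lower u + (Complex.I * s) • raise u) - ((m : ℂ) + z) • (v : L2)‖ ^ 2 := by
  set a := z.re with ha
  set b := z.im with hb
  have hz : z = a + b * Complex.I := (Complex.re_add_im z).symm
  set l := (1 - |s| / c) * |b| - |s| / c * (m + |a|) with hldef
  rcases le_or_gt (4 * a ^ 2) (2 + (m + a) ^ 2) with hcase | hcase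
  · have hss : s ^ 2 < c ^ 2 := by rw [← sq_abs s]; gcongr
    have hG : 0 < c ^ 2 - s ^ 2 := by linarith
    have h := rotated_lower_bound (u := (u : L2)) (v := (v : L2)) (p := lower v) (q := raise v)
      (Q := (c : ℂ) • lower u + (Complex.I * s) • raise u) hcs hG (norm_sq_raise v) (by
        rw [inner_sub_left, inner_add_right, inner_smul_left, inner_smul_left, inner_smul_right,
          inner_smul_right, inner_raise_left, inner_lower_left, Complex.conj_ofReal, map_mul,
          Complex.conj_I, Complex.conj_ofReal]
        ring) m a b z hz
    refine le_trans ?_ h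
    obtain ⟨c1, c2⟩ := scalar_rotated hc hcs hsc hm hcase hl
    rw [mul_add]
    exact add_le_add (mul_le_mul_of_nonneg_right c1 (sq_nonneg _))
      (mul_le_mul_of_nonneg_right c2 (sq_nonneg _))
  · rcases eq_or_lt_of_le (by positivity : 0 ≤ ‖(u : L2)‖ ^ 2 + ‖(v : L2)‖ ^ 2) with h0 | h0
    · rw [← h0, mul_zero]
      positivity
    · set n := ‖(u : L2)‖ ^ 2 + ‖(v : L2)‖ ^ 2 with hn
      set r := (Real.sqrt n)⁻¹ with hr
      have hr2 : r ^ 2 = n⁻¹ := by rw [hr, inv_pow, Real.sq_sqrt h0.le]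
      have hsm (w : L2) : ‖(r : ℂ) • w‖ ^ 2 = r ^ 2 * ‖w‖ ^ 2 := by
        rw [norm_smul, Complex.norm_real, mul_pow, Real.norm_eq_abs, sq_abs]
      have hle : l = |b| - |s| / c * (|a| + m + |b|) := by rw [hldef]; ring
      have h := selfAdjoint_comparison (u := (r : ℂ) • u) (v := (r : ℂ) • v) hc hcs hm (by
        rw [Submodule.coe_smul, Submodule.coe_smul, hsm, hsm, ← mul_add, ← hn, hr2,
          inv_mul_cancel₀ h0.ne']) hcase hz (hle ▸ hl)
      rw [← hle] at h
      have e1 : ((m : ℂ) - z) • (((r : ℂ) • u : formDomain) : L2) +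
          ((c : ℂ) • raise ((r : ℂ) • v) + (Complex.I * s) • lower ((r : ℂ) • v)) =
          (r : ℂ) • (((m : ℂ) - z) • (u : L2) +
            ((c : ℂ) • raise v + (Complex.I * s) • lower v)) := by
        rw [map_smul, map_smul, Submodule.coe_smul]
        module
      have e2 : ((c : ℂ) • lower ((r : ℂ) • u) + (Complex.I * s) • raise ((r : ℂ) • u)) -
          ((m : ℂ) + z) • (((r : ℂ) • v : formDomain) : L2) =
          (r : ℂ) • (((c : ℂ) • lower u + (Complex.I * s) • raise u) -
            ((m : ℂ) + z) • (v : L2)) := by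
        rw [map_smul, map_smul, Submodule.coe_smul]
        module
      rw [e1, e2, hsm, hsm, ← mul_add, hr2, inv_mul_eq_div, le_div_iff₀ h0] at h
      exact h

end RelativisticOscillator

namespace UnboundedOperator

/-! ### Existence of resolvents -/

section
variable {E : Type*} [NormedAddCommGroup E] [InnerProductSpace ℂ E] [CompleteSpace E]

/-- A closed operator `T` such that `T - z` is bounded below and has dense range has a resolvent
at `z`. -/
theorem exists_isResolventAt {T : E →ₗ.[ℂ] E} (hT : T.IsClosed) {z : ℂ} {l : ℝ} (hl : 0 < l)
    (hlow : ∀ ψ : T.domain, l * ‖(ψ : E)‖ ≤ ‖T ψ - z • (ψ : E)‖)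
    (hdense : ∀ f : E, (∀ ψ : T.domain, inner ℂ f (T ψ - z • (ψ : E)) = (0 : ℂ)) → f = 0) :
    ∃ R : E →L[ℂ] E, IsResolventAt T z R ∧ ‖R‖ ≤ 1 / l := by
  set S : T.domain →ₗ[ℂ] E := T.toFun - z • T.domain.subtype with hS
  have hSa (ψ : T.domain) : S ψ = T ψ - z • (ψ : E) := rfl
  have hinj : Function.Injective S := by
    rw [injective_iff_map_eq_zero]
    intro ψ hψ
    have h := hlow ψ
    rw [← hSa, hψ, norm_zero] at h
    have : ‖(ψ : E)‖ = 0 := le_antisymm (nonpos_of_mul_nonpos_right h hl) (norm_nonneg _)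
    exact Subtype.ext (norm_eq_zero.1 this)
  have hclosed : IsClosed (LinearMap.range S : Set E) := by
    refine isClosed_of_closure_subset fun f hf => ?_
    obtain ⟨x, hx, hxf⟩ := mem_closure_iff_seq_limit.1 hf
    choose ψ hψ using hx
    have hc : CauchySeq fun n => (ψ n : E) := by
      have h1 := hxf.cauchySeq
      rw [Metric.cauchySeq_iff] at h1 ⊢
      intro ε hε
      obtain ⟨N, hN⟩ := h1 (l * ε) (by positivity)
      refine ⟨N, fun m hm n hn => ?_⟩
      have h2 := hN m hm n hn
      have h3 := hlow (ψ m - ψ n)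
      rw [← hSa, map_sub, hψ, hψ, ← dist_eq_norm] at h3
      rw [dist_eq_norm]
      exact lt_of_mul_lt_mul_left (h3.trans_lt h2) hl.le
    obtain ⟨φ, hφ⟩ := cauchySeq_tendsto_of_complete hc
    have h2 : Tendsto (fun n => ((ψ n : E), T (ψ n))) atTop (𝓝 (φ, f + z • φ)) := by
      refine hφ.prodMk_nhds ?_
      refine (hxf.add (hφ.const_smul z)).congr fun n => ?_
      rw [← hψ, hSa, sub_add_cancel]
    have h3 : (φ, f + z • φ) ∈ T.graph :=
      hT.mem_of_tendsto h2 (Eventually.of_forall fun n => T.mem_graph (ψ n))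
    obtain ⟨y, hy1, hy2⟩ := (LinearPMap.mem_graph_iff T).1 h3
    refine ⟨y, ?_⟩
    rw [hSa, hy1, hy2]
    exact add_sub_cancel_right _ _
  have hsurj : Function.Surjective S := by
    rw [← LinearMap.range_eq_top]
    have : CompleteSpace (LinearMap.range S) := hclosed.completeSpace_coe
    rw [← Submodule.orthogonal_eq_bot_iff, Submodule.eq_bot_iff]
    intro f hf
    refine hdense f fun ψ => ?_
    rw [← hSa]
    exact (Submodule.mem_orthogonal' _ _).1 hf _ ⟨ψ, rfl⟩
  set e := LinearEquiv.ofBijective S ⟨hinj, hsurj⟩ with he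
  have heS (ψ : T.domain) : e ψ = T ψ - z • (ψ : E) := rfl
  have hb (f : E) : ‖(T.domain.subtype ∘ₗ e.symm.toLinearMap) f‖ ≤ 1 / l * ‖f‖ := by
    have h := hlow (e.symm f)
    rw [← heS, e.apply_symm_apply] at h
    rw [div_mul_eq_mul_div, one_mul, le_div_iff₀ hl, mul_comm]
    exact h
  refine ⟨LinearMap.mkContinuous (T.domain.subtype ∘ₗ e.symm.toLinearMap) (1 / l) hb,
    ⟨fun f => (e.symm f).2, fun f => ?_, fun ψ => ?_⟩,
    LinearMap.mkContinuous_norm_le _ (by positivity) _⟩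
  · exact e.apply_symm_apply f
  · exact congrArg Subtype.val (e.symm_apply_apply ψ)

/-- If some resolvent of `T` is compact, then every point of the spectrum is an eigenvalue. -/
theorem mem_resolventSet_of_isCompactOperator {T : E →ₗ.[ℂ] E} {z₀ z : ℂ} {R : E →L[ℂ] E}
    (hR : IsResolventAt T z₀ R) (hc : IsCompactOperator R)
    (hinj : ∀ ψ : T.domain, T ψ - z • (ψ : E) = 0 → (ψ : E) = 0) : z ∈ resolventSet T := by
  rcases eq_or_ne z z₀ with rfl | hz
  · exact ⟨R, hR⟩
  have hz' : z - z₀ ≠ 0 := sub_ne_zero.2 hz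
  -- `T - z = (z - z₀) (μ - R) (T - z₀)` for this `μ`, so the Fredholm alternative applies to `R`
  set μ := (z - z₀)⁻¹ with hμ
  have hμ0 : μ ≠ 0 := inv_ne_zero hz'
  have hne : ¬ Module.End.HasEigenvalue (R : Module.End ℂ E) μ := by
    intro h
    obtain ⟨x, hx⟩ := h.exists_hasEigenvector
    have h1 : R x = μ • x := hx.apply_eq_smul
    have h2 : (z - z₀) • R x = x := by rw [h1, smul_smul, hμ, mul_inv_cancel₀ hz', one_smul]
    have h3 := hR.right_inv x
    have h4 : R x = 0 := hinj ⟨R x, hR.mem_domain x⟩ (by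
      have : T ⟨R x, hR.mem_domain x⟩ - z • R x =
          (T ⟨R x, hR.mem_domain x⟩ - z₀ • R x) - (z - z₀) • R x := by module
      rw [this, h3, h2, sub_self])
    rw [h4, smul_zero] at h2
    exact hx.2 h2.symm
  have hres := (hc.hasEigenvalue_or_mem_resolventSet hμ0).resolve_left hne
  obtain ⟨J, hJ⟩ := hres
  have e (w : E) : (J : E →L[ℂ] E) w = μ • w - R w := by
    rw [hJ, Algebra.algebraMap_eq_smul_one]
    rfl
  have j1 (w : E) : μ • (J⁻¹ : (E →L[ℂ] E)ˣ).1 w - R ((J⁻¹ : (E →L[ℂ] E)ˣ).1 w) = w := by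
    rw [← e]
    exact DFunLike.congr_fun J.mul_inv w
  have j2 (w : E) : (J⁻¹ : (E →L[ℂ] E)ˣ).1 (μ • w - R w) = w := by
    rw [← e]
    exact DFunLike.congr_fun J.inv_mul w
  refine ⟨R ∘L (μ • (J⁻¹ : (E →L[ℂ] E)ˣ).1), ⟨fun f => hR.mem_domain _, fun f => ?_, fun ψ => ?_⟩⟩
  · have h1 := hR.right_inv (μ • (J⁻¹ : (E →L[ℂ] E)ˣ).1 f)
    have h2 := j1 f
    set w := (J⁻¹ : (E →L[ℂ] E)ˣ).1 f
    have h3 : T ⟨R (μ • w), hR.mem_domain _⟩ - z • R (μ • w) =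
      (T ⟨R (μ • w), hR.mem_domain _⟩ - z₀ • R (μ • w)) - (z - z₀) • R (μ • w) := by module
    refine h3.trans ?_
    rw [h1, map_smul, smul_smul, hμ, mul_inv_cancel₀ hz', one_smul]
    exact h2
  · have h1 := hR.left_inv ψ
    set f := T ψ - z₀ • (ψ : E) with hf
    have h2 : T ψ - z • (ψ : E) = (z - z₀) • (μ • f - R f) := by
      rw [smul_sub, smul_smul, hμ, mul_inv_cancel₀ hz', one_smul, h1, hf]
      module
    change R (μ • (J⁻¹ : (E →L[ℂ] E)ˣ).1 (T ψ - z • (ψ : E))) = ψ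
    rw [h2, map_smul, map_smul, map_smul, j2, smul_smul, hμ, inv_mul_cancel₀ hz', one_smul, h1]

end

end UnboundedOperator

namespace RelativisticOscillator

/-! ### Closedness of the ladder operators -/

/-- The derivative and the multiplication operator are jointly closed. -/
theorem mem_formDomain_of_tendsto {u : ℕ → formDomain} {w p q : L2}
    (hu : Tendsto (fun n => (u n : L2)) atTop (𝓝 w))
    (hp : Tendsto (fun n => weakDeriv (u n)) atTop (𝓝 p))
    (hq : Tendsto (fun n => mulX (u n)) atTop (𝓝 q)) :
    ∃ h : w ∈ formDomain, weakDeriv ⟨w, h⟩ = p ∧ mulX ⟨w, h⟩ = q := by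
  have h1 : HasWeakDeriv w p := by
    have hc := (Lp.toTemperedDistributionCLM ℂ (volume : Measure ℝ) 2).continuous
    have e1 := ((TemperedDistribution.derivCLM ℂ).continuous.tendsto _).comp
      ((hc.tendsto w).comp hu)
    have e2 := (hc.tendsto p).comp hp
    refine tendsto_nhds_unique e1 (e2.congr fun n => ?_)
    exact (hasWeakDeriv_weakDeriv (u n)).symm
  have h2 : (fun x : ℝ => (x : ℂ) * w x) =ᵐ[volume] q := by
    -- along a subsequence both convergences hold almost everywhere
    obtain ⟨ns, hns, h3⟩ := (tendstoInMeasure_of_tendsto_Lp hu).exists_seq_tendsto_ae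
    obtain ⟨ms, hms, h4⟩ :=
      (tendstoInMeasure_of_tendsto_Lp (hq.comp hns.tendsto_atTop)).exists_seq_tendsto_ae
    have h5 : ∀ᵐ x : ℝ, ∀ n, mulX (u n) x = (x : ℂ) * (u n : L2) x :=
      ae_all_iff.2 fun n => coeFn_mulX (u n)
    filter_upwards [h3, h4, h5] with x h3 h4 h5
    refine tendsto_nhds_unique ((h3.comp hms.tendsto_atTop).const_mul (x : ℂ))
      (h4.congr fun n => ?_)
    exact h5 _
  have hw : w ∈ formDomain := ⟨⟨p, h1⟩, (memLp_congr_ae h2).2 (Lp.memLp q)⟩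
  refine ⟨hw, (hasWeakDeriv_weakDeriv _).unique h1, ?_⟩
  apply Lp.ext
  exact (coeFn_mulX ⟨w, hw⟩).trans h2

theorem exists_of_tendsto_lower {u : ℕ → formDomain} {w p q : L2}
    (hu : Tendsto (fun n => (u n : L2)) atTop (𝓝 w))
    (hp : Tendsto (fun n => lower (u n)) atTop (𝓝 p))
    (hq : Tendsto (fun n => raise (u n)) atTop (𝓝 q)) :
    ∃ h : w ∈ formDomain, lower ⟨w, h⟩ = p ∧ raise ⟨w, h⟩ = q := by
  have h1 : Tendsto (fun n => weakDeriv (u n)) atTop (𝓝 ((1 / 2 : ℂ) • (p - q))) :=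
    ((hp.sub hq).const_smul (1 / 2 : ℂ)).congr fun n => by
      rw [lower_apply, raise_apply]; module
  have h2 : Tendsto (fun n => mulX (u n)) atTop (𝓝 ((1 / 2 : ℂ) • (p + q))) :=
    ((hp.add hq).const_smul (1 / 2 : ℂ)).congr fun n => by
      rw [lower_apply, raise_apply]; module
  obtain ⟨h, h3, h4⟩ := mem_formDomain_of_tendsto hu h1 h2
  refine ⟨h, ?_, ?_⟩
  · rw [lower_apply, h3, h4]; module
  · rw [raise_apply, h3, h4]; module

theorem norm_raise_le (u : formDomain) : ‖raise u‖ ≤ ‖lower u‖ + 2 * ‖(u : L2)‖ := by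
  refine le_of_sq_le_sq ?_ (by positivity)
  rw [norm_sq_raise]
  nlinarith [norm_nonneg (lower u), norm_nonneg (u : L2),
    mul_nonneg (norm_nonneg (lower u)) (norm_nonneg (u : L2))]

/-! ### The components of the Dirac operator -/

/-- The rotated annihilation operator `e^{-iθ/2} ∂ₓ + e^{iθ/2} x`. -/
def rotLower (θ : ℝ) : formDomain →ₗ[ℂ] L2 :=
  Complex.exp (-Complex.I * θ / 2) • weakDeriv + Complex.exp (Complex.I * θ / 2) • mulX

/-- The rotated creation operator `-e^{-iθ/2} ∂ₓ + e^{iθ/2} x`. -/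
def rotRaise (θ : ℝ) : formDomain →ₗ[ℂ] L2 :=
  Complex.exp (Complex.I * θ / 2) • mulX - Complex.exp (-Complex.I * θ / 2) • weakDeriv

theorem exp_half_eq (θ : ℝ) : Complex.exp (Complex.I * θ / 2) =
    (Real.cos (θ / 2) : ℂ) + Complex.I * (Real.sin (θ / 2) : ℂ) := by
  rw [show Complex.I * (θ : ℂ) / 2 = ((θ / 2 : ℝ) : ℂ) * Complex.I by push_cast; ring,
    Complex.exp_mul_I]
  push_cast
  ring

theorem exp_neg_half_eq (θ : ℝ) : Complex.exp (-Complex.I * θ / 2) =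
    (Real.cos (θ / 2) : ℂ) - Complex.I * (Real.sin (θ / 2) : ℂ) := by
  rw [show -Complex.I * (θ : ℂ) / 2 = ((-(θ / 2) : ℝ) : ℂ) * Complex.I by push_cast; ring,
    Complex.exp_mul_I, ← Complex.ofReal_cos, ← Complex.ofReal_sin, Real.cos_neg, Real.sin_neg]
  push_cast
  ring

theorem rotLower_apply (θ : ℝ) (u : formDomain) :
    rotLower θ u = (Real.cos (θ / 2) : ℂ) • lower u +
      (Complex.I * (Real.sin (θ / 2) : ℂ)) • raise u := by
  have : rotLower θ u = Complex.exp (-Complex.I * θ / 2) • weakDeriv u +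
    Complex.exp (Complex.I * θ / 2) • mulX u := rfl
  rw [this, exp_half_eq, exp_neg_half_eq, lower_apply, raise_apply]
  module

theorem rotRaise_apply (θ : ℝ) (u : formDomain) :
    rotRaise θ u = (Real.cos (θ / 2) : ℂ) • raise u +
      (Complex.I * (Real.sin (θ / 2) : ℂ)) • lower u := by
  have : rotRaise θ u = Complex.exp (Complex.I * θ / 2) • mulX u -
    Complex.exp (-Complex.I * θ / 2) • weakDeriv u := rfl
  rw [this, exp_half_eq, exp_neg_half_eq, lower_apply, raise_apply]
  module

theorem diracOscillator_apply (θ m : ℝ) (ψ : spinorDomain) (j : Fin 4) :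
    (diracOscillator θ m ψ) j =
      (-Complex.I * Complex.exp (-Complex.I * θ / 2)) •
          ∑ k, α₁ j k • weakDeriv (component k ψ) -
        Complex.exp (Complex.I * θ / 2) • ∑ k, α₂ j k • mulX (component k ψ) +
        (m : ℂ) • ∑ k, α₃ j k • (component k ψ : L2) := rfl

theorem diracOscillator_zero (θ m : ℝ) (ψ : spinorDomain) :
    (diracOscillator θ m ψ) 0 =
      Complex.I • rotRaise θ (component 3 ψ) + (m : ℂ) • (component 2 ψ : L2) := by
  rw [diracOscillator_apply]
  simp only [Fin.sum_univ_four, α₁, α₂, α₃, Matrix.of_apply, Matrix.cons_val]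
  have : rotRaise θ (component 3 ψ) = Complex.exp (Complex.I * θ / 2) • mulX (component 3 ψ) -
    Complex.exp (-Complex.I * θ / 2) • weakDeriv (component 3 ψ) := rfl
  rw [this]
  module

theorem diracOscillator_one (θ m : ℝ) (ψ : spinorDomain) :
    (diracOscillator θ m ψ) 1 =
      -(Complex.I • rotLower θ (component 2 ψ)) - (m : ℂ) • (component 3 ψ : L2) := by
  rw [diracOscillator_apply]
  simp only [Fin.sum_univ_four, α₁, α₂, α₃, Matrix.of_apply, Matrix.cons_val]
  have : rotLower θ (component 2 ψ) = Complex.exp (-Complex.I * θ / 2) •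
    weakDeriv (component 2 ψ) + Complex.exp (Complex.I * θ / 2) • mulX (component 2 ψ) := rfl
  rw [this]
  module

theorem diracOscillator_two (θ m : ℝ) (ψ : spinorDomain) :
    (diracOscillator θ m ψ) 2 =
      Complex.I • rotRaise θ (component 1 ψ) + (m : ℂ) • (component 0 ψ : L2) := by
  rw [diracOscillator_apply]
  simp only [Fin.sum_univ_four, α₁, α₂, α₃, Matrix.of_apply, Matrix.cons_val]
  have : rotRaise θ (component 1 ψ) = Complex.exp (Complex.I * θ / 2) • mulX (component 1 ψ) -
    Complex.exp (-Complex.I * θ / 2) • weakDeriv (component 1 ψ) := rfl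
  rw [this]
  module

theorem diracOscillator_three (θ m : ℝ) (ψ : spinorDomain) :
    (diracOscillator θ m ψ) 3 =
      -(Complex.I • rotLower θ (component 0 ψ)) - (m : ℂ) • (component 1 ψ : L2) := by
  rw [diracOscillator_apply]
  simp only [Fin.sum_univ_four, α₁, α₂, α₃, Matrix.of_apply, Matrix.cons_val]
  have : rotLower θ (component 0 ψ) = Complex.exp (-Complex.I * θ / 2) •
    weakDeriv (component 0 ψ) + Complex.exp (Complex.I * θ / 2) • mulX (component 0 ψ) := rfl
  rw [this]
  module

theorem norm_sq_spinor (f : SpinorL2) :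
    ‖f‖ ^ 2 = ‖f 0‖ ^ 2 + ‖f 1‖ ^ 2 + ‖f 2‖ ^ 2 + ‖f 3‖ ^ 2 := by
  rw [PiLp.norm_sq_eq_of_L2, Fin.sum_univ_four]

/-- The norm of a spinor in terms of the two blocks `f₀ ± f₂`, `f₁ ± f₃`. -/
theorem two_mul_norm_sq_spinor (f : SpinorL2) :
    2 * ‖f‖ ^ 2 = (‖f 0 + f 2‖ ^ 2 + ‖f 1 + f 3‖ ^ 2) + (‖f 0 - f 2‖ ^ 2 + ‖f 1 - f 3‖ ^ 2) := by
  have h1 := parallelogram_law_with_norm ℂ (f 0) (f 2)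
  have h2 := parallelogram_law_with_norm ℂ (f 1) (f 3)
  rw [norm_sq_spinor]
  linarith

/-- The first component of a `2 × 2` block of `H_θ - z`. -/
def blockFst (θ m : ℝ) (z : ℂ) (u v : formDomain) : L2 := ((m : ℂ) - z) • (u : L2) + rotRaise θ v

/-- The second component of a `2 × 2` block of `H_θ - z`. -/
def blockSnd (θ m : ℝ) (z : ℂ) (u v : formDomain) : L2 := rotLower θ u - ((m : ℂ) + z) • (v : L2)

theorem block_fst_add (θ m : ℝ) (z : ℂ) (ψ : spinorDomain) :
    (diracOscillator θ m ψ - z • (ψ : SpinorL2)) 0 +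
      (diracOscillator θ m ψ - z • (ψ : SpinorL2)) 2 =
    blockFst θ m z (component 0 ψ + component 2 ψ)
      (Complex.I • (component 1 ψ + component 3 ψ)) := by
  have e (j : Fin 4) : (diracOscillator θ m ψ - z • (ψ : SpinorL2)) j =
    (diracOscillator θ m ψ) j - z • (component j ψ : L2) := rfl
  rw [e, e, diracOscillator_zero, diracOscillator_two, blockFst, map_smul, map_add,
    Submodule.coe_add]
  module

theorem block_snd_add (θ m : ℝ) (z : ℂ) (ψ : spinorDomain) :
    (diracOscillator θ m ψ - z • (ψ : SpinorL2)) 1 +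
      (diracOscillator θ m ψ - z • (ψ : SpinorL2)) 3 =
    -Complex.I • blockSnd θ m z (component 0 ψ + component 2 ψ)
      (Complex.I • (component 1 ψ + component 3 ψ)) := by
  have e (j : Fin 4) : (diracOscillator θ m ψ - z • (ψ : SpinorL2)) j =
    (diracOscillator θ m ψ) j - z • (component j ψ : L2) := rfl
  rw [e, e, diracOscillator_one, diracOscillator_three, blockSnd, map_add, Submodule.coe_smul,
    Submodule.coe_add, smul_sub, smul_smul, smul_smul,
    show -Complex.I * ((m : ℂ) + z) * Complex.I = (m : ℂ) + z by
      linear_combination (-((m : ℂ) + z)) * Complex.I_sq]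
  module

theorem block_fst_sub (θ m : ℝ) (z : ℂ) (ψ : spinorDomain) :
    (diracOscillator θ m ψ - z • (ψ : SpinorL2)) 0 -
      (diracOscillator θ m ψ - z • (ψ : SpinorL2)) 2 =
    -blockFst θ m (-z) (component 0 ψ - component 2 ψ)
      (Complex.I • (component 1 ψ - component 3 ψ)) := by
  have e (j : Fin 4) : (diracOscillator θ m ψ - z • (ψ : SpinorL2)) j =
    (diracOscillator θ m ψ) j - z • (component j ψ : L2) := rfl
  rw [e, e, diracOscillator_zero, diracOscillator_two, blockFst, map_smul, map_sub,
    Submodule.coe_sub]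
  module

theorem block_snd_sub (θ m : ℝ) (z : ℂ) (ψ : spinorDomain) :
    (diracOscillator θ m ψ - z • (ψ : SpinorL2)) 1 -
      (diracOscillator θ m ψ - z • (ψ : SpinorL2)) 3 =
    Complex.I • blockSnd θ m (-z) (component 0 ψ - component 2 ψ)
      (Complex.I • (component 1 ψ - component 3 ψ)) := by
  have e (j : Fin 4) : (diracOscillator θ m ψ - z • (ψ : SpinorL2)) j =
    (diracOscillator θ m ψ) j - z • (component j ψ : L2) := rfl
  rw [e, e, diracOscillator_one, diracOscillator_three, blockSnd, map_sub, Submodule.coe_smul,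
    Submodule.coe_sub, smul_sub, smul_smul, smul_smul,
    show Complex.I * ((m : ℂ) + -z) * Complex.I = -((m : ℂ) - z) by
      linear_combination ((m : ℂ) - z) * Complex.I_sq]
  module

/-! ### The lower bound for the Dirac operator -/

theorem cos_half_pos {θ : ℝ} (hθ : θ ∈ Set.Ioo (-(Real.pi / 2)) (Real.pi / 2)) :
    0 < Real.cos (θ / 2) :=
  Real.cos_pos_of_mem_Ioo ⟨by linarith [hθ.1, Real.pi_pos], by linarith [hθ.2, Real.pi_pos]⟩

theorem abs_sin_half_lt_cos_half {θ : ℝ} (hθ : θ ∈ Set.Ioo (-(Real.pi / 2)) (Real.pi / 2)) :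
    |Real.sin (θ / 2)| < Real.cos (θ / 2) := by
  have h : 0 < Real.cos (θ / 2) ^ 2 - Real.sin (θ / 2) ^ 2 := by
    rw [← Real.cos_two_mul', mul_div_cancel₀ _ two_ne_zero]
    exact Real.cos_pos_of_mem_Ioo hθ
  exact abs_lt_of_sq_lt_sq (by linarith) (cos_half_pos hθ).le

theorem abs_tan_half {θ : ℝ} (hθ : θ ∈ Set.Ioo (-(Real.pi / 2)) (Real.pi / 2)) :
    |Real.tan (θ / 2)| = |Real.sin (θ / 2)| / Real.cos (θ / 2) := by
  rw [Real.tan_eq_sin_div_cos, abs_div, abs_of_pos (cos_half_pos hθ)]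

theorem block_lower_bound {θ m : ℝ} (hθ : θ ∈ Set.Ioo (-(Real.pi / 2)) (Real.pi / 2))
    (hm : 0 ≤ m) (z : ℂ) (u v : formDomain)
    (hl : 0 < (1 - |Real.tan (θ / 2)|) * |z.im| - |Real.tan (θ / 2)| * (m + |z.re|)) :
    ((1 - |Real.tan (θ / 2)|) * |z.im| - |Real.tan (θ / 2)| * (m + |z.re|)) ^ 2 *
        (‖(u : L2)‖ ^ 2 + ‖(v : L2)‖ ^ 2) ≤
      ‖blockFst θ m z u v‖ ^ 2 + ‖blockSnd θ m z u v‖ ^ 2 := by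
  rw [abs_tan_half hθ] at hl ⊢
  rw [blockFst, blockSnd, rotRaise_apply, rotLower_apply]
  exact pair_lower_bound u v (cos_half_pos hθ) (Real.cos_sq_add_sin_sq _)
    (abs_sin_half_lt_cos_half hθ) hm z hl

theorem diracOscillator_lower_bound {θ m : ℝ}
    (hθ : θ ∈ Set.Ioo (-(Real.pi / 2)) (Real.pi / 2)) (hm : 0 ≤ m) (z : ℂ)
    (hl : 0 < (1 - |Real.tan (θ / 2)|) * |z.im| - |Real.tan (θ / 2)| * (m + |z.re|))
    (ψ : spinorDomain) :
    ((1 - |Real.tan (θ / 2)|) * |z.im| - |Real.tan (θ / 2)| * (m + |z.re|)) * ‖(ψ : SpinorL2)‖ ≤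
      ‖diracOscillator θ m ψ - z • (ψ : SpinorL2)‖ := by
  set l := (1 - |Real.tan (θ / 2)|) * |z.im| - |Real.tan (θ / 2)| * (m + |z.re|) with hldef
  refine le_of_sq_le_sq ?_ (norm_nonneg _)
  have h1 := two_mul_norm_sq_spinor (diracOscillator θ m ψ - z • (ψ : SpinorL2))
  rw [block_fst_add, block_snd_add, block_fst_sub, block_snd_sub, norm_neg, norm_smul, norm_smul,
    norm_neg, Complex.norm_I, one_mul, one_mul] at h1
  have h2 := block_lower_bound hθ hm z (component 0 ψ + component 2 ψ)
      (Complex.I • (component 1 ψ + component 3 ψ)) hl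
  have h3 := block_lower_bound hθ hm (-z) (component 0 ψ - component 2 ψ)
      (Complex.I • (component 1 ψ - component 3 ψ)) (by
        rwa [Complex.neg_im, Complex.neg_re, abs_neg, abs_neg])
  rw [Complex.neg_im, Complex.neg_re, abs_neg, abs_neg] at h3
  rw [← hldef, Submodule.coe_smul, norm_smul, Complex.norm_I, one_mul] at h2 h3
  have h4 := two_mul_norm_sq_spinor (ψ : SpinorL2)
  have h5 : 2 * (l * ‖(ψ : SpinorL2)‖) ^ 2 = l ^ 2 * (2 * ‖(ψ : SpinorL2)‖ ^ 2) := by ring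
  have e1 : ((component 0 ψ + component 2 ψ : formDomain) : L2) =
    (ψ : SpinorL2) 0 + (ψ : SpinorL2) 2 := rfl
  have e2 : ((component 1 ψ + component 3 ψ : formDomain) : L2) =
    (ψ : SpinorL2) 1 + (ψ : SpinorL2) 3 := rfl
  have e3 : ((component 0 ψ - component 2 ψ : formDomain) : L2) =
    (ψ : SpinorL2) 0 - (ψ : SpinorL2) 2 := rfl
  have e4 : ((component 1 ψ - component 3 ψ : formDomain) : L2) =
    (ψ : SpinorL2) 1 - (ψ : SpinorL2) 3 := rfl
  rw [e1, e2] at h2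
  rw [e3, e4] at h3
  have : 2 * (l * ‖(ψ : SpinorL2)‖) ^ 2 ≤
      2 * ‖diracOscillator θ m ψ - z • (ψ : SpinorL2)‖ ^ 2 := by
    rw [h5, h4, h1, mul_add]
    exact add_le_add h2 h3
  linarith

/-! ### The Gaussian transform of the blocks -/

/-- The exponent `-e^{iθ} / 2` of the Gaussians `exp (-e^{iθ} x² / 2 + w x)` that are eigenfunctions
of the rotated annihilation operator. -/
def rotExp (θ : ℝ) : ℂ := -Complex.exp (Complex.I * θ) / 2

theorem exp_I_mul_re (θ : ℝ) : (Complex.exp (Complex.I * θ)).re = Real.cos θ := by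
  rw [mul_comm, Complex.exp_ofReal_mul_I_re]

theorem rotExp_re_neg {θ : ℝ} (hθ : θ ∈ Set.Ioo (-(Real.pi / 2)) (Real.pi / 2)) :
    (rotExp θ).re < 0 := by
  have h := Real.cos_pos_of_mem_Ioo hθ
  have e : rotExp θ = ((-(1 / 2) : ℝ) : ℂ) * Complex.exp (Complex.I * θ) := by
    rw [rotExp]; push_cast; ring
  rw [e, Complex.re_ofReal_mul, exp_I_mul_re]
  linarith

theorem exp_half_mul_exp_neg_half (θ : ℝ) :
    Complex.exp (Complex.I * θ / 2) * Complex.exp (-Complex.I * θ / 2) = 1 := by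
  rw [← Complex.exp_add]
  ring_nf
  simp

theorem two_mul_rotExp (θ : ℝ) : 2 * rotExp θ = -Complex.exp (Complex.I * θ / 2) ^ 2 := by
  rw [rotExp, ← Complex.exp_nat_mul]
  push_cast
  ring_nf

theorem gaussianTransform_rotLower {θ : ℝ} (h : (rotExp θ).re < 0) (u : formDomain) (w : ℂ) :
    gaussianTransform h (rotLower θ u) w =
      2 * Complex.exp (Complex.I * θ / 2) * deriv (gaussianTransform h (u : L2)) w -
        Complex.exp (-Complex.I * θ / 2) * w * gaussianTransform h (u : L2) w := by
  have : rotLower θ u = Complex.exp (-Complex.I * θ / 2) • weakDeriv u +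
    Complex.exp (Complex.I * θ / 2) • mulX u := rfl
  rw [this, gaussianTransform_add, gaussianTransform_smul, gaussianTransform_smul,
    gaussianTransform_weakDeriv, gaussianTransform_mulX, two_mul_rotExp]
  linear_combination (Complex.exp (Complex.I * θ / 2) *
    deriv (gaussianTransform h (u : L2)) w) * exp_half_mul_exp_neg_half θ

theorem gaussianTransform_rotRaise {θ : ℝ} (h : (rotExp θ).re < 0) (u : formDomain) (w : ℂ) :
    gaussianTransform h (rotRaise θ u) w =
        Complex.exp (-Complex.I * θ / 2) * w * gaussianTransform h (u : L2) w := by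
  have : rotRaise θ u = Complex.exp (Complex.I * θ / 2) • mulX u -
    Complex.exp (-Complex.I * θ / 2) • weakDeriv u := rfl
  rw [this, gaussianTransform_sub, gaussianTransform_smul, gaussianTransform_smul,
    gaussianTransform_weakDeriv, gaussianTransform_mulX, two_mul_rotExp]
  linear_combination (-Complex.exp (Complex.I * θ / 2) *
    deriv (gaussianTransform h (u : L2)) w) * exp_half_mul_exp_neg_half θ

/-- The Gaussian transform turns the second order equation for the first component of a block into
a first order ordinary differential equation. -/
theorem gaussianTransform_block {θ : ℝ} (h : (rotExp θ).re < 0) (m : ℝ) (z : ℂ)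
    (u v : formDomain) (w : ℂ) :
    2 * w * deriv (gaussianTransform h (u : L2)) w -
        (z ^ 2 - m ^ 2 + Complex.exp (-Complex.I * θ / 2) ^ 2 * w ^ 2) *
          gaussianTransform h (u : L2) w =
      (m + z) * gaussianTransform h (blockFst θ m z u v) w +
        Complex.exp (-Complex.I * θ / 2) * w * gaussianTransform h (blockSnd θ m z u v) w := by
  rw [blockFst, blockSnd, gaussianTransform_add, gaussianTransform_sub, gaussianTransform_smul,
    gaussianTransform_smul, gaussianTransform_rotLower, gaussianTransform_rotRaise]
  linear_combination (-2 * w * deriv (gaussianTransform h (u : L2)) w) *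
    exp_half_mul_exp_neg_half θ

/-- Multiplication by this Gaussian removes the quadratic coefficient from the equation of
`gaussianTransform_block`. -/
theorem hasDerivAt_conjugated {U : ℂ → ℂ} (hU : Differentiable ℂ U) (e w : ℂ) :
    HasDerivAt (fun w => Complex.exp (-(e ^ 2 * w ^ 2) / 4) * U w)
      (Complex.exp (-(e ^ 2 * w ^ 2) / 4) * (deriv U w - e ^ 2 * w / 2 * U w)) w := by
  have h1 : HasDerivAt (fun w : ℂ => -(e ^ 2 * w ^ 2) / 4) (-(e ^ 2 * (2 * w)) / 4) w := by
    have := (((hasDerivAt_pow 2 w).const_mul (e ^ 2)).neg).div_const 4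
    simpa using this
  convert! (h1.cexp).fun_mul (hU w).hasDerivAt using 1
  ring

theorem eq_zero_of_transformed_equation {U : ℂ → ℂ} (hU : Differentiable ℂ U) {e μ : ℂ}
    (hμ : ∀ n : ℕ, μ / 2 ≠ n) (h : ∀ w, 2 * w * deriv U w = (μ + e ^ 2 * w ^ 2) * U w) (w : ℂ) :
    U w = 0 := by
  have h1 := eq_zero_of_mul_deriv_eq (W := fun w => Complex.exp (-(e ^ 2 * w ^ 2) / 4) * U w)
    (fun w => (hasDerivAt_conjugated hU e w).differentiableAt) hμ (fun w => by
      rw [(hasDerivAt_conjugated hU e w).deriv]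
      linear_combination (Complex.exp (-(e ^ 2 * w ^ 2) / 4) / 2) * h w) w
  exact (mul_eq_zero.1 h1).resolve_left (Complex.exp_ne_zero _)

theorem half_sq_sub_sq_ne_natCast (m : ℝ) {z : ℂ} (hz : z.im ≠ 0) (n : ℕ) :
    (z ^ 2 - m ^ 2) / 2 ≠ n := by
  intro h
  have h1 : z ^ 2 = ((2 * n + m ^ 2 : ℝ) : ℂ) := by
    push_cast
    linear_combination 2 * h
  have h2 := congrArg Complex.im h1
  have h3 := congrArg Complex.re h1
  rw [sq, Complex.mul_im, Complex.ofReal_im] at h2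
  rw [sq, Complex.mul_re, Complex.ofReal_re] at h3
  have h4 : z.re = 0 := by
    have : z.im * z.re = 0 := by linarith
    exact (mul_eq_zero.1 this).resolve_left hz
  rw [h4] at h3
  have h5 : (0 : ℝ) ≤ n := n.cast_nonneg
  have h6 := sq_nonneg m
  have h7 : 0 < z.im * z.im := mul_self_pos.2 hz
  linarith

theorem ofReal_add_ne_zero (m : ℝ) {z : ℂ} (hz : z.im ≠ 0) : (m : ℂ) + z ≠ 0 := by
  intro h
  have := congrArg Complex.im h
  simp at this
  exact hz this

/-- The blocks of `H_θ - z` are injective for nonreal `z`. -/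
theorem block_injective {θ : ℝ} (hθ : θ ∈ Set.Ioo (-(Real.pi / 2)) (Real.pi / 2)) (m : ℝ) {z : ℂ}
    (hz : z.im ≠ 0) {u v : formDomain} (h1 : blockFst θ m z u v = 0)
    (h2 : blockSnd θ m z u v = 0) : u = 0 ∧ v = 0 := by
  have hb := rotExp_re_neg hθ
  have hT0 (w : ℂ) : gaussianTransform hb 0 w = 0 := by
    have := gaussianTransform_smul hb 0 0 w
    rwa [zero_smul, zero_mul] at this
  have hu : (u : L2) = 0 := by
    refine eq_zero_of_gaussianTransform_eq_zero hb fun w => ?_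
    refine eq_zero_of_transformed_equation (differentiable_gaussianTransform hb _)
      (e := Complex.exp (-Complex.I * θ / 2)) (half_sq_sub_sq_ne_natCast m hz) (fun w => ?_) w
    have h := gaussianTransform_block hb m z u v w
    rw [h1, h2, hT0, mul_zero, mul_zero, add_zero] at h
    linear_combination h
  have hu' : u = 0 := Subtype.ext hu
  refine ⟨hu', ?_⟩
  rw [blockSnd, hu', map_zero, zero_sub, neg_eq_zero, smul_eq_zero] at h2
  exact Subtype.ext (h2.resolve_left (ofReal_add_ne_zero m hz))

theorem inner_schwartzL2_right (φ : 𝓢(ℝ, ℂ)) (F : L2) :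
    inner ℂ F (schwartzL2 φ) = ∫ x, φ x * (star F : L2) x := by
  rw [L2.inner_def]
  refine integral_congr_ae ?_
  filter_upwards [φ.coeFn_toLp 2 (volume : Measure ℝ), Lp.coeFn_star F] with x hx hs
  rw [RCLike.inner_apply, hx, hs]
  rfl

theorem eq_zero_of_star_eq_zero {F : L2} (h : star F = 0) : F = 0 := by
  apply Lp.ext
  filter_upwards [Lp.coeFn_star F, Lp.coeFn_zero ℂ 2 (volume : Measure ℝ)] with x h1 h2
  rw [h, h2] at h1
  rw [h2]
  exact star_eq_zero.1 h1.symm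

/-- The blocks of `H_θ - z` have dense range for nonreal `z`. -/
theorem block_dense {θ : ℝ} (hθ : θ ∈ Set.Ioo (-(Real.pi / 2)) (Real.pi / 2)) (m : ℝ) {z : ℂ}
    (hz : z.im ≠ 0) {F K : L2} (h : ∀ u v : formDomain,
      inner ℂ F (blockFst θ m z u v) + inner ℂ K (blockSnd θ m z u v) = (0 : ℂ)) :
    F = 0 ∧ K = 0 := by
  have hb := rotExp_re_neg hθ
  set e := Complex.exp (-Complex.I * θ / 2)
  -- testing against Gaussians turns orthogonality into differential equations for the Gaussian
  -- transforms of `star F` and `star K`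
  have hX (w : ℂ) : schwartzL2 (SchwartzMap.derivCLM ℂ ℂ (gaussian hb w)) =
      w • schwartzL2 (gaussian hb w) +
        (2 * rotExp θ) • schwartzL2 (schwartzMulX (gaussian hb w)) := by
    rw [deriv_gaussian, schwartzL2_add, schwartzL2_smul, schwartzL2_smul]
  have hL (w : ℂ) : rotLower θ (schwartzDomain (gaussian hb w)) =
      (e * w) • schwartzL2 (gaussian hb w) := by
    have : rotLower θ (schwartzDomain (gaussian hb w)) =
      e • weakDeriv (schwartzDomain (gaussian hb w)) +
      Complex.exp (Complex.I * θ / 2) • mulX (schwartzDomain (gaussian hb w)) := rfl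
    rw [this, weakDeriv_schwartzDomain, mulX_schwartzDomain, hX, two_mul_rotExp, smul_add,
      smul_smul, smul_smul, add_assoc, ← add_smul]
    have h0 : e * -Complex.exp (Complex.I * θ / 2) ^ 2 + Complex.exp (Complex.I * θ / 2) = 0 := by
      linear_combination (-Complex.exp (Complex.I * θ / 2)) * exp_half_mul_exp_neg_half θ
    rw [h0, zero_smul, add_zero]
  have hR (w : ℂ) : rotRaise θ (schwartzDomain (gaussian hb w)) =
      (2 * Complex.exp (Complex.I * θ / 2)) • schwartzL2 (schwartzMulX (gaussian hb w)) -
        (e * w) • schwartzL2 (gaussian hb w) := by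
    have : rotRaise θ (schwartzDomain (gaussian hb w)) =
      Complex.exp (Complex.I * θ / 2) • mulX (schwartzDomain (gaussian hb w)) -
      e • weakDeriv (schwartzDomain (gaussian hb w)) := rfl
    rw [this, weakDeriv_schwartzDomain, mulX_schwartzDomain, hX, two_mul_rotExp, smul_add,
      smul_smul, smul_smul]
    have h0 : e * -Complex.exp (Complex.I * θ / 2) ^ 2 = -Complex.exp (Complex.I * θ / 2) := by
      linear_combination (-Complex.exp (Complex.I * θ / 2)) * exp_half_mul_exp_neg_half θ
    rw [h0]
    module
  have hT (G : L2) (w : ℂ) : inner ℂ G (schwartzL2 (gaussian hb w)) =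
      gaussianTransform hb (star G) w := inner_schwartzL2_right _ _
  have hT' (G : L2) (w : ℂ) : inner ℂ G (schwartzL2 (schwartzMulX (gaussian hb w))) =
      deriv (gaussianTransform hb (star G)) w := by
    rw [inner_schwartzL2_right, (hasDerivAt_gaussianTransform hb (star G) w).deriv, gaussianMoment,
      pow_one]
  have h1 (w : ℂ) : (m - z) * gaussianTransform hb (star F) w +
      e * w * gaussianTransform hb (star K) w = 0 := by
    have := h (schwartzDomain (gaussian hb w)) 0
    rw [blockFst, blockSnd, map_zero, Submodule.coe_zero, smul_zero, sub_zero, add_zero, hL,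
      coe_schwartzDomain, inner_smul_right, inner_smul_right, hT, hT] at this
    exact this
  have h2 (w : ℂ) : 2 * Complex.exp (Complex.I * θ / 2) *
        deriv (gaussianTransform hb (star F)) w -
      e * w * gaussianTransform hb (star F) w = (m + z) * gaussianTransform hb (star K) w := by
    have := h 0 (schwartzDomain (gaussian hb w))
    rw [blockFst, blockSnd, map_zero, Submodule.coe_zero, smul_zero, zero_add, zero_sub, hR,
      coe_schwartzDomain, inner_sub_right, inner_neg_right, inner_smul_right, inner_smul_right,
      inner_smul_right, hT, hT, hT'] at this
    linear_combination this
  have hF : ∀ w, gaussianTransform hb (star F) w = 0 := by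
    refine eq_zero_of_transformed_equation (differentiable_gaussianTransform hb _)
      (e := e) (half_sq_sub_sq_ne_natCast m hz) (fun w => ?_)
    linear_combination e * w * h2 w + (m + z) * h1 w -
      (2 * w * deriv (gaussianTransform hb (star F)) w) * exp_half_mul_exp_neg_half θ
  have hK (w : ℂ) : gaussianTransform hb (star K) w = 0 := by
    have h3 := h2 w
    have h4 : deriv (gaussianTransform hb (star F)) w = 0 := by
      rw [show gaussianTransform hb (star F) = fun _ => 0 from funext hF, deriv_const]
    rw [hF, h4, mul_zero, mul_zero, sub_zero] at h3
    exact (mul_eq_zero.1 h3.symm).resolve_left (ofReal_add_ne_zero m hz)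
  exact ⟨eq_zero_of_star_eq_zero (eq_zero_of_gaussianTransform_eq_zero hb hF),
    eq_zero_of_star_eq_zero (eq_zero_of_gaussianTransform_eq_zero hb hK)⟩

/-! ### The resolvent of the Dirac operator -/

/-- The element of `𝒟⁴` with given components. -/
def spinor (g : Fin 4 → formDomain) : spinorDomain :=
  ⟨WithLp.toLp 2 fun j => (g j : L2), fun j => (g j).2⟩

@[simp]
theorem component_spinor (g : Fin 4 → formDomain) (j : Fin 4) : component j (spinor g) = g j := rfl

theorem eq_zero_of_components {ψ : SpinorL2} (h1 : ψ 0 + ψ 2 = 0) (h2 : ψ 1 + ψ 3 = 0)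
    (h3 : ψ 0 - ψ 2 = 0) (h4 : ψ 1 - ψ 3 = 0) : ψ = 0 := by
  have h := two_mul_norm_sq_spinor ψ
  rw [h1, h2, h3, h4, norm_zero] at h
  have : ‖ψ‖ ^ 2 = 0 := by linarith
  exact norm_eq_zero.1 (pow_eq_zero_iff two_ne_zero |>.1 this)

theorem diracOscillator_injective {θ : ℝ} (hθ : θ ∈ Set.Ioo (-(Real.pi / 2)) (Real.pi / 2))
    (m : ℝ) {z : ℂ} (hz : z.im ≠ 0) (ψ : spinorDomain)
    (h : diracOscillator θ m ψ - z • (ψ : SpinorL2) = 0) : (ψ : SpinorL2) = 0 := by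
  have h0 (j : Fin 4) : (diracOscillator θ m ψ - z • (ψ : SpinorL2)) j = 0 := by rw [h]; rfl
  have e1 := block_fst_add θ m z ψ
  have e2 := block_snd_add θ m z ψ
  have e3 := block_fst_sub θ m z ψ
  have e4 := block_snd_sub θ m z ψ
  rw [h0, h0, add_zero] at e1 e2
  rw [h0, h0, sub_zero] at e3 e4
  have hI : -Complex.I ≠ 0 := neg_ne_zero.2 Complex.I_ne_zero
  obtain ⟨a1, a2⟩ := block_injective hθ m hz e1.symm ((smul_eq_zero.1 e2.symm).resolve_left hI)
  obtain ⟨b1, b2⟩ := block_injective hθ m (z := -z) (by simpa using hz) (neg_eq_zero.1 e3.symm)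
    ((smul_eq_zero.1 e4.symm).resolve_left Complex.I_ne_zero)
  replace a2 := (smul_eq_zero.1 a2).resolve_left Complex.I_ne_zero
  replace b2 := (smul_eq_zero.1 b2).resolve_left Complex.I_ne_zero
  exact eq_zero_of_components (congrArg Subtype.val a1) (congrArg Subtype.val a2)
    (congrArg Subtype.val b1) (congrArg Subtype.val b2)

theorem two_mul_inner_spinor (f g : SpinorL2) :
    2 * inner ℂ f g = (inner ℂ (f 0 + f 2) (g 0 + g 2) + inner ℂ (f 1 + f 3) (g 1 + g 3) : ℂ) +
      (inner ℂ (f 0 - f 2) (g 0 - g 2) + inner ℂ (f 1 - f 3) (g 1 - g 3)) := by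
  rw [PiLp.inner_apply, Fin.sum_univ_four]
  simp only [inner_add_left, inner_add_right, inner_sub_left, inner_sub_right]
  ring

theorem diracOscillator_dense {θ : ℝ} (hθ : θ ∈ Set.Ioo (-(Real.pi / 2)) (Real.pi / 2))
    (m : ℝ) {z : ℂ} (hz : z.im ≠ 0) (f : SpinorL2)
    (h : ∀ ψ : spinorDomain, inner ℂ f (diracOscillator θ m ψ - z • (ψ : SpinorL2)) = (0 : ℂ)) :
    f = 0 := by
  have hb0 (z : ℂ) : blockFst θ m z 0 0 = 0 ∧ blockSnd θ m z 0 0 = 0 := by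
    simp [blockFst, blockSnd]
  have half (u : formDomain) : (1 / 2 : ℂ) • u + (1 / 2 : ℂ) • u = u := by module
  have half' (u : formDomain) : (1 / 2 : ℂ) • u - -((1 / 2 : ℂ) • u) = u := by module
  have hI (u : formDomain) : Complex.I • (-Complex.I • u) = u := by
    rw [smul_smul, mul_neg, Complex.I_mul_I, neg_neg, one_smul]
  -- spinors with equal, respectively opposite, halves excite only one of the two blocks
  have h1 : f 0 + f 2 = 0 ∧ Complex.I • (f 1 + f 3) = 0 := by
    refine block_dense hθ m hz fun u v => ?_
    have h2 := h (spinor ![(1 / 2 : ℂ) • u, (1 / 2 : ℂ) • (-Complex.I • v), (1 / 2 : ℂ) • u,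
      (1 / 2 : ℂ) • (-Complex.I • v)])
    have h3 := two_mul_inner_spinor f (diracOscillator θ m (spinor ![(1 / 2 : ℂ) • u,
      (1 / 2 : ℂ) • (-Complex.I • v), (1 / 2 : ℂ) • u, (1 / 2 : ℂ) • (-Complex.I • v)]) -
      z • ((spinor ![(1 / 2 : ℂ) • u, (1 / 2 : ℂ) • (-Complex.I • v), (1 / 2 : ℂ) • u,
      (1 / 2 : ℂ) • (-Complex.I • v)] : spinorDomain) : SpinorL2))
    rw [h2, block_fst_add, block_snd_add, block_fst_sub, block_snd_sub] at h3
    simp only [component_spinor, Matrix.cons_val] at h3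
    rw [half, half, sub_self, sub_self, smul_zero, (hb0 _).1, (hb0 _).2, smul_zero, neg_zero,
      inner_zero_right, inner_zero_right, add_zero, add_zero, mul_zero, hI, inner_smul_right] at h3
    rw [inner_smul_left, Complex.conj_I, h3]
  have h2 : -(f 0 - f 2) = 0 ∧ -Complex.I • (f 1 - f 3) = 0 := by
    refine block_dense hθ m (z := -z) (by simpa using hz) fun u v => ?_
    have h2 := h (spinor ![(1 / 2 : ℂ) • u, (1 / 2 : ℂ) • (-Complex.I • v), -((1 / 2 : ℂ) • u),
      -((1 / 2 : ℂ) • (-Complex.I • v))])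
    have h3 := two_mul_inner_spinor f (diracOscillator θ m (spinor ![(1 / 2 : ℂ) • u,
      (1 / 2 : ℂ) • (-Complex.I • v), -((1 / 2 : ℂ) • u), -((1 / 2 : ℂ) • (-Complex.I • v))]) -
      z • ((spinor ![(1 / 2 : ℂ) • u, (1 / 2 : ℂ) • (-Complex.I • v), -((1 / 2 : ℂ) • u),
      -((1 / 2 : ℂ) • (-Complex.I • v))] : spinorDomain) : SpinorL2))
    rw [h2, block_fst_add, block_snd_add, block_fst_sub, block_snd_sub] at h3
    simp only [component_spinor, Matrix.cons_val] at h3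
    rw [half', half', add_neg_cancel, add_neg_cancel, smul_zero, (hb0 _).1, (hb0 _).2, smul_zero,
      inner_zero_right, inner_zero_right, add_zero, zero_add, mul_zero, hI, inner_smul_right,
      inner_neg_right] at h3
    rw [inner_neg_left, inner_smul_left, map_neg, Complex.conj_I, neg_neg, h3]
  have hI' : -Complex.I ≠ 0 := neg_ne_zero.2 Complex.I_ne_zero
  exact eq_zero_of_components h1.1 ((smul_eq_zero.1 h1.2).resolve_left Complex.I_ne_zero)
    (neg_eq_zero.1 h2.1) ((smul_eq_zero.1 h2.2).resolve_left hI')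

theorem norm_lower_le_raise (u : formDomain) : ‖lower u‖ ≤ ‖raise u‖ := by
  refine le_of_sq_le_sq ?_ (norm_nonneg _)
  rw [norm_sq_raise]
  linarith [sq_nonneg ‖(u : L2)‖]

theorem norm_ofReal_smul_L2 (r : ℝ) (u : L2) : ‖(r : ℂ) • u‖ = |r| * ‖u‖ := by
  rw [norm_smul, Complex.norm_real, Real.norm_eq_abs]

theorem norm_I_ofReal_smul_L2 (r : ℝ) (u : L2) : ‖(Complex.I * r) • u‖ = |r| * ‖u‖ := by
  rw [norm_smul, norm_mul, Complex.norm_I, one_mul, Complex.norm_real, Real.norm_eq_abs]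

theorem norm_lower_le_rotLower {θ : ℝ} (hθ : θ ∈ Set.Ioo (-(Real.pi / 2)) (Real.pi / 2))
    (u : formDomain) : (Real.cos (θ / 2) - |Real.sin (θ / 2)|) * ‖lower u‖ ≤
      ‖rotLower θ u‖ + 2 * ‖(u : L2)‖ := by
  have h1 := norm_le_add_norm_add ((Real.cos (θ / 2) : ℂ) • lower u)
    ((Complex.I * (Real.sin (θ / 2) : ℂ)) • raise u)
  rw [← rotLower_apply, norm_ofReal_smul_L2, norm_I_ofReal_smul_L2,
    abs_of_pos (cos_half_pos hθ)] at h1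
  have h2 := mul_le_mul_of_nonneg_left (norm_raise_le u) (abs_nonneg (Real.sin (θ / 2)))
  have h3 := mul_le_mul_of_nonneg_right (Real.abs_sin_le_one (θ / 2)) (norm_nonneg (u : L2))
  linarith

theorem norm_lower_le_rotRaise {θ : ℝ} (hθ : θ ∈ Set.Ioo (-(Real.pi / 2)) (Real.pi / 2))
    (u : formDomain) : (Real.cos (θ / 2) - |Real.sin (θ / 2)|) * ‖lower u‖ ≤ ‖rotRaise θ u‖ := by
  have h1 := norm_le_add_norm_add ((Real.cos (θ / 2) : ℂ) • raise u)
    ((Complex.I * (Real.sin (θ / 2) : ℂ)) • lower u)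
  rw [← rotRaise_apply, norm_ofReal_smul_L2, norm_I_ofReal_smul_L2,
    abs_of_pos (cos_half_pos hθ)] at h1
  have h2 := mul_le_mul_of_nonneg_left (norm_lower_le_raise u) (cos_half_pos hθ).le
  linarith

/-- The graph norm of `H_θ` controls the norm of `𝒟` componentwise, because `|sin (θ/2)|` is smaller
than `cos (θ/2)`. -/
theorem norm_lower_component_le {θ m : ℝ} (hθ : θ ∈ Set.Ioo (-(Real.pi / 2)) (Real.pi / 2))
    (hm : 0 ≤ m) (ψ : spinorDomain) (j : Fin 4) :
    ‖lower (component j ψ)‖ ≤ (m + 2) / (Real.cos (θ / 2) - |Real.sin (θ / 2)|) *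
      (‖diracOscillator θ m ψ‖ + ‖(ψ : SpinorL2)‖) := by
  have hd := sub_pos.2 (abs_sin_half_lt_cos_half hθ)
  rw [div_mul_eq_mul_div, le_div_iff₀ hd, mul_comm]
  have hc (k : Fin 4) : ‖(component k ψ : L2)‖ ≤ ‖(ψ : SpinorL2)‖ := PiLp.norm_apply_le _ k
  have hH (k : Fin 4) : ‖(diracOscillator θ m ψ) k‖ ≤ ‖diracOscillator θ m ψ‖ :=
    PiLp.norm_apply_le _ k
  have hA := norm_nonneg (diracOscillator θ m ψ)
  have hB := norm_nonneg (ψ : SpinorL2)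
  have hmA := mul_nonneg hm hA
  have raise_le (k l i : Fin 4) (h : (diracOscillator θ m ψ) k =
      Complex.I • rotRaise θ (component l ψ) + (m : ℂ) • (component i ψ : L2)) :
      ‖rotRaise θ (component l ψ)‖ ≤ ‖diracOscillator θ m ψ‖ + m * ‖(ψ : SpinorL2)‖ := by
    have h1 := norm_le_add_norm_add (Complex.I • rotRaise θ (component l ψ))
      ((m : ℂ) • (component i ψ : L2))
    rw [← h, norm_smul, Complex.norm_I, one_mul, norm_ofReal_smul_L2, abs_of_nonneg hm] at h1
    have := mul_le_mul_of_nonneg_left (hc i) hm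
    linarith [hH k]
  have lower_le (k l i : Fin 4) (h : (diracOscillator θ m ψ) k =
      -(Complex.I • rotLower θ (component l ψ)) - (m : ℂ) • (component i ψ : L2)) :
      ‖rotLower θ (component l ψ)‖ ≤ ‖diracOscillator θ m ψ‖ + m * ‖(ψ : SpinorL2)‖ := by
    have h1 := norm_le_add_norm_add (Complex.I • rotLower θ (component l ψ))
      ((m : ℂ) • (component i ψ : L2))
    rw [show Complex.I • rotLower θ (component l ψ) + (m : ℂ) • (component i ψ : L2) =
      -(diracOscillator θ m ψ) k by rw [h]; module, norm_neg, norm_smul, Complex.norm_I, one_mul,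
      norm_ofReal_smul_L2, abs_of_nonneg hm] at h1
    have := mul_le_mul_of_nonneg_left (hc i) hm
    linarith [hH k]
  have hj := hc j
  fin_cases j
  · have h1 := norm_lower_le_rotLower hθ (component 0 ψ)
    have h2 := lower_le 3 0 1 (diracOscillator_three θ m ψ)
    have h3 := hc 0
    refine le_trans h1 ?_
    linarith
  · have h1 := norm_lower_le_rotRaise hθ (component 1 ψ)
    have h2 := raise_le 2 1 0 (diracOscillator_two θ m ψ)
    refine le_trans h1 ?_
    linarith
  · have h1 := norm_lower_le_rotLower hθ (component 2 ψ)
    have h2 := lower_le 1 2 3 (diracOscillator_one θ m ψ)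
    have h3 := hc 2
    refine le_trans h1 ?_
    linarith
  · have h1 := norm_lower_le_rotRaise hθ (component 3 ψ)
    have h2 := raise_le 0 3 2 (diracOscillator_zero θ m ψ)
    refine le_trans h1 ?_
    linarith

theorem isClosed_diracOscillator {θ m : ℝ} (hθ : θ ∈ Set.Ioo (-(Real.pi / 2)) (Real.pi / 2))
    (hm : 0 ≤ m) : (diracOscillator θ m).IsClosed := by
  refine isClosed_of_closure_subset fun p hp => ?_
  obtain ⟨x, hx, hxp⟩ := mem_closure_iff_seq_limit.1 hp
  have hx' : ∀ n, ∃ ψ : spinorDomain, (ψ : SpinorL2) = (x n).1 ∧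
      diracOscillator θ m ψ = (x n).2 := fun n => (LinearPMap.mem_graph_iff _).1 (hx n)
  choose ψ hψ1 hψ2 using hx'
  obtain ⟨w, φ⟩ := p
  have hw : Tendsto (fun n => (ψ n : SpinorL2)) atTop (𝓝 w) := by
    simp_rw [hψ1]; exact (continuous_fst.tendsto _).comp hxp
  have hφ : Tendsto (fun n => diracOscillator θ m (ψ n)) atTop (𝓝 φ) := by
    simp_rw [hψ2]; exact (continuous_snd.tendsto _).comp hxp
  have happ (j : Fin 4) : Continuous fun f : SpinorL2 => f j := PiLp.continuous_apply 2 _ j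
  have hwj (j : Fin 4) : Tendsto (fun n => (component j (ψ n) : L2)) atTop (𝓝 (w j)) :=
    ((happ j).tendsto w).comp hw
  have hlim (j : Fin 4) : ∃ h : w j ∈ formDomain,
      Tendsto (fun n => lower (component j (ψ n))) atTop (𝓝 (lower ⟨w j, h⟩)) ∧
      Tendsto (fun n => raise (component j (ψ n))) atTop (𝓝 (raise ⟨w j, h⟩)) := by
    set C := (m + 2) / (Real.cos (θ / 2) - |Real.sin (θ / 2)|)
    have hC : 0 ≤ C := div_nonneg (by linarith) (sub_pos.2 (abs_sin_half_lt_cos_half hθ)).le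
    have hCs : CauchySeq fun n => lower (component j (ψ n)) := by
      have hs : CauchySeq fun n => (diracOscillator θ m (ψ n), (ψ n : SpinorL2)) :=
        (hφ.prodMk_nhds hw).cauchySeq
      rw [Metric.cauchySeq_iff] at hs ⊢
      intro ε hε
      obtain ⟨N, hN⟩ := hs (ε / (2 * C + 1)) (by positivity)
      refine ⟨N, fun a ha b hb => ?_⟩
      have h1 := hN a ha b hb
      rw [Prod.dist_eq, max_lt_iff, dist_eq_norm, dist_eq_norm] at h1
      have h2 := norm_lower_component_le hθ hm (ψ a - ψ b) j
      have e : diracOscillator θ m (ψ a - ψ b) =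
        diracOscillator θ m (ψ a) - diracOscillator θ m (ψ b) :=
          map_sub (diracOscillator θ m).toFun _ _
      rw [map_sub, map_sub, Submodule.coe_sub, e] at h2
      rw [dist_eq_norm]
      refine h2.trans_lt ?_
      have h3 : C * (‖diracOscillator θ m (ψ a) - diracOscillator θ m (ψ b)‖ +
          ‖(ψ a : SpinorL2) - (ψ b : SpinorL2)‖) ≤ C * (2 * (ε / (2 * C + 1))) :=
        mul_le_mul_of_nonneg_left (by linarith [h1.1, h1.2]) hC
      refine h3.trans_lt ?_
      rw [← sub_pos]
      have : ε - C * (2 * (ε / (2 * C + 1))) = ε / (2 * C + 1) := by field_simp; ring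
      rw [this]
      positivity
    have hCr : CauchySeq fun n => raise (component j (ψ n)) := by
      have hs : CauchySeq fun n => (lower (component j (ψ n)), (component j (ψ n) : L2)) :=
        hCs.prodMk (hwj j).cauchySeq
      rw [Metric.cauchySeq_iff] at hs ⊢
      intro ε hε
      obtain ⟨N, hN⟩ := hs (ε / 3) (by positivity)
      refine ⟨N, fun a ha b hb => ?_⟩
      have h1 := hN a ha b hb
      rw [Prod.dist_eq, max_lt_iff, dist_eq_norm, dist_eq_norm] at h1
      have h2 := norm_raise_le (component j (ψ a) - component j (ψ b))
      rw [map_sub, map_sub, Submodule.coe_sub] at h2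
      rw [dist_eq_norm]
      linarith [h1.1, h1.2]
    obtain ⟨p, hp⟩ := cauchySeq_tendsto_of_complete hCs
    obtain ⟨q, hq⟩ := cauchySeq_tendsto_of_complete hCr
    obtain ⟨h, h1, h2⟩ := exists_of_tendsto_lower (hwj j) hp hq
    exact ⟨h, h1 ▸ hp, h2 ▸ hq⟩
  choose hmem hlow hraise using hlim
  set W : spinorDomain := ⟨w, hmem⟩ with hW
  have hL (j : Fin 4) : Tendsto (fun n => rotLower θ (component j (ψ n))) atTop
      (𝓝 (rotLower θ (component j W))) := by
    simp_rw [rotLower_apply]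
    exact ((hlow j).const_smul _).add ((hraise j).const_smul _)
  have hR (j : Fin 4) : Tendsto (fun n => rotRaise θ (component j (ψ n))) atTop
      (𝓝 (rotRaise θ (component j W))) := by
    simp_rw [rotRaise_apply]
    exact ((hraise j).const_smul _).add ((hlow j).const_smul _)
  refine (LinearPMap.mem_graph_iff _).2 ⟨W, rfl, ?_⟩
  have hφj (j : Fin 4) : Tendsto (fun n => (diracOscillator θ m (ψ n)) j) atTop (𝓝 (φ j)) :=
    ((happ j).tendsto φ).comp hφ
  have key (j : Fin 4) (h : Tendsto (fun n => (diracOscillator θ m (ψ n)) j) atTop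
      (𝓝 ((diracOscillator θ m W) j))) : (diracOscillator θ m W) j = φ j :=
    tendsto_nhds_unique h (hφj j)
  ext1 j
  refine key j ?_
  fin_cases j
  · change Tendsto _ _ (𝓝 ((diracOscillator θ m W) 0))
    rw [diracOscillator_zero]
    exact (((hR 3).const_smul Complex.I).add ((hwj 2).const_smul (m : ℂ))).congr
      fun n => (diracOscillator_zero θ m (ψ n)).symm
  · change Tendsto _ _ (𝓝 ((diracOscillator θ m W) 1))
    rw [diracOscillator_one]
    exact (((hL 2).const_smul Complex.I).neg.sub ((hwj 3).const_smul (m : ℂ))).congr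
      fun n => (diracOscillator_one θ m (ψ n)).symm
  · change Tendsto _ _ (𝓝 ((diracOscillator θ m W) 2))
    rw [diracOscillator_two]
    exact (((hR 1).const_smul Complex.I).add ((hwj 0).const_smul (m : ℂ))).congr
      fun n => (diracOscillator_two θ m (ψ n)).symm
  · change Tendsto _ _ (𝓝 ((diracOscillator θ m W) 3))
    rw [diracOscillator_three]
    exact (((hL 0).const_smul Complex.I).neg.sub ((hwj 1).const_smul (m : ℂ))).congr
      fun n => (diracOscillator_three θ m (ψ n)).symm

/-! ### Compactness of the resolvent -/

/-- The orthogonal projection onto the first `N` Hermite functions. -/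
def hermiteProj (N : ℕ) : L2 →L[ℂ] L2 :=
  ∑ n ∈ Finset.range N, (innerSL ℂ (schwartzL2 (hermite n))).smulRight (schwartzL2 (hermite n))

theorem hermiteProj_apply (N : ℕ) (u : L2) :
    hermiteProj N u = ∑ n ∈ Finset.range N, coef n u • schwartzL2 (hermite n) := by
  rw [hermiteProj, sum_apply]
  rfl

theorem coef_sub_hermiteProj (N k : ℕ) (u : L2) :
    coef k (u - hermiteProj N u) = if k < N then 0 else coef k u := by
  have h := orthonormal_iff_ite.1 orthonormal_hermite
  rw [coef, inner_sub_right, hermiteProj_apply, inner_sum]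
  simp only [inner_smul_right, h, mul_ite, mul_one, mul_zero, Finset.sum_ite_eq, Finset.mem_range]
  split_ifs
  · exact sub_self _
  · exact sub_zero _

theorem norm_sub_hermiteProj_sq_le (N : ℕ) (u : formDomain) :
    2 * N * ‖(u : L2) - hermiteProj N u‖ ^ 2 ≤ ‖lower u‖ ^ 2 := by
  refine hasSum_le (fun k => ?_)
    ((hasSum_norm_sq ((u : L2) - hermiteProj N u)).mul_left (2 * N : ℝ))
    (hasSum_norm_sq_lower u)
  rw [coef_sub_hermiteProj]
  split_ifs with h
  · rw [norm_zero, zero_pow two_ne_zero, mul_zero]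
    positivity
  · have : (N : ℝ) ≤ k := by exact_mod_cast not_lt.1 h
    gcongr

theorem isCompactOperator_hermiteProj (N : ℕ) : IsCompactOperator (hermiteProj N) := by
  refine (Submodule.sum_mem (compactOperator (RingHom.id ℂ) L2 L2) (t := Finset.range N)
    (f := fun n => (innerSL ℂ (schwartzL2 (hermite n))).smulRight (schwartzL2 (hermite n)))
    fun n _ => ?_ :)
  have h : IsCompactOperator (innerSL ℂ (schwartzL2 (hermite n)) : L2 →L[ℂ] ℂ) :=
    ⟨Metric.closedBall 0 1, isCompact_closedBall 0 1,
      (innerSL ℂ (schwartzL2 (hermite n))).continuous.continuousAt.preimage_mem_nhds (by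
        rw [map_zero]; exact Metric.closedBall_mem_nhds 0 one_pos)⟩
  exact h.clm_comp (ContinuousLinearMap.toSpanSingleton ℂ (schwartzL2 (hermite n)))

/-- A bounded operator with values in `𝒟` that is bounded for the norm of the annihilation operator
is a limit of finite rank operators. -/
theorem isCompactOperator_of_lower_bounded {T : SpinorL2 →L[ℂ] L2} (hT : ∀ f, T f ∈ formDomain)
    {C : ℝ} (hC : ∀ f, ‖lower ⟨T f, hT f⟩‖ ≤ C * ‖f‖) : IsCompactOperator T := by
  have hlim : Tendsto (fun N : ℕ => hermiteProj N ∘L T) atTop (𝓝 T) := by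
    rw [tendsto_iff_norm_sub_tendsto_zero]
    refine squeeze_zero' (g := fun N : ℕ => |C| * (Real.sqrt N)⁻¹)
      (Eventually.of_forall fun _ => norm_nonneg _) ?_ ?_
    · filter_upwards [eventually_gt_atTop 0] with N hN
      have hN' : (0 : ℝ) < N := by exact_mod_cast hN
      refine ContinuousLinearMap.opNorm_le_bound _ (by positivity) fun f => ?_
      have h1 := norm_sub_hermiteProj_sq_le N ⟨T f, hT f⟩
      have h2 : ‖lower ⟨T f, hT f⟩‖ ≤ |C| * ‖f‖ :=
        (hC f).trans (mul_le_mul_of_nonneg_right (le_abs_self C) (norm_nonneg f))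
      have h3 : ‖(hermiteProj N ∘L T - T) f‖ = ‖T f - hermiteProj N (T f)‖ := norm_sub_rev _ _
      rw [h3]
      refine le_of_sq_le_sq ?_ (by positivity)
      rw [mul_pow, mul_pow, inv_pow, Real.sq_sqrt hN'.le]
      have h4 : ‖lower ⟨T f, hT f⟩‖ ^ 2 ≤ (|C| * ‖f‖) ^ 2 := by gcongr
      rw [mul_right_comm, ← mul_pow, ← div_eq_mul_inv, le_div_iff₀ hN']
      have h5 : 0 ≤ (N : ℝ) * ‖T f - hermiteProj N (T f)‖ ^ 2 := by positivity
      change 2 * N * ‖T f - hermiteProj N (T f)‖ ^ 2 ≤ _ at h1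
      linarith
    · have h := (tendsto_inv_atTop_zero.comp
        (Real.tendsto_sqrt_atTop.comp tendsto_natCast_atTop_atTop)).const_mul |C|
      rw [mul_zero] at h
      exact h
  exact isCompactOperator_of_tendsto hlim
    (Eventually.of_forall fun N => (isCompactOperator_hermiteProj N).comp_clm T)

theorem isCompactOperator_of_components {R : SpinorL2 →L[ℂ] SpinorL2}
    (h : ∀ j, IsCompactOperator fun f => (R f) j) : IsCompactOperator R := by
  choose K hK hK' using h
  refine ⟨(PiLp.continuousLinearEquiv 2 ℂ (fun _ : Fin 4 => L2)).symm '' Set.univ.pi K,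
    (isCompact_univ_pi hK).image (ContinuousLinearEquiv.continuous _), ?_⟩
  filter_upwards [(Filter.iInter_mem.2 hK' : (⋂ j, (fun f => (R f) j) ⁻¹' K j) ∈ 𝓝 0)] with f hf
  exact ⟨fun j => (R f) j, fun j _ => Set.mem_iInter.1 hf j, rfl⟩

theorem isCompactOperator_resolvent {θ m : ℝ} (hθ : θ ∈ Set.Ioo (-(Real.pi / 2)) (Real.pi / 2))
    (hm : 0 ≤ m) {z : ℂ} {R : SpinorL2 →L[ℂ] SpinorL2}
    (hR : UnboundedOperator.IsResolventAt (diracOscillator θ m) z R) : IsCompactOperator R := by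
  refine isCompactOperator_of_components fun j => ?_
  set C := (m + 2) / (Real.cos (θ / 2) - |Real.sin (θ / 2)|)
  have hC : 0 ≤ C := div_nonneg (by linarith) (sub_pos.2 (abs_sin_half_lt_cos_half hθ)).le
  refine isCompactOperator_of_lower_bounded (T := PiLp.proj 2 (fun _ : Fin 4 => L2) j ∘L R)
    (fun f => hR.mem_domain f j) (C := C * (1 + ‖z‖ * ‖R‖ + ‖R‖)) fun f => ?_
  have h1 := norm_lower_component_le hθ hm ⟨R f, hR.mem_domain f⟩ j
  refine h1.trans ?_
  rw [mul_assoc]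
  refine mul_le_mul_of_nonneg_left ?_ hC
  have h2 : diracOscillator θ m ⟨R f, hR.mem_domain f⟩ = f + z • R f := by
    rw [← sub_eq_iff_eq_add]
    exact hR.right_inv f
  have h3 := R.le_opNorm f
  have h4 : ‖diracOscillator θ m ⟨R f, hR.mem_domain f⟩‖ ≤ ‖f‖ + ‖z‖ * (‖R‖ * ‖f‖) := by
    rw [h2]
    refine (norm_add_le _ _).trans ?_
    rw [norm_smul]
    gcongr
  refine (add_le_add h4 h3).trans (le_of_eq ?_)
  ring

/-! ### The resolvent set -/

theorem exists_isResolventAt_of_lower_bound {θ m : ℝ}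
    (hθ : θ ∈ Set.Ioo (-(Real.pi / 2)) (Real.pi / 2)) (hm : 0 ≤ m) {z : ℂ}
    (hl : |Real.tan (θ / 2)| * (m + |z.re|) < (1 - |Real.tan (θ / 2)|) * |z.im|) :
    ∃ R, UnboundedOperator.IsResolventAt (diracOscillator θ m) z R ∧
      ‖R‖ ≤ 1 / ((1 - |Real.tan (θ / 2)|) * |z.im| - |Real.tan (θ / 2)| * (m + |z.re|)) := by
  have hz : z.im ≠ 0 := by
    intro h
    rw [h, abs_zero, mul_zero] at hl
    have : 0 ≤ |Real.tan (θ / 2)| * (m + |z.re|) := by positivity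
    linarith
  exact UnboundedOperator.exists_isResolventAt (isClosed_diracOscillator hθ hm) (sub_pos.2 hl)
    (fun ψ => diracOscillator_lower_bound hθ hm z (sub_pos.2 hl) ψ)
    (fun f hf => diracOscillator_dense hθ m hz f hf)

/-- The spectrum of `H_θ` is real. -/
theorem mem_resolventSet_of_im_ne_zero {θ m : ℝ}
    (hθ : θ ∈ Set.Ioo (-(Real.pi / 2)) (Real.pi / 2)) (hm : 0 ≤ m) {z : ℂ} (hz : z.im ≠ 0) :
    z ∈ UnboundedOperator.resolventSet (diracOscillator θ m) := by
  have ht : 0 < 1 - |Real.tan (θ / 2)| := by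
    rw [abs_tan_half hθ, sub_pos, div_lt_one (cos_half_pos hθ)]
    exact abs_sin_half_lt_cos_half hθ
  set b : ℝ := (|Real.tan (θ / 2)| * m + 1) / (1 - |Real.tan (θ / 2)|) with hb
  have hb0 : 0 < b := by positivity
  obtain ⟨R, hR, -⟩ := exists_isResolventAt_of_lower_bound hθ hm (z := b * Complex.I) (by
    simp only [Complex.re_ofReal_mul, Complex.im_ofReal_mul, Complex.I_re, Complex.I_im, mul_zero,
      mul_one, abs_zero, add_zero]
    rw [abs_of_pos hb0, hb, mul_div_cancel₀ _ ht.ne']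
    linarith)
  exact UnboundedOperator.mem_resolventSet_of_isCompactOperator hR
    (isCompactOperator_resolvent hθ hm hR) fun ψ hψ => diracOscillator_injective hθ m hz ψ hψ

/-! ### The Gamma integral along rotated rays -/

theorem integrableOn_rpow_mul_exp_neg_mul {s b : ℝ} (hs : -1 < s) (hb : 0 < b) :
    IntegrableOn (fun t : ℝ => t ^ s * Real.exp (-b * t)) (Set.Ioi 0) := by
  have h := integrableOn_rpow_mul_exp_neg_mul_rpow hs one_pos hb
  simpa only [Real.rpow_one] using h

theorem norm_cpow_mul_cexp_neg {s r : ℂ} {t : ℝ} (ht : 0 < t) :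
    ‖(t : ℂ) ^ s * Complex.exp (-(r * t))‖ = t ^ s.re * Real.exp (-r.re * t) := by
  rw [norm_mul, Complex.norm_cpow_eq_rpow_re_of_pos ht, Complex.norm_exp, Complex.neg_re,
    Complex.re_mul_ofReal, neg_mul]

theorem aestronglyMeasurable_cpow_mul_cexp_neg (s r : ℂ) :
    AEStronglyMeasurable (fun t : ℝ => (t : ℂ) ^ s * Complex.exp (-(r * t)))
      (volume.restrict (Set.Ioi 0)) := by
  refine ContinuousOn.aestronglyMeasurable (fun t ht => ?_) measurableSet_Ioi
  refine ContinuousAt.continuousWithinAt (ContinuousAt.mul ?_ (by fun_prop))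
  exact Complex.continuousAt_ofReal_cpow_const _ _ (Or.inr (ne_of_gt ht))

theorem integrableOn_cpow_mul_cexp_neg {s r : ℂ} (hs : -1 < s.re) (hr : 0 < r.re) :
    IntegrableOn (fun t : ℝ => (t : ℂ) ^ s * Complex.exp (-(r * t))) (Set.Ioi 0) := by
  refine (integrableOn_rpow_mul_exp_neg_mul hs hr).mono'
    (aestronglyMeasurable_cpow_mul_cexp_neg s r) ?_
  filter_upwards [ae_restrict_mem measurableSet_Ioi] with t ht
  exact (norm_cpow_mul_cexp_neg ht).le

theorem differentiableOn_integral_cpow_mul_cexp_neg {a : ℂ} (ha : 0 < a.re) :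
    DifferentiableOn ℂ
      (fun r : ℂ => ∫ t : ℝ in Set.Ioi 0, (t : ℂ) ^ (a - 1) * Complex.exp (-(r * t)))
      {r | 0 < r.re} := by
  intro r₀ hr₀
  have hr₀' : 0 < r₀.re := hr₀
  have hs : -1 < (a - 1).re := by rw [Complex.sub_re, Complex.one_re]; linarith
  refine DifferentiableAt.differentiableWithinAt (HasDerivAt.differentiableAt
    (hasDerivAt_integral_of_dominated_loc_of_deriv_le
    (bound := fun t : ℝ => t ^ a.re * Real.exp (-(r₀.re / 2) * t))
    (F := fun (r : ℂ) (t : ℝ) => (t : ℂ) ^ (a - 1) * Complex.exp (-(r * t)))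
    (F' := fun (r : ℂ) (t : ℝ) => -((t : ℂ) ^ a * Complex.exp (-(r * t))))
    (Metric.ball_mem_nhds r₀ (half_pos hr₀')) (Eventually.of_forall fun r =>
      aestronglyMeasurable_cpow_mul_cexp_neg _ _) (integrableOn_cpow_mul_cexp_neg hs hr₀')
    (aestronglyMeasurable_cpow_mul_cexp_neg _ _).neg ?_
    (integrableOn_rpow_mul_exp_neg_mul (by linarith) (half_pos hr₀')) ?_).2)
  · filter_upwards [ae_restrict_mem measurableSet_Ioi] with t ht r hr
    have ht' : 0 < t := ht
    rw [norm_neg, norm_cpow_mul_cexp_neg ht']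
    have h1 : |(r - r₀).re| < r₀.re / 2 :=
      (Complex.abs_re_le_norm _).trans_lt (by rw [← dist_eq_norm]; exact hr)
    rw [Complex.sub_re, abs_lt] at h1
    gcongr
    nlinarith [h1.1]
  · filter_upwards [ae_restrict_mem measurableSet_Ioi] with t ht r hr
    have ht' : (t : ℂ) ≠ 0 := by exact_mod_cast (ne_of_gt ht)
    have h1 : HasDerivAt (fun r : ℂ => Complex.exp (-(r * t)))
        (Complex.exp (-(r * t)) * -(1 * t)) r :=
      (((hasDerivAt_id r).mul_const (t : ℂ)).neg).cexp
    convert! h1.const_mul ((t : ℂ) ^ (a - 1)) using 1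
    rw [Complex.cpow_sub _ _ ht', Complex.cpow_one]
    field_simp

/-- The Gamma integral with a complex rate, by analytic continuation from real rates. -/
theorem integral_cpow_mul_cexp_neg {a r : ℂ} (ha : 0 < a.re) (hr : 0 < r.re) :
    ∫ t : ℝ in Set.Ioi 0, (t : ℂ) ^ (a - 1) * Complex.exp (-(r * t)) =
      (1 / r) ^ a * Complex.Gamma a := by
  have hopen : IsOpen {r : ℂ | 0 < r.re} := isOpen_lt continuous_const Complex.continuous_re
  have hconv : Convex ℝ {r : ℂ | 0 < r.re} := convex_halfSpace_re_gt 0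
  have hg : DifferentiableOn ℂ (fun r : ℂ => (1 / r) ^ a * Complex.Gamma a) {r | 0 < r.re} := by
    intro r hr
    have hr' : 0 < r.re := hr
    have hr0 : r ≠ 0 := by rintro rfl; simp at hr'
    refine DifferentiableAt.differentiableWithinAt (DifferentiableAt.mul_const ?_ _)
    refine DifferentiableAt.cpow_const (by fun_prop (disch := exact hr0)) (Or.inl ?_)
    rw [one_div, Complex.inv_re]
    exact div_pos hr' (Complex.normSq_pos.2 hr0)
  refine ((differentiableOn_integral_cpow_mul_cexp_neg ha).analyticOnNhd
    hopen).eqOn_of_preconnected_of_frequently_eq (hg.analyticOnNhd hopen)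
    hconv.isPreconnected (z₀ := ((1 : ℝ) : ℂ)) (by simp) ?_ hr
  have ht : Tendsto (fun x : ℝ => (x : ℂ)) (𝓝[≠] 1) (𝓝[≠] ((1 : ℝ) : ℂ)) := by
    refine tendsto_nhdsWithin_iff.2 ⟨(Complex.continuous_ofReal.tendsto 1).mono_left
      nhdsWithin_le_nhds, ?_⟩
    filter_upwards [self_mem_nhdsWithin] with x hx
    exact fun h => hx (Complex.ofReal_injective h)
  refine ht.frequently (Eventually.frequently ?_)
  filter_upwards [nhdsWithin_le_nhds (lt_mem_nhds (one_pos : (0 : ℝ) < 1))] with x hx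
  exact Complex.integral_cpow_mul_exp_neg_mul_Ioi ha hx

/-- The maximum of `t ^ x * exp (-k * t)` is attained at `t = x / k`. -/
theorem rpow_mul_exp_neg_le {x k t : ℝ} (hx : 0 < x) (hk : 0 < k) (ht : 0 < t) :
    t ^ x * Real.exp (-k * t) ≤ (x / k) ^ x * Real.exp (-x) := by
  rw [Real.rpow_def_of_pos ht, Real.rpow_def_of_pos (by positivity), ← Real.exp_add, ← Real.exp_add]
  refine Real.exp_le_exp.2 ?_
  have h := Real.log_le_sub_one_of_pos (by positivity : 0 < t / (x / k))
  rw [Real.log_div ht.ne' (by positivity)] at h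
  have h2 := mul_le_mul_of_nonneg_right h hx.le
  have h3 : (t / (x / k) - 1) * x = k * t - x := by field_simp
  rw [h3] at h2
  linarith

/-- Decay of the Gamma function in the direction of argument `η`, from rotating the ray of
integration by the angle `η`. -/
theorem norm_Gamma_one_add_le {ν : ℂ} {η : ℝ} (hx : 0 < ν.re) (hη : 0 < Real.cos η)
    (hη1 : -Real.pi < η) (hη2 : η < Real.pi) :
    ‖Complex.Gamma (1 + ν)‖ * Real.exp (η * ν.im) ≤ (ν.re + 1) / Real.cos η *
      (((ν.re + 1) / Real.cos η) ^ ν.re * Real.exp (-ν.re)) := by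
  set x := ν.re with hxdef
  set r := Complex.exp (η * Complex.I) with hr
  have hrre : r.re = Real.cos η := Complex.exp_ofReal_mul_I_re η
  have ha : 0 < (1 + ν).re := by rw [Complex.add_re, Complex.one_re]; linarith
  have h := integral_cpow_mul_cexp_neg (a := 1 + ν) (r := r) ha (by rw [hrre]; exact hη)
  have h1 : ‖((1 : ℂ) / r) ^ (1 + ν)‖ = Real.exp (η * ν.im) := by
    have hinv : (1 : ℂ) / r = Complex.exp ((-η : ℝ) * Complex.I) := by
      rw [hr, one_div, ← Complex.exp_neg]
      push_cast
      ring_nf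
    have hlog : Complex.log (1 / r) = (-η : ℝ) * Complex.I := by
      rw [hinv, Complex.log_exp] <;> simp <;> linarith
    rw [Complex.cpow_def_of_ne_zero (one_div_ne_zero (Complex.exp_ne_zero _)), hlog,
      Complex.norm_exp]
    congr 1
    simp
  have h2 : ‖∫ t : ℝ in Set.Ioi 0, (t : ℂ) ^ (1 + ν - 1) * Complex.exp (-(r * t))‖ ≤
      (x + 1) / Real.cos η * (((x + 1) / Real.cos η) ^ x * Real.exp (-x)) := by
    -- the rate `cos η = k + l` is split so that `t ^ x e^{-k t}` is bounded and `e^{-l t}`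
    -- integrable
    set k := Real.cos η * (x / (x + 1)) with hk
    set l := Real.cos η / (x + 1) with hl
    have hk0 : 0 < k := by positivity
    have hl0 : 0 < l := by positivity
    have hkl : Real.cos η = k + l := by rw [hk, hl]; field_simp
    have hxk : x / k = (x + 1) / Real.cos η := by rw [hk]; field_simp
    have hint : IntegrableOn (fun t : ℝ => (x / k) ^ x * Real.exp (-x) * Real.exp (-l * t))
        (Set.Ioi 0) := (integrableOn_exp_mul_Ioi (neg_lt_zero.2 hl0) 0).const_mul _
    refine (norm_integral_le_of_norm_le hint ?_).trans (le_of_eq ?_)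
    · filter_upwards [ae_restrict_mem measurableSet_Ioi] with t ht
      rw [norm_cpow_mul_cexp_neg ht, hrre, hkl, add_sub_cancel_left,
        show -(k + l) * t = -k * t + -l * t by ring, Real.exp_add, ← mul_assoc]
      exact mul_le_mul_of_nonneg_right (rpow_mul_exp_neg_le hx hk0 ht) (Real.exp_pos _).le
    · rw [integral_const_mul, integral_exp_mul_Ioi (neg_lt_zero.2 hl0), mul_zero, Real.exp_zero,
        hxk, hl]
      field_simp
  rw [h, norm_mul, h1, mul_comm] at h2
  exact h2

/-! ### Growth of entire solutions of `t φ' - ν φ = e^{ζ t}` -/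

theorem hasDerivAt_cpow_neg_mul {φ : ℂ → ℂ} (hφ : Differentiable ℂ φ) {ν ζ : ℂ}
    (hode : ∀ t, t * deriv φ t - ν * φ t = Complex.exp (ζ * t)) {r : ℝ} (hr : 0 < r) :
    HasDerivAt (fun r : ℝ => (r : ℂ) ^ (-ν) * φ r)
      ((r : ℂ) ^ (-ν - 1) * Complex.exp (ζ * r)) r := by
  have hr' : (r : ℂ) ≠ 0 := by exact_mod_cast hr.ne'
  have h1 := (hasDerivAt_id (r : ℂ)).cpow_const (c := -ν)
    (Complex.ofReal_mem_slitPlane.2 hr)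
  have h2 := (h1.fun_mul (hφ (r : ℂ)).hasDerivAt).comp_ofReal
  convert! h2 using 1
  simp only [id_eq]
  rw [← hode, Complex.cpow_sub _ _ hr', Complex.cpow_one]
  field_simp
  ring

theorem tendsto_cpow_mul_cexp_zero (s : ℂ) {ζ : ℂ} (hζ : ζ.re < 0) :
    Tendsto (fun r : ℝ => (r : ℂ) ^ s * Complex.exp (ζ * r)) atTop (𝓝 0) := by
  rw [tendsto_zero_iff_norm_tendsto_zero]
  refine (tendsto_rpow_mul_exp_neg_mul_atTop_nhds_zero s.re (-ζ.re) (neg_pos.2 hζ)).congr' ?_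
  filter_upwards [eventually_gt_atTop 0] with r hr
  have := norm_cpow_mul_cexp_neg (s := s) (r := -ζ) hr
  rw [neg_mul, neg_neg, Complex.neg_re] at this
  exact this.symm

/-- The behaviour at infinity of an entire solution of `t φ' - ν φ = e^{ζ t}` along a ray on which
the right hand side decays. For `Re ν < 0` this is the Gamma integral; differentiating the equation
lowers `ν` by one. -/
theorem tendsto_cpow_neg_mul {ζ : ℂ} (hζ : ζ.re < 0) (N : ℕ) : ∀ (ν : ℂ) (φ : ℂ → ℂ),
    ν.re < N → Differentiable ℂ φ →
    (∀ t, t * deriv φ t - ν * φ t = Complex.exp (ζ * t)) →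
    (∀ n : ℕ, ν ≠ n) ∧ Tendsto (fun r : ℝ => (r : ℂ) ^ (-ν) * φ r) atTop
      (𝓝 ((-ζ) ^ ν * Complex.Gamma (-ν))) := by
  have hζ0 : ζ ≠ 0 := by rintro rfl; simp at hζ
  have hre : 0 < (-ζ).re := by rw [Complex.neg_re]; linarith
  induction N with
  | zero =>
    intro ν φ hν hφ hode
    rw [Nat.cast_zero] at hν
    have hν' : 0 < (-ν).re := by rw [Complex.neg_re]; linarith
    refine ⟨fun n hn => ?_, ?_⟩
    · rw [hn, Complex.natCast_re] at hν
      exact absurd hν (not_lt.2 n.cast_nonneg)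
    have hint : IntegrableOn (fun t : ℝ => (t : ℂ) ^ (-ν - 1) * Complex.exp (-(-ζ * t)))
        (Set.Ioi 0) := integrableOn_cpow_mul_cexp_neg (by
      rw [Complex.sub_re, Complex.one_re]; linarith) hre
    have hlim := intervalIntegral_tendsto_integral_Ioi 0 hint tendsto_id
    rw [integral_cpow_mul_cexp_neg hν' hre] at hlim
    have harg : (-ζ).arg ≠ Real.pi := fun h => by
      have := (Complex.arg_eq_pi_iff.1 h).1
      linarith
    rw [one_div, Complex.inv_cpow _ _ harg, Complex.cpow_neg, inv_inv] at hlim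
    refine hlim.congr' ?_
    filter_upwards [eventually_ge_atTop 0] with R hR
    have hcont : ContinuousOn (fun r : ℝ => (r : ℂ) ^ (-ν) * φ r) (Set.Icc 0 R) := by
      refine Continuous.continuousOn (Continuous.mul ?_ ?_)
      · exact continuous_iff_continuousAt.2 fun r =>
          Complex.continuousAt_ofReal_cpow_const _ _ (Or.inl hν')
      · exact hφ.continuous.comp Complex.continuous_ofReal
    have hsub : Set.Ioc 0 R ⊆ Set.Ioi 0 := fun t ht => ht.1
    have h := intervalIntegral.integral_eq_sub_of_hasDerivAt_of_le hR hcont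
      (fun t ht => hasDerivAt_cpow_neg_mul hφ hode ht.1)
      ((intervalIntegrable_iff_integrableOn_Ioc_of_le hR).2 (by
        have := hint.mono_set hsub
        simpa only [neg_mul, neg_neg] using this))
    have hν0 : -ν ≠ 0 := by
      intro h0
      rw [h0] at hν'
      simp at hν'
    rw [Complex.ofReal_zero, Complex.zero_cpow hν0, zero_mul, sub_zero] at h
    rw [← h]
    simp only [neg_mul, neg_neg, id_eq]
  | succ N ih =>
    intro ν φ hν hφ hode
    have hd : Differentiable ℂ (deriv φ) := fun t => (hφ.contDiff.differentiable_deriv_two t)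
    have hode' : ∀ t, t * deriv (fun t => deriv φ t / ζ) t - (ν - 1) * (deriv φ t / ζ) =
        Complex.exp (ζ * t) := by
      intro t
      have h1 : HasDerivAt (fun t => t * deriv φ t - ν * φ t)
          (1 * deriv φ t + t * deriv (deriv φ) t - ν * deriv φ t) t :=
        ((hasDerivAt_id t).fun_mul (hd t).hasDerivAt).sub ((hφ t).hasDerivAt.const_mul ν)
      have h2 : HasDerivAt (fun t => Complex.exp (ζ * t)) (Complex.exp (ζ * t) * (ζ * 1)) t :=
        ((hasDerivAt_id t).const_mul ζ).cexp
      rw [funext hode] at h1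
      have h3 := h1.unique h2
      rw [deriv_div_const]
      have h4 : t * deriv (deriv φ) t - (ν - 1) * deriv φ t = Complex.exp (ζ * t) * ζ := by
        linear_combination h3
      rw [mul_div_assoc', mul_div_assoc', ← sub_div, h4, mul_div_cancel_right₀ _ hζ0]
    obtain ⟨h1, h2⟩ := ih (ν - 1) (fun t => deriv φ t / ζ) (by
      rw [Complex.sub_re, Complex.one_re]
      push_cast at hν
      linarith) (hd.div_const ζ) hode'
    have hν0 : ν ≠ 0 := by
      rintro rfl
      have := hode 0
      simp at this
    refine ⟨fun n hn => ?_, ?_⟩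
    · rcases n with _ | n
      · exact hν0 (by simpa using hn)
      · refine h1 n ?_
        rw [hn]
        push_cast
        ring
    have h3 := (h2.const_mul ζ).sub (tendsto_cpow_mul_cexp_zero (-ν) hζ)
    have h4 := h3.const_mul ν⁻¹
    have hlim : ν⁻¹ * (ζ * ((-ζ) ^ (ν - 1) * Complex.Gamma (-(ν - 1))) - 0) =
        (-ζ) ^ ν * Complex.Gamma (-ν) := by
      have e1 : Complex.Gamma (-(ν - 1)) = -ν * Complex.Gamma (-ν) := by
        rw [← Complex.Gamma_add_one _ (neg_ne_zero.2 hν0)]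
        congr 1
        ring
      rw [e1, Complex.cpow_sub _ _ (neg_ne_zero.2 hζ0), Complex.cpow_one, sub_zero]
      field_simp
    rw [hlim] at h4
    refine h4.congr' ?_
    filter_upwards [eventually_gt_atTop 0] with r hr
    have hr' : (r : ℂ) ≠ 0 := by exact_mod_cast hr.ne'
    rw [← hode, show -(ν - 1) = -ν + 1 by ring, Complex.cpow_add _ _ hr', Complex.cpow_one]
    field_simp
    ring

/-- On the arc from `θ` to `π - θ` the cosine lies below its tangent line at `θ`. -/
theorem mul_sin_add_cos_le {θ s : ℝ} (hθ0 : 0 ≤ θ) (hs0 : 0 ≤ s)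
    (hs : s ≤ Real.pi - 2 * θ) : s * Real.sin θ + Real.cos (θ + s) ≤ Real.cos θ := by
  have hd (s : ℝ) : HasDerivAt (fun s => s * Real.sin θ + Real.cos (θ + s))
      (1 * Real.sin θ + -Real.sin (θ + s) * (0 + 1)) s :=
    ((hasDerivAt_id s).mul_const _).add
      (((hasDerivAt_const s θ).add (hasDerivAt_id s)).cos)
  have h : AntitoneOn (fun s => s * Real.sin θ + Real.cos (θ + s))
      (Set.Icc 0 (Real.pi - 2 * θ)) := by
    refine antitoneOn_of_deriv_nonpos (convex_Icc _ _)
      (fun s _ => (hd s).continuousAt.continuousWithinAt)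
      (fun s _ => (hd s).differentiableAt.differentiableWithinAt) fun s hs => ?_
    rw [interior_Icc] at hs
    rw [(hd s).deriv]
    have h1 := Real.sin_sub_sin (θ + s) θ
    have h2 : 0 ≤ Real.sin ((θ + s - θ) / 2) :=
      Real.sin_nonneg_of_nonneg_of_le_pi (by linarith [hs.1]) (by linarith [hs.2])
    have h3 : 0 ≤ Real.cos ((θ + s + θ) / 2) :=
      Real.cos_nonneg_of_neg_pi_div_two_le_of_le (by linarith [hs.1, Real.pi_pos])
        (by linarith [hs.2])
    have := mul_nonneg h2 h3
    linarith
  have := h ⟨le_rfl, hs0.trans hs⟩ ⟨hs0, hs⟩ hs0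
  simpa using this

/-- Comparison of the value at `1` of an entire solution of `t φ' - ν φ = e^{ζ t}` with its
behaviour at infinity, along an arc of the unit circle followed by a ray. -/
theorem norm_Gamma_mul_le {θ : ℝ} (hθ0 : 0 < θ) (hθ : θ < Real.pi / 2) {ν : ℂ} (hx : 1 ≤ ν.re)
    (hy : ν.im ≤ ν.re / Real.cos θ * Real.sin θ)
    {φ : ℂ → ℂ} (hφ : Differentiable ℂ φ) (hode : ∀ t, t * deriv φ t - ν * φ t =
      Complex.exp ((ν.re / Real.cos θ : ℝ) * Complex.exp (θ * Complex.I) * t)) :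
    (∀ n : ℕ, ν ≠ n) ∧
    ‖Complex.Gamma (-ν)‖ * ((ν.re / Real.cos θ) ^ ν.re * Real.exp (ν.im * (Real.pi - θ))) ≤
      ‖φ 1‖ + (Real.pi + 1) * Real.exp ν.re := by
  have hc : 0 < Real.cos θ := Real.cos_pos_of_mem_Ioo ⟨by linarith, hθ⟩
  set x := ν.re with hxdef
  set y := ν.im with hydef
  set ρ := x / Real.cos θ with hρ
  have hρ0 : 0 < ρ := by positivity
  have hρx : ρ * Real.cos θ = x := by rw [hρ]; field_simp
  set χ := Real.pi - 2 * θ with hχ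
  have hχ0 : 0 ≤ χ := by linarith
  -- the exponent of the derivative of `q` below is at most `x` along the arc
  have harc (s : ℝ) (hs0 : 0 ≤ s) (hs : s ≤ χ) : y * s + ρ * Real.cos (θ + s) ≤ x := by
    have h1 := mul_le_mul_of_nonneg_left (mul_sin_add_cos_le hθ0.le hs0 hs) hρ0.le
    have h2 := mul_le_mul_of_nonneg_right hy hs0
    rw [hρx] at h1
    linarith
  set e := Complex.exp (χ * Complex.I) with he
  set ζ : ℂ := (ρ : ℝ) * Complex.exp (θ * Complex.I) with hζ
  have hζe : ζ * e = (ρ : ℝ) * (Complex.cos ((Real.pi - θ : ℝ) : ℂ) +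
      Complex.sin ((Real.pi - θ : ℝ) : ℂ) * Complex.I) := by
    rw [hζ, he, mul_assoc, ← Complex.exp_add, ← Complex.exp_mul_I, hχ]
    push_cast
    ring_nf
  have hneg : -(ζ * e) = (ρ : ℝ) * (Complex.cos ((-θ : ℝ) : ℂ) +
      Complex.sin ((-θ : ℝ) : ℂ) * Complex.I) := by
    rw [hζe, ← Complex.ofReal_cos, ← Complex.ofReal_sin, ← Complex.ofReal_cos,
      ← Complex.ofReal_sin, Real.cos_pi_sub, Real.sin_pi_sub, Real.cos_neg, Real.sin_neg]
    push_cast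
    ring
  have hre : (ζ * e).re = -x := by
    rw [hζe, ← Complex.ofReal_cos, ← Complex.ofReal_sin, Complex.re_ofReal_mul, Complex.add_re,
      Complex.re_ofReal_mul, Complex.I_re, mul_zero, add_zero, Complex.ofReal_re, Real.cos_pi_sub]
    linarith
  -- the solution along the ray of argument `χ`
  set p : ℂ → ℂ := fun t => φ (e * t) with hp
  have hpd (t : ℂ) : HasDerivAt p (deriv φ (e * t) * e) t := by
    have h1 : HasDerivAt (fun t : ℂ => e * t) e t := by
      simpa using (hasDerivAt_id t).const_mul e
    exact (hφ (e * t)).hasDerivAt.comp t h1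
  have hpode (t : ℂ) : t * deriv p t - ν * p t = Complex.exp (ζ * e * t) := by
    rw [(hpd t).deriv, mul_assoc, ← hode (e * t)]
    ring
  have hpdiff : Differentiable ℂ p := fun t => (hpd t).differentiableAt
  obtain ⟨N, hN⟩ := exists_nat_gt ν.re
  obtain ⟨hne, hlim⟩ := tendsto_cpow_neg_mul (ζ := ζ * e) (by rw [hre]; linarith) N ν p hN hpdiff
    hpode
  refine ⟨hne, ?_⟩
  have hray : ‖(-(ζ * e)) ^ ν * Complex.Gamma (-ν)‖ ≤ ‖p 1‖ + Real.exp (-x) := by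
    refine le_of_tendsto hlim.norm ?_
    filter_upwards [eventually_ge_atTop 1] with R hR
    have hB (r : ℝ) : HasDerivAt (fun r => (Real.exp (-x) - Real.exp (-x * r)) / x)
        (Real.exp (-x * r)) r := by
      have h1 : HasDerivAt (fun r => Real.exp (-x * r)) (Real.exp (-x * r) * (-x * 1)) r :=
        ((hasDerivAt_id r).const_mul (-x)).exp
      have h2 := ((hasDerivAt_const r (Real.exp (-x))).sub h1).div_const x
      convert! h2 using 1
      field_simp
      ring
    have hh (r : ℝ) (hr : 1 ≤ r) := (hasDerivAt_cpow_neg_mul hpdiff hpode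
      (zero_lt_one.trans_le hr)).sub_const (((1 : ℝ) : ℂ) ^ (-ν) * p ((1 : ℝ) : ℂ))
    have h := image_norm_le_of_norm_deriv_right_le_deriv_boundary' (a := 1) (b := R)
      (fun r hr => (hh r hr.1).continuousAt.continuousWithinAt)
      (fun r hr => (hh r hr.1).hasDerivWithinAt)
      (B := fun r => (Real.exp (-x) - Real.exp (-x * r)) / x) (B' := fun r => Real.exp (-x * r))
      (by simp) (fun r _ => (hB r).continuousAt.continuousWithinAt)
      (fun r _ => (hB r).hasDerivWithinAt) (fun r hr => by
        have hr0 : 0 < r := zero_lt_one.trans_le hr.1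
        have h1 := norm_cpow_mul_cexp_neg (s := -ν - 1) (r := -(ζ * e)) hr0
        rw [neg_mul, neg_neg, Complex.neg_re, hre, neg_neg] at h1
        rw [h1]
        refine mul_le_of_le_one_left (Real.exp_pos _).le ?_
        refine Real.rpow_le_one_of_one_le_of_nonpos hr.1 ?_
        rw [Complex.sub_re, Complex.neg_re, Complex.one_re]
        linarith) (Set.right_mem_Icc.2 hR)
    have h1 : (Real.exp (-x) - Real.exp (-x * R)) / x ≤ Real.exp (-x) := by
      rw [div_le_iff₀ (by linarith)]
      nlinarith [Real.exp_pos (-x), Real.exp_pos (-x * R)]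
    rw [Complex.ofReal_one, Complex.one_cpow, one_mul] at h
    have h2 := norm_le_norm_add_norm_sub' ((R : ℂ) ^ (-ν) * p R) (p 1)
    linarith
  -- the solution along the arc
  set q : ℝ → ℂ := fun s => Complex.exp (-Complex.I * ν * s) * φ (Complex.exp (s * Complex.I))
    with hq
  have hqd (s : ℝ) : HasDerivAt q (Complex.I * (Complex.exp (-Complex.I * ν * s) *
      Complex.exp (ζ * Complex.exp (s * Complex.I)))) s := by
    have h1 : HasDerivAt (fun s : ℂ => Complex.exp (-Complex.I * ν * s))
        (Complex.exp (-Complex.I * ν * s) * (-Complex.I * ν * 1)) s :=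
      ((hasDerivAt_id (s : ℂ)).const_mul _).cexp
    have h2 : HasDerivAt (fun s : ℂ => Complex.exp (s * Complex.I))
        (Complex.exp (s * Complex.I) * (1 * Complex.I)) s :=
      ((hasDerivAt_id (s : ℂ)).mul_const _).cexp
    have h3 := (h1.fun_mul ((hφ _).hasDerivAt.comp (s : ℂ) h2)).comp_ofReal
    convert! h3 using 1
    simp only [Function.comp_apply]
    rw [← hode]
    ring
  have hqn (s : ℝ) (hs0 : 0 ≤ s) (hs : s ≤ χ) : ‖Complex.I * (Complex.exp (-Complex.I * ν * s) *
      Complex.exp (ζ * Complex.exp (s * Complex.I)))‖ ≤ Real.exp x := by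
    rw [norm_mul, Complex.norm_I, one_mul, ← Complex.exp_add, Complex.norm_exp, Real.exp_le_exp]
    refine le_trans (le_of_eq ?_) (harc s hs0 hs)
    rw [hζ, mul_assoc (ρ : ℂ), ← Complex.exp_add, ← add_mul, ← Complex.ofReal_add, Complex.add_re,
      Complex.re_mul_ofReal, Complex.re_ofReal_mul, Complex.exp_ofReal_mul_I_re, hydef]
    simp
  have harc2 := norm_image_sub_le_of_norm_deriv_le_segment' (a := 0) (b := χ) (f := q)
    (fun s _ => (hqd s).hasDerivWithinAt) (fun s hs => hqn s hs.1 hs.2.le) χ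
    (Set.right_mem_Icc.2 hχ0)
  have hq0 : q 0 = φ 1 := by simp [hq]
  have hqχ : ‖q χ‖ = Real.exp (y * χ) * ‖p 1‖ := by
    change ‖Complex.exp (-Complex.I * ν * χ) * φ e‖ = Real.exp (y * χ) * ‖φ (e * 1)‖
    rw [norm_mul, Complex.norm_exp, mul_one, Complex.re_mul_ofReal, hydef]
    simp
  rw [hq0] at harc2
  have h5 : Real.exp (y * χ) * ‖p 1‖ ≤ ‖φ 1‖ + Real.exp x * Real.pi := by
    rw [← hqχ]
    have h6 := norm_le_norm_add_norm_sub' (q χ) (φ 1)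
    have h7 : Real.exp x * (χ - 0) ≤ Real.exp x * Real.pi :=
      mul_le_mul_of_nonneg_left (by linarith) (Real.exp_pos x).le
    linarith
  have h8 : Real.exp (y * χ) * Real.exp (-x) ≤ Real.exp x := by
    rw [← Real.exp_add, Real.exp_le_exp]
    have h9 := harc χ hχ0 le_rfl
    rw [show θ + χ = Real.pi - θ by rw [hχ]; ring, Real.cos_pi_sub, mul_neg, hρx] at h9
    linarith
  have hnorm : ‖(-(ζ * e)) ^ ν‖ = ρ ^ x * Real.exp (y * θ) := by
    have hne0 : -(ζ * e) ≠ 0 := by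
      intro h0
      have := congrArg Complex.re h0
      rw [Complex.neg_re, hre, Complex.zero_re] at this
      linarith
    rw [Complex.norm_cpow_of_ne_zero hne0]
    have h1 : ‖-(ζ * e)‖ = ρ := by
      rw [norm_neg, norm_mul, he, Complex.norm_exp_ofReal_mul_I, mul_one, hζ, norm_mul,
        Complex.norm_exp_ofReal_mul_I, mul_one, Complex.norm_real, Real.norm_of_nonneg hρ0.le]
    have h2 : (-(ζ * e)).arg = -θ := by
      rw [hneg]
      exact Complex.arg_mul_cos_add_sin_mul_I hρ0 ⟨by linarith, by linarith⟩
    rw [h1, h2, div_eq_mul_inv, ← Real.exp_neg]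
    congr 2
    ring
  rw [norm_mul, hnorm] at hray
  have h10 : Real.exp (y * (Real.pi - θ)) = Real.exp (y * θ) * Real.exp (y * χ) := by
    rw [← Real.exp_add]
    congr 1
    rw [hχ]
    ring
  rw [h10]
  have h11 := mul_le_mul_of_nonneg_left hray (Real.exp_pos (y * χ)).le
  linarith

/-! ### Exponential growth at `t = 1` -/

/-- The right hand side is the exponential rate obtained from the comparison of Gamma functions. The
difference of the two sides vanishes at `θ = η` and increases with `θ`. -/
theorem one_sub_cos_le_rate {η θ : ℝ} (hη0 : 0 ≤ η) (hηθ : η ≤ θ) (hθ : θ < Real.pi / 2) :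
    1 - Real.cos (θ - η) ≤
      Real.cos η * (Real.log (Real.cos η) - Real.log (Real.cos θ)) - Real.sin η * (θ - η) := by
  have hcos (s : ℝ) (h0 : η ≤ s) (h1 : s ≤ θ) : 0 < Real.cos s :=
    Real.cos_pos_of_mem_Ioo ⟨by linarith [Real.pi_pos], by linarith⟩
  have hd (s : ℝ) (h0 : η ≤ s) (h1 : s ≤ θ) : HasDerivAt (fun s => Real.cos η *
      (Real.log (Real.cos η) - Real.log (Real.cos s)) - Real.sin η * (s - η) -
        (1 - Real.cos (s - η)))
      (Real.cos η * (-(-Real.sin s / Real.cos s)) - Real.sin η * 1 -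
        (-(-Real.sin (s - η) * 1))) s :=
    (((((Real.hasDerivAt_cos s).log (hcos s h0 h1).ne').const_sub _).const_mul _).sub
      (((hasDerivAt_id s).sub_const η).const_mul _)).sub
      ((((hasDerivAt_id s).sub_const η).cos).const_sub 1)
  have h : MonotoneOn (fun s => Real.cos η *
      (Real.log (Real.cos η) - Real.log (Real.cos s)) - Real.sin η * (s - η) -
        (1 - Real.cos (s - η))) (Set.Icc η θ) := by
    refine monotoneOn_of_deriv_nonneg (convex_Icc _ _)
      (fun s hs => (hd s hs.1 hs.2).continuousAt.continuousWithinAt)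
      (fun s hs => ?_) fun s hs => ?_
    · have hs' := interior_subset hs
      exact (hd s hs'.1 hs'.2).differentiableAt.differentiableWithinAt
    · have hs' := interior_subset hs
      rw [(hd s hs'.1 hs'.2).deriv]
      have hc := hcos s hs'.1 hs'.2
      have h1 : 0 ≤ Real.sin (s - η) :=
        Real.sin_nonneg_of_nonneg_of_le_pi (by linarith [hs'.1])
          (by linarith [hs'.2, Real.pi_pos])
      have h2 : Real.cos η * (-(-Real.sin s / Real.cos s)) - Real.sin η * 1 -
          (-(-Real.sin (s - η) * 1)) = Real.sin (s - η) * (1 / Real.cos s - 1) := by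
        rw [Real.sin_sub]
        field_simp
      rw [h2]
      refine mul_nonneg h1 ?_
      rw [sub_nonneg, le_div_iff₀ hc, one_mul]
      exact Real.cos_le_one s
  have h3 := h ⟨le_rfl, hηθ⟩ ⟨hηθ, le_rfl⟩ hηθ
  simp only [sub_self, mul_zero, Real.cos_zero] at h3
  linarith

theorem norm_sin_le_exp (w : ℂ) : ‖Complex.sin w‖ ≤ Real.exp |w.im| := by
  have h1 : ‖Complex.exp (-w * Complex.I)‖ ≤ Real.exp |w.im| := by
    rw [Complex.norm_exp]
    refine Real.exp_le_exp.2 ?_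
    simpa using le_abs_self _
  have h2 : ‖Complex.exp (w * Complex.I)‖ ≤ Real.exp |w.im| := by
    rw [Complex.norm_exp]
    refine Real.exp_le_exp.2 ?_
    simpa using neg_le_abs _
  rw [Complex.sin, norm_div, norm_mul, Complex.norm_I, mul_one, Complex.norm_two,
    div_le_iff₀ two_pos]
  linarith [norm_sub_le (Complex.exp (-w * Complex.I)) (Complex.exp (w * Complex.I))]

/-- Lower bound for the Gamma function away from its poles, by reflection. -/
theorem pi_le_norm_Gamma_neg_mul {ν : ℂ} (hν : ∀ n : ℕ, ν ≠ n) (hx : 0 < ν.re)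
    (hy : 0 ≤ ν.im) : Real.pi ≤
      ‖Complex.Gamma (-ν)‖ * ‖Complex.Gamma (1 + ν)‖ * Real.exp (Real.pi * ν.im) := by
  have h := Complex.Gamma_mul_Gamma_one_sub (-ν)
  rw [sub_neg_eq_add] at h
  have h0 : Complex.Gamma (-ν) * Complex.Gamma (1 + ν) ≠ 0 := by
    refine mul_ne_zero (Complex.Gamma_ne_zero fun n hn => hν n (by simpa using hn))
      (Complex.Gamma_ne_zero_of_re_pos ?_)
    rw [Complex.add_re, Complex.one_re]
    linarith
  have hs : Complex.sin (Real.pi * -ν) ≠ 0 := by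
    intro hs
    rw [hs, div_zero] at h
    exact h0 h
  have h1 := norm_sin_le_exp (Real.pi * -ν)
  rw [Complex.im_ofReal_mul, Complex.neg_im, abs_mul, abs_neg, abs_of_pos Real.pi_pos,
    abs_of_nonneg hy] at h1
  rw [eq_div_iff hs] at h
  have h2 := congrArg norm h
  rw [norm_mul, norm_mul, Complex.norm_real, Real.norm_of_nonneg Real.pi_pos.le] at h2
  calc Real.pi = _ := h2.symm
    _ ≤ _ := by gcongr

/-- Lower bound of an entire solution of `t φ' - ν φ = e^{ζ t}` at `t = 1`, with the
choice `|ζ| = Re ν / cos θ`, `arg ζ = θ`, so that `Re ζ = Re ν`. -/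
theorem exp_le_norm_solution {θ : ℝ} (hθ0 : 0 < θ) (hθ : θ < Real.pi / 2) {n η : ℝ} (hη0 : 0 ≤ η)
    (hηθ : η ≤ θ) {ν : ℂ} (hre : ν.re = n * Real.cos η) (him : ν.im = n * Real.sin η)
    (hx : 1 ≤ ν.re) {φ : ℂ → ℂ} (hφ : Differentiable ℂ φ)
    (hode : ∀ t, t * deriv φ t - ν * φ t =
      Complex.exp ((ν.re / Real.cos θ : ℝ) * Complex.exp (θ * Complex.I) * t)) :
    Real.pi * Real.exp (n * (1 - Real.cos (θ - η)) - 1) ≤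
      (‖φ 1‖ * Real.exp (-ν.re) + (Real.pi + 1)) * ((n + 1) / Real.cos θ) := by
  have hc : 0 < Real.cos θ := Real.cos_pos_of_mem_Ioo ⟨by linarith, hθ⟩
  have hcη : 0 < Real.cos η := Real.cos_pos_of_mem_Ioo ⟨by linarith [Real.pi_pos], by linarith⟩
  have hsη : 0 ≤ Real.sin η :=
    Real.sin_nonneg_of_nonneg_of_le_pi hη0 (by linarith [Real.pi_pos])
  have hn : 0 < n := by
    by_contra hn
    have := mul_nonpos_of_nonpos_of_nonneg (not_lt.1 hn) hcη.le
    linarith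
  have hle : Real.cos θ ≤ Real.cos η :=
    Real.cos_le_cos_of_nonneg_of_le_pi hη0 (by linarith [Real.pi_pos]) hηθ
  have hx0 : 0 < ν.re := by linarith
  have hy0 : 0 ≤ ν.im := by rw [him]; positivity
  have hy : ν.im ≤ ν.re / Real.cos θ * Real.sin θ := by
    have h1 : 0 ≤ Real.sin (θ - η) :=
      Real.sin_nonneg_of_nonneg_of_le_pi (by linarith) (by linarith [Real.pi_pos])
    rw [Real.sin_sub] at h1
    rw [hre, him, div_mul_eq_mul_div, le_div_iff₀ hc]
    have := mul_nonneg hn.le h1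
    linarith
  obtain ⟨hν, h1⟩ := norm_Gamma_mul_le hθ0 hθ hx hy hφ hode
  have h2 := pi_le_norm_Gamma_neg_mul hν hx0 hy0
  have h3 := norm_Gamma_one_add_le hx0 hcη (by linarith [Real.pi_pos])
    (by linarith [Real.pi_pos])
  have h4 := one_sub_cos_le_rate hη0 hηθ hθ
  set x := ν.re with hxdef
  set y := ν.im with hydef
  set ρ := x / Real.cos θ with hρ
  set k := (x + 1) / Real.cos η with hk
  have hρ0 : 0 < ρ := by positivity
  have hk0 : 0 < k := by positivity
  have hkn : k ≤ (n + 1) / Real.cos θ := by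
    rw [hk, hre, div_le_div_iff₀ hcη hc]
    have := Real.cos_le_one η
    nlinarith
  -- the bound at infinity, the reflection formula and the bound for `Γ (1 + ν)` combined
  have h5 : Real.pi * Real.exp (η * y) * (ρ ^ x * Real.exp (y * (Real.pi - θ))) ≤
      (‖φ 1‖ + (Real.pi + 1) * Real.exp x) * (k * (k ^ x * Real.exp (-x))) *
        Real.exp (Real.pi * y) := by
    calc _ ≤ ‖Complex.Gamma (-ν)‖ * ‖Complex.Gamma (1 + ν)‖ * Real.exp (Real.pi * y) *
          Real.exp (η * y) * (ρ ^ x * Real.exp (y * (Real.pi - θ))) := by gcongr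
      _ = (‖Complex.Gamma (-ν)‖ * (ρ ^ x * Real.exp (y * (Real.pi - θ)))) *
          (‖Complex.Gamma (1 + ν)‖ * Real.exp (η * y)) * Real.exp (Real.pi * y) := by ring
      _ ≤ _ := by gcongr
  -- comparison of `log (ρ ^ x)` with `log (k ^ x)`
  have h6 : n * (1 - Real.cos (θ - η)) - 1 + x * Real.log k ≤
      (η - θ) * y + x * Real.log ρ := by
    have e1 : Real.log k = Real.log (x + 1) - Real.log (Real.cos η) :=
      Real.log_div (by linarith) hcη.ne'
    have e2 : Real.log ρ = Real.log x - Real.log (Real.cos θ) := Real.log_div hx0.ne' hc.ne'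
    have e3 : x * (Real.log (x + 1) - Real.log x) ≤ 1 := by
      have h7 := Real.log_le_sub_one_of_pos (by positivity : 0 < (x + 1) / x)
      rw [Real.log_div (by linarith) hx0.ne'] at h7
      have h8 := mul_le_mul_of_nonneg_left h7 hx0.le
      have h9 : x * ((x + 1) / x - 1) = 1 := by field_simp; ring
      linarith
    have h7 := mul_le_mul_of_nonneg_left h4 hn.le
    rw [e1, e2]
    rw [him]
    have e4 : x * Real.log (Real.cos η) = n * Real.cos η * Real.log (Real.cos η) := by rw [hre]
    have e5 : x * Real.log (Real.cos θ) = n * Real.cos η * Real.log (Real.cos θ) := by rw [hre]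
    linarith
  have h7 : Real.exp (n * (1 - Real.cos (θ - η)) - 1) * k ^ x ≤
      Real.exp ((η - θ) * y) * ρ ^ x := by
    rw [Real.rpow_def_of_pos hk0, Real.rpow_def_of_pos hρ0, ← Real.exp_add, ← Real.exp_add,
      Real.exp_le_exp]
    linarith
  have h8 : Real.pi * (Real.exp ((η - θ) * y) * ρ ^ x) ≤
      (‖φ 1‖ * Real.exp (-x) + (Real.pi + 1)) * k * k ^ x := by
    have e1 : Real.exp (η * y) * Real.exp (y * (Real.pi - θ)) =
        Real.exp ((η - θ) * y) * Real.exp (Real.pi * y) := by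
      rw [← Real.exp_add, ← Real.exp_add]
      congr 1
      ring
    have e2 : Real.exp x * Real.exp (-x) = 1 := by
      rw [← Real.exp_add, add_neg_cancel, Real.exp_zero]
    refine le_of_mul_le_mul_right ?_ (Real.exp_pos (Real.pi * y))
    linear_combination h5 - Real.pi * ρ ^ x * e1 +
      (Real.pi + 1) * k * k ^ x * Real.exp (Real.pi * y) * e2
  have h9 : Real.pi * Real.exp (n * (1 - Real.cos (θ - η)) - 1) ≤
      (‖φ 1‖ * Real.exp (-x) + (Real.pi + 1)) * k := by
    refine le_of_mul_le_mul_right ?_ (Real.rpow_pos_of_pos hk0 x)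
    have := mul_le_mul_of_nonneg_left h7 Real.pi_pos.le
    linarith
  refine h9.trans (mul_le_mul_of_nonneg_left hkn ?_)
  positivity

theorem exists_growth_of_pos {θ δ D : ℝ} (hθ0 : 0 < θ) (hθ : θ < Real.pi / 2) (hδ : 0 < δ)
    (hD : 0 ≤ D) :
    ∃ N : ℝ, ∀ ν : ℂ, N ≤ ‖ν‖ → ν.arg ≤ θ - δ → 0 ≤ ν.im →
      ∀ φ : ℂ → ℂ, Differentiable ℂ φ → (∀ t, t * deriv φ t - ν * φ t =
        Complex.exp ((ν.re / Real.cos θ : ℝ) * Complex.exp (θ * Complex.I) * t)) →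
      D * Real.exp ((1 - Real.cos δ) / 2 * ‖ν‖) ≤ ‖φ 1‖ * Real.exp (-ν.re) := by
  have hc : 0 < Real.cos θ := Real.cos_pos_of_mem_Ioo ⟨by linarith, hθ⟩
  by_cases hδθ : θ < δ
  · refine ⟨0, fun ν _ h1 h2 => ?_⟩
    have := Complex.arg_nonneg_iff.2 h2
    linarith
  set κ := (1 - Real.cos δ) / 2 with hκ
  have hκ0 : 0 < κ := by
    have : Real.cos δ < Real.cos 0 :=
      Real.cos_lt_cos_of_nonneg_of_le_pi le_rfl (by linarith [Real.pi_pos]) hδ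
    rw [Real.cos_zero] at this
    rw [hκ]
    linarith
  have hlim : Tendsto (fun n : ℝ => (n + 1) * Real.exp (-κ * n)) atTop (𝓝 0) := by
    have h1 := Real.tendsto_pow_mul_exp_neg_atTop_nhds_zero 1
    have h2 := Real.tendsto_pow_mul_exp_neg_atTop_nhds_zero 0
    have h3 : Tendsto (fun n : ℝ => κ * n) atTop atTop := tendsto_id.const_mul_atTop hκ0
    have h4 := ((h1.comp h3).const_mul κ⁻¹).add (h2.comp h3)
    rw [mul_zero, add_zero] at h4
    refine h4.congr fun n => ?_
    simp only [Function.comp_apply, pow_one, pow_zero, neg_mul]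
    field_simp
  set A := (Real.pi + 1 + D) / Real.cos θ with hA
  have hA0 : 0 < A := by positivity
  have hev : ∀ᶠ n : ℝ in atTop, (n + 1) * Real.exp (-κ * n) ≤ Real.pi * Real.exp (-1) / A :=
    hlim.eventually_le_const (by positivity)
  obtain ⟨N, hN⟩ := eventually_atTop.1 hev
  refine ⟨max N (1 / Real.cos θ), fun ν hν harg him φ hφ hode => ?_⟩
  have hη0 : 0 ≤ ν.arg := Complex.arg_nonneg_iff.2 him
  have hηθ : ν.arg ≤ θ := by linarith
  have h1 : 1 / Real.cos θ ≤ ‖ν‖ := (le_max_right _ _).trans hν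
  have h2 := hN ‖ν‖ ((le_max_left _ _).trans hν)
  have hre : ν.re = ‖ν‖ * Real.cos ν.arg := (Complex.norm_mul_cos_arg ν).symm
  have him' : ν.im = ‖ν‖ * Real.sin ν.arg := (Complex.norm_mul_sin_arg ν).symm
  have hx : 1 ≤ ν.re := by
    rw [div_le_iff₀ hc] at h1
    have h3 : Real.cos θ ≤ Real.cos ν.arg :=
      Real.cos_le_cos_of_nonneg_of_le_pi hη0 (by linarith [Real.pi_pos]) hηθ
    rw [hre]
    exact h1.trans (mul_le_mul_of_nonneg_left h3 (norm_nonneg _))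
  have h3 := exp_le_norm_solution hθ0 hθ hη0 hηθ hre him' hx hφ hode
  set n := ‖ν‖ with hn
  have hn0 : 0 ≤ n := norm_nonneg _
  have h4 : Real.exp (κ * n) * Real.exp (κ * n) * Real.exp (-1) ≤
      Real.exp (n * (1 - Real.cos (θ - ν.arg)) - 1) := by
    rw [← Real.exp_add, ← Real.exp_add, Real.exp_le_exp, hκ]
    have h5 : Real.cos (θ - ν.arg) ≤ Real.cos δ :=
      Real.cos_le_cos_of_nonneg_of_le_pi hδ.le (by linarith [Real.pi_pos]) (by linarith)
    have h6 := mul_le_mul_of_nonneg_left h5 hn0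
    linarith
  have h5 : Real.exp (-κ * n) * Real.exp (κ * n) = 1 := by
    rw [← Real.exp_add, neg_mul, neg_add_cancel, Real.exp_zero]
  have h6 : (Real.pi + 1 + D) * Real.exp (κ * n) * ((n + 1) / Real.cos θ) ≤
      Real.pi * Real.exp (n * (1 - Real.cos (θ - ν.arg)) - 1) := by
    rw [le_div_iff₀ hA0] at h2
    calc _ = (n + 1) * A * Real.exp (κ * n) := by rw [hA]; ring
      _ = ((n + 1) * Real.exp (-κ * n) * A) * (Real.exp (κ * n) * Real.exp (κ * n)) := by
        linear_combination -(n + 1) * A * Real.exp (κ * n) * h5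
      _ ≤ Real.pi * Real.exp (-1) * (Real.exp (κ * n) * Real.exp (κ * n)) := by gcongr
      _ = Real.pi * (Real.exp (κ * n) * Real.exp (κ * n) * Real.exp (-1)) := by ring
      _ ≤ _ := by gcongr
  have h7 := le_of_mul_le_mul_right (h6.trans h3) (by positivity)
  have h8 : (Real.pi + 1) * 1 ≤ (Real.pi + 1) * Real.exp (κ * n) := by
    gcongr
    exact Real.one_le_exp (by positivity)
  linarith

/-- Uniform exponential growth of `φ 1`, for the entire solutions of `t φ' - ν φ = e^{ζ t}`,
`ζ = (Re ν / cos θ) e^{iθ}`, as `ν → ∞` in a closed sector strictly inside that of opening `θ`. -/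
theorem exists_growth {θ δ D : ℝ} (hθ : |θ| < Real.pi / 2) (hδ : 0 < δ) (hD : 0 ≤ D) :
    ∃ N : ℝ, ∀ ν : ℂ, N ≤ ‖ν‖ → |ν.arg| ≤ |θ| - δ → 0 ≤ θ * ν.im →
      ∀ φ : ℂ → ℂ, Differentiable ℂ φ → (∀ t, t * deriv φ t - ν * φ t =
        Complex.exp ((ν.re / Real.cos θ : ℝ) * Complex.exp (θ * Complex.I) * t)) →
      D * Real.exp ((1 - Real.cos δ) / 2 * ‖ν‖) ≤ ‖φ 1‖ * Real.exp (-ν.re) := by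
  -- for `θ < 0`, complex conjugation reduces to the opposite angle
  rcases lt_trichotomy θ 0 with h | h | h
  · rw [abs_of_neg h] at hθ ⊢
    obtain ⟨N, hN⟩ := exists_growth_of_pos (neg_pos.2 h) hθ hδ hD
    refine ⟨N, fun ν hν harg him φ hφ hode => ?_⟩
    have hpi : ν.arg ≠ Real.pi := by
      intro h0
      rw [h0, abs_of_pos Real.pi_pos] at harg
      linarith [Real.pi_pos]
    have h1 := hN (starRingEnd ℂ ν) (by rwa [Complex.norm_conj]) (by
      rw [Complex.arg_conj, if_neg hpi]
      exact (neg_le_abs _).trans harg) (by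
      rw [Complex.conj_im]
      nlinarith) (starRingEnd ℂ ∘ φ ∘ starRingEnd ℂ)
      (fun t => differentiableAt_conj_conj_iff.2 (hφ _))
      fun t => ?_
    · simpa using h1
    · have h2 : HasDerivAt (starRingEnd ℂ ∘ φ ∘ starRingEnd ℂ)
          (starRingEnd ℂ (deriv φ (starRingEnd ℂ t))) t := by
        have := (hφ (starRingEnd ℂ t)).hasDerivAt.conj_conj
        rwa [Complex.conj_conj] at this
      rw [h2.deriv]
      have h3 := congrArg (starRingEnd ℂ) (hode (starRingEnd ℂ t))
      rw [map_sub, map_mul, map_mul, Complex.conj_conj, ← Complex.exp_conj, map_mul, map_mul,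
        Complex.conj_conj, ← Complex.exp_conj, map_mul, Complex.conj_ofReal, Complex.conj_ofReal,
        Complex.conj_I] at h3
      rw [Function.comp_apply, Function.comp_apply, h3, Complex.conj_re, Real.cos_neg,
        Complex.ofReal_neg, neg_mul, mul_neg]
  · refine ⟨0, fun ν _ harg => ?_⟩
    rw [h, abs_zero] at harg
    linarith [abs_nonneg ν.arg]
  · rw [abs_of_pos h] at hθ ⊢
    obtain ⟨N, hN⟩ := exists_growth_of_pos h hθ hδ hD
    exact ⟨N, fun ν hν harg him φ hφ hode => hN ν hν ((le_abs_self _).trans harg)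
      (nonneg_of_mul_nonneg_right him h) φ hφ hode⟩

/-! ### Lower bound for the resolvent -/

theorem norm_cpow_half {w : ℂ} (hw : w ≠ 0) : ‖w ^ (1 / 2 : ℂ)‖ = Real.sqrt ‖w‖ := by
  rw [Complex.norm_cpow_of_ne_zero hw, Real.sqrt_eq_rpow]
  simp

theorem gaussianTransform_gaussian {θ : ℝ} (h : (rotExp θ).re < 0) (c w : ℂ) :
    gaussianTransform h (schwartzL2 (gaussian h c)) w =
      (Real.pi / Complex.exp (Complex.I * θ)) ^ (1 / 2 : ℂ) *
        Complex.exp (Complex.exp (-Complex.I * θ / 2) ^ 2 * (c + w) ^ 2 / 4) := by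
  have hb : (2 * rotExp θ).re < 0 := by
    rw [Complex.mul_re]
    simp only [Complex.re_ofNat, Complex.im_ofNat, zero_mul, sub_zero]
    linarith
  have h1 := integral_cexp_quadratic hb (c + w) 0
  have h2 : -(2 * rotExp θ) = Complex.exp (Complex.I * θ) := by rw [rotExp]; ring
  have h3 : Complex.exp (-Complex.I * θ / 2) ^ 2 * Complex.exp (Complex.I * θ) = 1 := by
    rw [← Complex.exp_nat_mul, ← Complex.exp_add]
    push_cast
    ring_nf
    simp
  have h4 : 0 - (c + w) ^ 2 / (4 * (2 * rotExp θ)) =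
      Complex.exp (-Complex.I * θ / 2) ^ 2 * (c + w) ^ 2 / 4 := by
    have h5 : 2 * rotExp θ = -Complex.exp (Complex.I * θ) := by rw [← h2, neg_neg]
    have h6 := Complex.exp_ne_zero (Complex.I * θ)
    rw [h5]
    generalize Complex.exp (-Complex.I * θ / 2) = e at h3 ⊢
    field_simp
    linear_combination (-(c + w) ^ 2) * h3
  rw [h2, h4] at h1
  rw [← h1, gaussianTransform]
  refine integral_congr_ae ?_
  filter_upwards [(gaussian h c).coeFn_toLp 2 (volume : Measure ℝ)] with x hx
  rw [hx, gaussian_apply, gaussian_apply, ← Complex.exp_add]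
  congr 1
  ring

/-- The weight `exp ((Re c)² / cos θ)` is the price of moving the Gaussian in the complex plane. -/
theorem norm_sq_gaussian {θ : ℝ} (hθ : θ ∈ Set.Ioo (-(Real.pi / 2)) (Real.pi / 2))
    (h : (rotExp θ).re < 0) (c : ℂ) :
    ‖schwartzL2 (gaussian h c)‖ ^ 2 =
      Real.sqrt (Real.pi / Real.cos θ) * Real.exp (c.re ^ 2 / Real.cos θ) := by
  have hc := Real.cos_pos_of_mem_Ioo hθ
  have h1 : ((‖schwartzL2 (gaussian h c)‖ ^ 2 : ℝ) : ℂ) =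
      ∫ x : ℝ, Complex.exp ((-Real.cos θ : ℝ) * x ^ 2 + (2 * c.re : ℝ) * x + 0) := by
    have := inner_self_eq_norm_sq_to_K (𝕜 := ℂ) (schwartzL2 (gaussian h c))
    push_cast
    refine this.symm.trans ?_
    rw [inner_schwartzL2_right]
    refine integral_congr_ae ?_
    filter_upwards [(gaussian h c).coeFn_toLp 2 (volume : Measure ℝ),
      Lp.coeFn_star (schwartzL2 (gaussian h c))] with x hx hs
    rw [hs, Pi.star_apply, hx, gaussian_apply]
    change _ * (starRingEnd ℂ) _ = _
    rw [← Complex.exp_conj, ← Complex.exp_add]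
    congr 1
    have e1 : rotExp θ + (starRingEnd ℂ) (rotExp θ) = ((-Real.cos θ : ℝ) : ℂ) := by
      rw [Complex.add_conj, rotExp]
      have : (-Complex.exp (Complex.I * θ) / 2).re = -Real.cos θ / 2 := by
        rw [← exp_I_mul_re]
        simp
      rw [this]
      push_cast
      ring
    have e2 : c + (starRingEnd ℂ) c = ((2 * c.re : ℝ) : ℂ) := Complex.add_conj c
    rw [map_add, map_mul, map_mul, map_pow, Complex.conj_ofReal]
    push_cast at e1 e2
    linear_combination (x : ℂ) ^ 2 * e1 + (x : ℂ) * e2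
  rw [integral_cexp_quadratic (by rw [Complex.ofReal_re]; linarith)] at h1
  have h2 := congrArg norm h1
  rw [Complex.norm_real, Real.norm_of_nonneg (sq_nonneg _), norm_mul, ← Complex.ofReal_neg,
    neg_neg, ← Complex.ofReal_div, norm_cpow_half (by
      rw [Complex.ofReal_ne_zero]
      exact (div_pos Real.pi_pos hc).ne'), Complex.norm_real,
    Real.norm_of_nonneg (div_pos Real.pi_pos hc).le, Complex.norm_exp] at h2
  rw [h2]
  congr 2
  have : (0 : ℂ) - ((2 * c.re : ℝ) : ℂ) ^ 2 / (4 * ((-Real.cos θ : ℝ) : ℂ)) =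
      ((c.re ^ 2 / Real.cos θ : ℝ) : ℂ) := by
    have hc' : (Real.cos θ : ℂ) ≠ 0 := Complex.ofReal_ne_zero.2 hc.ne'
    push_cast at hc' ⊢
    field_simp
    ring
  rw [this, Complex.ofReal_re]

theorem norm_gaussian_mul_norm_gaussian {θ : ℝ}
    (hθ : θ ∈ Set.Ioo (-(Real.pi / 2)) (Real.pi / 2)) (h : (rotExp θ).re < 0) (c₁ c₂ : ℂ) :
    ‖schwartzL2 (gaussian h c₁)‖ * ‖schwartzL2 (gaussian h c₂)‖ =
      Real.sqrt (Real.pi / Real.cos θ) *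
        Real.exp ((c₁.re ^ 2 + c₂.re ^ 2) / (2 * Real.cos θ)) := by
  have hc := Real.cos_pos_of_mem_Ioo hθ
  rw [← sq_eq_sq₀ (by positivity) (by positivity), mul_pow, mul_pow, norm_sq_gaussian hθ,
    norm_sq_gaussian hθ, ← Real.exp_nat_mul]
  have : Real.exp (((2 : ℕ) : ℝ) * ((c₁.re ^ 2 + c₂.re ^ 2) / (2 * Real.cos θ))) =
      Real.exp (c₁.re ^ 2 / Real.cos θ) * Real.exp (c₂.re ^ 2 / Real.cos θ) := by
    rw [← Real.exp_add]
    congr 1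
    push_cast
    field_simp
  rw [this]
  ring

theorem norm_gaussianTransform_le {b : ℂ} (hb : b.re < 0) (u : L2) (w : ℂ) :
    ‖gaussianTransform hb u w‖ ≤ ‖u‖ * ‖schwartzL2 (gaussian hb w)‖ := by
  have h1 : gaussianTransform hb u w = inner ℂ (star u) (schwartzL2 (gaussian hb w)) := by
    rw [inner_schwartzL2_right, star_star]
    rfl
  rw [h1]
  refine (norm_inner_le_norm _ _).trans (mul_le_mul_of_nonneg_right ?_ (norm_nonneg _))
  refine Lp.norm_le_norm_of_ae_le ?_
  filter_upwards [Lp.coeFn_star u] with x hx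
  rw [hx, Pi.star_apply, norm_star]

/-- Matrix elements of the resolvent between Gaussians, suitably normalized and with the second
Gaussian moved along a complex line, give an entire solution of `t φ' - ν φ = e^{ζ t}`. -/
theorem exists_solution_of_isResolventAt {θ m : ℝ}
    (hθ : θ ∈ Set.Ioo (-(Real.pi / 2)) (Real.pi / 2)) {z : ℂ} (hz : (m : ℂ) + z ≠ 0)
    {R : SpinorL2 →L[ℂ] SpinorL2}
    (hR : UnboundedOperator.IsResolventAt (diracOscillator θ m) z R) (c₁ c₂ : ℂ) :
    ∃ φ : ℂ → ℂ, Differentiable ℂ φ ∧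
      (∀ t, t * deriv φ t - (z ^ 2 - m ^ 2) / 2 * φ t =
        Complex.exp (Complex.exp (-Complex.I * θ / 2) ^ 2 * c₁ * c₂ / 2 * t)) ∧
      ‖φ 1‖ * ‖(m : ℂ) + z‖ * Real.sqrt (Real.cos θ) ≤ 2 * ‖R‖ * Real.exp
        (-((Complex.exp (-Complex.I * θ / 2) ^ 2 * (c₁ ^ 2 + c₂ ^ 2)).re / 4) +
          (c₁.re ^ 2 + c₂.re ^ 2) / (2 * Real.cos θ)) := by
  have hc := Real.cos_pos_of_mem_Ioo hθ
  have hb := rotExp_re_neg hθ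
  set e := Complex.exp (-Complex.I * θ / 2) with he
  set g := schwartzL2 (gaussian hb c₁) with hg
  set f : SpinorL2 := WithLp.toLp 2 ![g, 0, g, 0] with hf
  set ψ : spinorDomain := ⟨R f, hR.mem_domain f⟩ with hψ
  have hψf : diracOscillator θ m ψ - z • (ψ : SpinorL2) = f := hR.right_inv f
  have hf0 : f 0 = g := rfl
  have hf1 : f 1 = 0 := rfl
  have hf2 : f 2 = g := rfl
  have hf3 : f 3 = 0 := rfl
  set u := component 0 ψ + component 2 ψ with hu
  set v := Complex.I • (component 1 ψ + component 3 ψ) with hv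
  have h1 := block_fst_add θ m z ψ
  have h2 := block_snd_add θ m z ψ
  rw [hψf, hf0, hf2, ← two_smul ℂ g] at h1
  rw [hψf, hf1, hf3, add_zero, eq_comm, smul_eq_zero, neg_eq_zero] at h2
  have h2' := h2.resolve_left Complex.I_ne_zero
  -- `ψ` is the resolvent applied to a spinor that is nonzero in one block only
  have hunorm : ‖(u : L2)‖ ≤ 2 * ‖R‖ * ‖g‖ := by
    have e1 := two_mul_norm_sq_spinor (ψ : SpinorL2)
    have e2 := norm_sq_spinor f
    rw [hf0, hf1, hf2, hf3, norm_zero] at e2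
    have e3 : ‖(ψ : SpinorL2)‖ ≤ ‖R‖ * ‖f‖ := R.le_opNorm f
    have e4 : (u : L2) = (ψ : SpinorL2) 0 + (ψ : SpinorL2) 2 := rfl
    rw [← e4] at e1
    refine abs_le_of_sq_le_sq' ?_ (by positivity) |>.2
    have e5 : ‖(ψ : SpinorL2)‖ ^ 2 ≤ (‖R‖ * ‖f‖) ^ 2 := by gcongr
    have e6 : (2 * ‖R‖ * ‖g‖) ^ 2 = 2 * (‖R‖ * ‖f‖) ^ 2 := by
      rw [mul_pow _ ‖f‖, e2]
      ring
    rw [e6]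
    nlinarith [sq_nonneg ‖(ψ : SpinorL2) 1 + (ψ : SpinorL2) 3‖,
      sq_nonneg ‖(ψ : SpinorL2) 0 - (ψ : SpinorL2) 2‖,
      sq_nonneg ‖(ψ : SpinorL2) 1 - (ψ : SpinorL2) 3‖]
  set U := gaussianTransform hb (u : L2) with hU
  have hUd : Differentiable ℂ U := differentiable_gaussianTransform hb _
  set k := ((Real.pi : ℂ) / Complex.exp (Complex.I * θ)) ^ (1 / 2 : ℂ) with hk
  have hkn : ‖k‖ = Real.sqrt Real.pi := by
    rw [hk, norm_cpow_half (div_ne_zero (Complex.ofReal_ne_zero.2 Real.pi_ne_zero)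
      (Complex.exp_ne_zero _)), norm_div, mul_comm, Complex.norm_exp_ofReal_mul_I, div_one,
      Complex.norm_real, Real.norm_of_nonneg Real.pi_pos.le]
  have hk0 : k ≠ 0 := by
    rw [← norm_pos_iff, hkn]
    exact Real.sqrt_pos.2 Real.pi_pos
  have hode (w : ℂ) : 2 * w * deriv U w - (z ^ 2 - m ^ 2 + e ^ 2 * w ^ 2) * U w =
      2 * (m + z) * k * Complex.exp (e ^ 2 * (c₁ + w) ^ 2 / 4) := by
    have h3 := gaussianTransform_block hb m z u v w
    have h0 : gaussianTransform hb 0 w = 0 := by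
      have := gaussianTransform_smul hb 0 0 w
      rwa [zero_smul, zero_mul] at this
    rw [← h1, h2', h0, mul_zero, add_zero, gaussianTransform_smul, hg,
      gaussianTransform_gaussian] at h3
    rw [h3]
    ring
  set κ := (m + z) * k * Complex.exp (e ^ 2 * c₁ ^ 2 / 4) with hκ
  have hκ0 : κ ≠ 0 := mul_ne_zero (mul_ne_zero hz hk0) (Complex.exp_ne_zero _)
  set V : ℂ → ℂ := fun w => Complex.exp (-(e ^ 2 * w ^ 2) / 4) * U w with hV
  have hVd (w : ℂ) := hasDerivAt_conjugated hUd e w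
  have hφd (t : ℂ) : HasDerivAt (fun t => V (c₂ * t) / κ)
      (Complex.exp (-(e ^ 2 * (c₂ * t) ^ 2) / 4) *
        (deriv U (c₂ * t) - e ^ 2 * (c₂ * t) / 2 * U (c₂ * t)) * c₂ / κ) t := by
    have h3 : HasDerivAt (fun t : ℂ => c₂ * t) c₂ t := by
      simpa using (hasDerivAt_id t).const_mul c₂
    exact ((hVd (c₂ * t)).comp t h3).div_const κ
  refine ⟨fun t => V (c₂ * t) / κ, fun t => (hφd t).differentiableAt, fun t => ?_, ?_⟩
  · rw [(hφd t).deriv]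
    have h3 := hode (c₂ * t)
    have h4 : Complex.exp (-(e ^ 2 * (c₂ * t) ^ 2) / 4) *
        Complex.exp (e ^ 2 * (c₁ + c₂ * t) ^ 2 / 4) =
        Complex.exp (e ^ 2 * c₁ ^ 2 / 4) * Complex.exp (e ^ 2 * c₁ * c₂ / 2 * t) := by
      rw [← Complex.exp_add, ← Complex.exp_add]
      congr 1
      ring
    have h5 : t * (Complex.exp (-(e ^ 2 * (c₂ * t) ^ 2) / 4) *
        (deriv U (c₂ * t) - e ^ 2 * (c₂ * t) / 2 * U (c₂ * t)) * c₂) -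
        (z ^ 2 - m ^ 2) / 2 * V (c₂ * t) = Complex.exp (e ^ 2 * c₁ * c₂ / 2 * t) * κ := by
      rw [hV, hκ]
      linear_combination (Complex.exp (-(e ^ 2 * (c₂ * t) ^ 2) / 4) / 2) * h3 +
        (m + z) * k * h4
    rw [mul_div_assoc', mul_div_assoc', ← sub_div, h5, mul_div_cancel_right₀ _ hκ0]
  · have h3 := norm_gaussianTransform_le hb (u : L2) c₂
    have h4 := norm_gaussian_mul_norm_gaussian hθ hb c₁ c₂
    rw [← hg] at h4
    have h5 : ‖U c₂‖ ≤ 2 * ‖R‖ * (Real.sqrt (Real.pi / Real.cos θ) *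
        Real.exp ((c₁.re ^ 2 + c₂.re ^ 2) / (2 * Real.cos θ))) := by
      rw [← h4, ← mul_assoc]
      exact h3.trans (by gcongr)
    change ‖V (c₂ * 1) / κ‖ * _ * _ ≤ _
    rw [Real.sqrt_div Real.pi_pos.le] at h5
    rw [mul_one, norm_div, norm_mul, hκ, norm_mul _ (Complex.exp _), norm_mul _ k, hkn,
      Complex.norm_exp, Complex.norm_exp]
    have e1 : (-(e ^ 2 * c₂ ^ 2) / 4).re = -((e ^ 2 * c₂ ^ 2).re / 4) := by
      rw [neg_div, Complex.neg_re]
      simp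
    have e2 : (e ^ 2 * c₁ ^ 2 / 4).re = (e ^ 2 * c₁ ^ 2).re / 4 := by simp
    have e3 : Real.exp (-((e ^ 2 * (c₁ ^ 2 + c₂ ^ 2)).re / 4) +
        (c₁.re ^ 2 + c₂.re ^ 2) / (2 * Real.cos θ)) =
        Real.exp (-((e ^ 2 * c₂ ^ 2).re / 4)) / Real.exp ((e ^ 2 * c₁ ^ 2).re / 4) *
          Real.exp ((c₁.re ^ 2 + c₂.re ^ 2) / (2 * Real.cos θ)) := by
      rw [← Real.exp_sub, ← Real.exp_add, mul_add, Complex.add_re]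
      congr 1
      ring
    rw [e1, e2, e3]
    have hz' : 0 < ‖(m : ℂ) + z‖ := norm_pos_iff.2 hz
    have hπ := Real.sqrt_pos.2 Real.pi_pos
    have hcs := Real.sqrt_pos.2 hc
    calc _ = Real.exp (-((e ^ 2 * c₂ ^ 2).re / 4)) / Real.exp ((e ^ 2 * c₁ ^ 2).re / 4) *
          (Real.sqrt (Real.cos θ) / Real.sqrt Real.pi) * ‖U c₂‖ := by field_simp
      _ ≤ _ := mul_le_mul_of_nonneg_left h5 (by positivity)
      _ = _ := by field_simp

/-! ### Pseudospectral consequences -/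

theorem sq_exp_neg_half (θ : ℝ) :
    Complex.exp (-Complex.I * θ / 2) ^ 2 = Complex.exp ((-θ : ℝ) * Complex.I) := by
  rw [← Complex.exp_nat_mul]
  congr 1
  push_cast
  ring

/-- The entire solution produced by the resolvent when
`ζ = (x / cos θ) e^{iθ}`. The two Gaussians
are translated. -/
theorem exists_solution_translated {θ m : ℝ}
    (hθ : θ ∈ Set.Ioo (-(Real.pi / 2)) (Real.pi / 2)) {z : ℂ} (hz : (m : ℂ) + z ≠ 0)
    {R : SpinorL2 →L[ℂ] SpinorL2}
    (hR : UnboundedOperator.IsResolventAt (diracOscillator θ m) z R) {x : ℝ} (hx : 0 ≤ x) :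
    ∃ φ : ℂ → ℂ, Differentiable ℂ φ ∧
      (∀ t, t * deriv φ t - (z ^ 2 - m ^ 2) / 2 * φ t =
        Complex.exp ((x / Real.cos θ : ℝ) * Complex.exp (θ * Complex.I) * t)) ∧
      ‖φ 1‖ * ‖(m : ℂ) + z‖ * Real.sqrt (Real.cos θ) ≤ 2 * ‖R‖ * Real.exp x := by
  have hc := Real.cos_pos_of_mem_Ioo hθ
  set r := Real.sqrt (x / (2 * Real.cos θ)) with hr
  have hr2 : r ^ 2 = x / (2 * Real.cos θ) := Real.sq_sqrt (by positivity)
  obtain ⟨φ, h1, h2, h3⟩ := exists_solution_of_isResolventAt hθ hz hR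
    ((2 * r : ℝ) * Complex.exp (θ * Complex.I)) ((2 * r : ℝ) * Complex.exp (θ * Complex.I))
  have hE : Complex.exp ((-θ : ℝ) * Complex.I) * Complex.exp (θ * Complex.I) = 1 := by
    rw [← Complex.exp_add]
    push_cast
    rw [← add_mul, neg_add_cancel, zero_mul, Complex.exp_zero]
  have e1 : Complex.exp (-Complex.I * θ / 2) ^ 2 *
      (((2 * r : ℝ) * Complex.exp (θ * Complex.I)) ^ 2) =
      ((4 * r ^ 2 : ℝ) : ℂ) * Complex.exp (θ * Complex.I) := by
    rw [sq_exp_neg_half]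
    push_cast at hE ⊢
    linear_combination (4 * (r : ℂ) ^ 2 * Complex.exp (θ * Complex.I)) * hE
  refine ⟨φ, h1, fun t => ?_, ?_⟩
  · rw [h2]
    congr 2
    have e2 : (x / Real.cos θ : ℝ) = 2 * r ^ 2 := by rw [hr2]; field_simp
    rw [e2]
    push_cast at e1 ⊢
    linear_combination e1 / 2
  · refine h3.trans_eq ?_
    rw [mul_add, Complex.add_re, e1, Complex.re_ofReal_mul, Complex.re_ofReal_mul,
      Complex.exp_ofReal_mul_I_re]
    congr 2
    have e2 : (2 * r * Real.cos θ) ^ 2 = 2 * x * Real.cos θ := by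
      rw [mul_pow, mul_pow, hr2]
      field_simp
    rw [e2, hr2]
    field_simp
    ring

/-- The entire solution produced by the resolvent when
`ζ = (x / cos θ) e^{-iθ}`. The two Gaussians
are modulated. -/
theorem exists_solution_modulated {θ m : ℝ}
    (hθ : θ ∈ Set.Ioo (-(Real.pi / 2)) (Real.pi / 2)) {z : ℂ} (hz : (m : ℂ) + z ≠ 0)
    {R : SpinorL2 →L[ℂ] SpinorL2}
    (hR : UnboundedOperator.IsResolventAt (diracOscillator θ m) z R) {x : ℝ} (hx : 0 ≤ x) :
    ∃ φ : ℂ → ℂ, Differentiable ℂ φ ∧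
      (∀ t, t * deriv φ t - (z ^ 2 - m ^ 2) / 2 * φ t =
        Complex.exp ((x / Real.cos (-θ) : ℝ) * Complex.exp ((-θ : ℝ) * Complex.I) * t)) ∧
      ‖φ 1‖ * ‖(m : ℂ) + z‖ * Real.sqrt (Real.cos θ) ≤ 2 * ‖R‖ * Real.exp x := by
  have hc := Real.cos_pos_of_mem_Ioo hθ
  set r := Real.sqrt (x / (2 * Real.cos θ)) with hr
  have hr2 : r ^ 2 = x / (2 * Real.cos θ) := Real.sq_sqrt (by positivity)
  obtain ⟨φ, h1, h2, h3⟩ := exists_solution_of_isResolventAt hθ hz hR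
    ((2 * r : ℝ) * Complex.I) ((-(2 * r) : ℝ) * Complex.I)
  refine ⟨φ, h1, fun t => ?_, ?_⟩
  · rw [h2, sq_exp_neg_half]
    congr 2
    have e2 : (x / Real.cos (-θ) : ℝ) = 2 * r ^ 2 := by rw [hr2, Real.cos_neg]; field_simp
    rw [e2]
    push_cast
    linear_combination (-2 * (r : ℂ) ^ 2 * Complex.exp (-θ * Complex.I)) * Complex.I_sq
  · refine h3.trans_eq ?_
    have e1 : Complex.exp (-Complex.I * θ / 2) ^ 2 *
        (((2 * r : ℝ) * Complex.I) ^ 2 + ((-(2 * r) : ℝ) * Complex.I) ^ 2) =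
        ((-8 * r ^ 2 : ℝ) : ℂ) * Complex.exp ((-θ : ℝ) * Complex.I) := by
      rw [sq_exp_neg_half]
      push_cast
      linear_combination (8 * (r : ℂ) ^ 2 * Complex.exp (-θ * Complex.I)) * Complex.I_sq
    rw [e1, Complex.re_ofReal_mul, Complex.re_ofReal_mul, Complex.re_ofReal_mul,
      Complex.exp_ofReal_mul_I_re, Complex.I_re, Real.cos_neg, hr2]
    congr 2
    field_simp
    ring

/-- Exponential lower bound for the resolvent in the regions `|arg (z² - m²)| ≤ |θ| - δ`. -/
theorem exists_exp_le_norm_resolvent {θ m : ℝ}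
    (hθ : θ ∈ Set.Ioo (-(Real.pi / 2)) (Real.pi / 2)) (hm : 0 ≤ m) {δ : ℝ} (hδ : 0 < δ) :
    ∃ C₁ > (0 : ℝ), ∃ c > (0 : ℝ), ∀ (z : ℂ) (R : SpinorL2 →L[ℂ] SpinorL2),
      UnboundedOperator.IsResolventAt (diracOscillator θ m) z R → C₁ ≤ ‖z ^ 2 - (m : ℂ) ^ 2‖ →
      |(z ^ 2 - (m : ℂ) ^ 2).arg| ≤ |θ| - δ → Real.exp (c * ‖z ^ 2 - (m : ℂ) ^ 2‖) ≤ ‖R‖ := by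
  by_cases hδθ : |θ| < δ
  · refine ⟨1, one_pos, 1, one_pos, fun z R _ _ h => ?_⟩
    linarith [abs_nonneg (z ^ 2 - (m : ℂ) ^ 2).arg]
  have hc := Real.cos_pos_of_mem_Ioo hθ
  have hθ' : |θ| < Real.pi / 2 := abs_lt.2 hθ
  have hκ : 0 < 1 - Real.cos δ := by
    have : Real.cos δ < Real.cos 0 :=
      Real.cos_lt_cos_of_nonneg_of_le_pi le_rfl (by linarith [Real.pi_pos]) hδ
    rw [Real.cos_zero] at this
    linarith
  have hs := Real.sqrt_pos.2 hc
  obtain ⟨N, hN⟩ := exists_growth (D := 2 / Real.sqrt (Real.cos θ)) hθ' hδ (by positivity)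
  obtain ⟨N', hN'⟩ := exists_growth (θ := -θ) (D := 2 / Real.sqrt (Real.cos θ))
    (by rwa [abs_neg]) hδ (by positivity)
  refine ⟨max (1 + 2 * m) (max (2 * N) (2 * N')), lt_max_of_lt_left (by linarith),
    (1 - Real.cos δ) / 4, by linarith, fun z R hR hC harg => ?_⟩
  set μ := z ^ 2 - (m : ℂ) ^ 2 with hμ
  have hC1 : 1 + 2 * m ≤ ‖μ‖ := (le_max_left _ _).trans hC
  have hC2 : 2 * N ≤ ‖μ‖ := (le_max_left _ _).trans ((le_max_right _ _).trans hC)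
  have hC3 : 2 * N' ≤ ‖μ‖ := (le_max_right _ _).trans ((le_max_right _ _).trans hC)
  -- `C₁ ≥ 1 + 2m` keeps `z` away from `-m`, where the Gaussian source term vanishes
  have hmz : 1 ≤ ‖(m : ℂ) + z‖ := by
    by_contra! h
    have h1 : μ = (m + z) * ((m + z) - 2 * m) := by rw [hμ]; ring
    have h2 : ‖((m : ℂ) + z) - 2 * m‖ ≤ ‖(m : ℂ) + z‖ + 2 * m := by
      refine (norm_sub_le _ _).trans_eq ?_
      rw [norm_mul, Complex.norm_two, Complex.norm_real, Real.norm_of_nonneg hm]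
    have h3 : ‖μ‖ = ‖(m : ℂ) + z‖ * ‖((m : ℂ) + z) - 2 * m‖ := by rw [h1, norm_mul]
    nlinarith [norm_nonneg ((m : ℂ) + z), norm_nonneg ((m : ℂ) + z - 2 * m)]
  have hz : (m : ℂ) + z ≠ 0 := by
    rw [← norm_pos_iff]
    linarith
  set ν := μ / 2 with hν
  have hνn : ‖ν‖ = ‖μ‖ / 2 := by rw [hν, norm_div, Complex.norm_two]
  have hνarg : ν.arg = μ.arg := by
    have : ν = ((1 / 2 : ℝ) : ℂ) * μ := by rw [hν]; push_cast; ring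
    rw [this, Complex.arg_real_mul _ (by norm_num)]
  have hνre : 0 ≤ ν.re := by
    rw [← Complex.abs_arg_le_pi_div_two_iff, hνarg]
    linarith
  -- either sign of `ζ` leads to the bound
  have key : ∀ φ : ℂ → ℂ, 2 / Real.sqrt (Real.cos θ) *
      Real.exp ((1 - Real.cos δ) / 2 * ‖ν‖) ≤ ‖φ 1‖ * Real.exp (-ν.re) →
      ‖φ 1‖ * ‖(m : ℂ) + z‖ * Real.sqrt (Real.cos θ) ≤ 2 * ‖R‖ * Real.exp ν.re →
      Real.exp ((1 - Real.cos δ) / 4 * ‖μ‖) ≤ ‖R‖ := by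
    intro φ h1 h2
    have e1 : (1 - Real.cos δ) / 2 * ‖ν‖ = (1 - Real.cos δ) / 4 * ‖μ‖ := by rw [hνn]; ring
    have e2 : Real.exp (-ν.re) * Real.exp ν.re = 1 := by
      rw [← Real.exp_add, neg_add_cancel, Real.exp_zero]
    rw [e1] at h1
    have h3 : ‖φ 1‖ * Real.sqrt (Real.cos θ) ≤ 2 * ‖R‖ * Real.exp ν.re := by
      refine le_trans ?_ h2
      rw [mul_right_comm]
      exact le_mul_of_one_le_right (by positivity) hmz
    have h4 := mul_le_mul_of_nonneg_right h1 (mul_nonneg hs.le (Real.exp_pos ν.re).le)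
    have h5 : 2 / Real.sqrt (Real.cos θ) * Real.exp ((1 - Real.cos δ) / 4 * ‖μ‖) *
        (Real.sqrt (Real.cos θ) * Real.exp ν.re) =
        2 * Real.exp ((1 - Real.cos δ) / 4 * ‖μ‖) * Real.exp ν.re := by field_simp
    have h6 : ‖φ 1‖ * Real.exp (-ν.re) * (Real.sqrt (Real.cos θ) * Real.exp ν.re) =
        ‖φ 1‖ * Real.sqrt (Real.cos θ) := by
      linear_combination ‖φ 1‖ * Real.sqrt (Real.cos θ) * e2
    rw [h5, h6] at h4
    have h7 := le_of_mul_le_mul_right (h4.trans h3) (Real.exp_pos _)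
    linarith
  rcases le_total 0 (θ * ν.im) with h | h
  · obtain ⟨φ, h1, h2, h3⟩ := exists_solution_translated hθ hz hR hνre
    exact key φ (hN ν (by linarith) (by rwa [hνarg]) h φ h1 h2) h3
  · obtain ⟨φ, h1, h2, h3⟩ := exists_solution_modulated hθ hz hR hνre
    exact key φ (hN' ν (by linarith) (by rwa [hνarg, abs_neg]) (by linarith) φ h1 h2) h3

theorem mem_pseudospectrum_of_exp {θ m : ℝ} {z : ℂ} {ε c M : ℝ} (hε : 0 < ε) (hc : 0 < c)
    (h : ∀ R, UnboundedOperator.IsResolventAt (diracOscillator θ m) z R →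
      Real.exp (c * M) ≤ ‖R‖) (hM : 1 / (2 * c) * Real.log (1 / ε ^ 2) < M) :
    z ∈ UnboundedOperator.pseudospectrum (diracOscillator θ m) ε := by
  by_cases hz : z ∈ UnboundedOperator.spectrum (diracOscillator θ m)
  · exact Or.inl hz
  refine Or.inr ⟨hz, ?_⟩
  obtain ⟨R, hR⟩ := not_not.1 hz
  rw [hR.resolvent_eq]
  refine lt_of_lt_of_le ?_ (h R hR)
  rw [← Real.log_lt_iff_lt_exp (by positivity)]
  have e : Real.log (1 / ε ^ 2) = 2 * Real.log (1 / ε) := by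
    rw [one_div, one_div, Real.log_inv, Real.log_inv, Real.log_pow]
    push_cast
    ring
  rw [e] at hM
  have h1 := mul_lt_mul_of_pos_left hM hc
  have h2 : c * (1 / (2 * c) * (2 * Real.log (1 / ε))) = Real.log (1 / ε) := by field_simp
  linarith

theorem pseudospectrum_subset {θ m : ℝ} (hθ : θ ∈ Set.Ioo (-(Real.pi / 2)) (Real.pi / 2))
    (hm : 0 ≤ m) {ε : ℝ} (hε : 0 < ε) {z : ℂ}
    (hz : z ∈ UnboundedOperator.pseudospectrum (diracOscillator θ m) ε) :
    (1 - |Real.tan (θ / 2)|) * |z.im| ≤ (|z.re| + m) * |Real.tan (θ / 2)| + ε := by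
  by_contra! h
  obtain ⟨R, hR, hRn⟩ := exists_isResolventAt_of_lower_bound hθ hm (z := z) (by linarith)
  rcases hz with hz | ⟨_, hz⟩
  · exact hz ⟨R, hR⟩
  · rw [hR.resolvent_eq] at hz
    have h1 := one_div_le_one_div_of_le hε (b := (1 - |Real.tan (θ / 2)|) * |z.im| -
      |Real.tan (θ / 2)| * (m + |z.re|)) (by linarith)
    linarith

/-- Resolvent growth along the rays issued from the thresholds `±m`. -/
theorem tendsto_norm_resolvent_ray {θ m : ℝ} (hθ : θ ∈ Set.Ioo (-(Real.pi / 2)) (Real.pi / 2))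
    (hm : 0 ≤ m) {ϑ : ℝ} (h0 : 0 < |ϑ|) (h1 : |ϑ| < |θ| / 2) {s : ℝ} (hs : s = m ∨ s = -m)
    {l : Filter ℝ} (hl : Tendsto (fun r : ℝ => |r|) l atTop) :
    (∀ᶠ r : ℝ in l, (s : ℂ) + r * Complex.exp (Complex.I * ϑ) ∈
      UnboundedOperator.resolventSet (diracOscillator θ m)) ∧
    Tendsto (fun r : ℝ => ‖UnboundedOperator.resolvent (diracOscillator θ m)
      ((s : ℂ) + r * Complex.exp (Complex.I * ϑ))‖) l atTop := by
  have hθ' : |θ| < Real.pi / 2 := abs_lt.2 hθ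
  have hϑ := abs_lt.1 (h1.trans (by linarith : |θ| / 2 < Real.pi))
  have hsin : Real.sin ϑ ≠ 0 := by
    rw [Ne, Real.sin_eq_zero_iff_of_lt_of_lt hϑ.1 hϑ.2]
    exact abs_pos.1 h0
  set e := Complex.exp (Complex.I * ϑ) with he
  have hen : ‖e‖ = 1 := by rw [he, mul_comm, Complex.norm_exp_ofReal_mul_I]
  have he0 : e ≠ 0 := Complex.exp_ne_zero _
  have hr0 : ∀ᶠ r in l, r ≠ 0 := by
    filter_upwards [hl.eventually_gt_atTop 0] with r hr
    exact abs_pos.1 hr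
  have hmem : ∀ᶠ r : ℝ in l, (s : ℂ) + r * e ∈
      UnboundedOperator.resolventSet (diracOscillator θ m) := by
    filter_upwards [hr0] with r hr
    refine mem_resolventSet_of_im_ne_zero hθ hm ?_
    rw [Complex.add_im, Complex.ofReal_im, zero_add, Complex.im_ofReal_mul, he, mul_comm Complex.I,
      Complex.exp_ofReal_mul_I_im]
    exact mul_ne_zero hr hsin
  refine ⟨hmem, ?_⟩
  obtain ⟨C₁, _, c, hc, H⟩ := exists_exp_le_norm_resolvent (δ := (|θ| - |2 * ϑ|) / 2) hθ hm (by
    rw [abs_mul, abs_two]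
    linarith)
  -- `z² - m² = r² e^{2iϑ} (1 + o(1))`
  set q : ℝ → ℂ := fun r => e ^ 2 + 2 * s * e * ((r⁻¹ : ℝ) : ℂ) with hq
  have hinv : Tendsto (fun r : ℝ => r⁻¹) l (𝓝 0) := by
    rw [tendsto_zero_iff_abs_tendsto_zero]
    refine (tendsto_inv_atTop_zero.comp hl).congr fun r => ?_
    rw [Function.comp_apply, Function.comp_apply, abs_inv]
  have hqlim : Tendsto q l (𝓝 (e ^ 2)) := by
    have h2 : Tendsto (fun r : ℝ => ((r⁻¹ : ℝ) : ℂ)) l (𝓝 ((0 : ℝ) : ℂ)) :=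
      (Complex.continuous_ofReal.tendsto 0).comp hinv
    have h3 := (h2.const_mul (2 * s * e)).const_add (e ^ 2)
    rwa [Complex.ofReal_zero, mul_zero, add_zero] at h3
  have hμ : ∀ᶠ r : ℝ in l, ((s : ℂ) + r * e) ^ 2 - (m : ℂ) ^ 2 = ((r ^ 2 : ℝ) : ℂ) * q r := by
    filter_upwards [hr0] with r hr
    have hr' : (r : ℂ) ≠ 0 := Complex.ofReal_ne_zero.2 hr
    have hs2 : (s : ℂ) ^ 2 = (m : ℂ) ^ 2 := by
      rcases hs with rfl | rfl
      · rfl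
      · push_cast
        ring
    rw [hq]
    push_cast
    field_simp
    linear_combination hs2
  have he2 : e ^ 2 = Complex.exp ((2 * ϑ : ℝ) * Complex.I) := by
    rw [he, ← Complex.exp_nat_mul]
    congr 1
    push_cast
    ring
  have harg : (e ^ 2).arg = 2 * ϑ := by
    have h2 := abs_lt.1 h1
    rw [he2, Complex.arg_exp_mul_I, toIocMod_eq_self]
    constructor <;> linarith
  have hslit : e ^ 2 ∈ Complex.slitPlane := by
    rw [Complex.mem_slitPlane_iff_arg, harg]
    refine ⟨?_, pow_ne_zero _ he0⟩
    have h2 := abs_lt.1 h1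
    linarith
  have hqarg : Tendsto (fun r => |(q r).arg|) l (𝓝 |2 * ϑ|) := by
    rw [← harg]
    exact ((Complex.continuousAt_arg hslit).tendsto.comp hqlim).abs
  have hqn : Tendsto (fun r => ‖q r‖) l (𝓝 1) := by
    have := hqlim.norm
    rwa [norm_pow, hen, one_pow] at this
  have hμn : Tendsto (fun r : ℝ => ‖((s : ℂ) + r * e) ^ 2 - (m : ℂ) ^ 2‖) l atTop := by
    have h2 : Tendsto (fun r : ℝ => |r| ^ 2) l atTop := (tendsto_pow_atTop two_ne_zero).comp hl
    refine (h2.atTop_mul_pos one_pos hqn).congr' ?_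
    filter_upwards [hμ] with r hr
    rw [hr, norm_mul, Complex.norm_real, norm_pow, Real.norm_eq_abs]
  have hexp := Real.tendsto_exp_atTop.comp (hμn.const_mul_atTop hc)
  refine tendsto_atTop_mono' l ?_ hexp
  have hgap : |2 * ϑ| < |θ| - (|θ| - |2 * ϑ|) / 2 := by
    rw [abs_mul, abs_two]
    linarith
  filter_upwards [hmem, hμ, hr0, hqarg.eventually_lt_const hgap, hμn.eventually_ge_atTop C₁]
    with r hr1 hr2 hr3 hr4 hr5
  obtain ⟨R, hR⟩ := hr1
  rw [hR.resolvent_eq]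
  refine H _ R hR hr5 ?_
  rw [hr2, Complex.arg_real_mul _ (by positivity)]
  exact hr4.le

end RelativisticOscillator

end

theorem mainTheorem2 (θ m : ℝ) (hθ : θ ∈ Set.Ioo (-(Real.pi / 2)) (Real.pi / 2)) (hm : 0 ≤ m) :
    (∀ δ > (0 : ℝ), ∃ C₁ > (0 : ℝ), ∃ C₂ > (0 : ℝ), ∀ ε > (0 : ℝ),
      {z : ℂ | C₁ ≤ ‖z ^ 2 - (m : ℂ) ^ 2‖ ∧
          |Complex.arg (z ^ 2 - (m : ℂ) ^ 2)| ≤ |θ| - δ ∧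
          C₂ * Real.log (1 / ε ^ 2) < ‖z ^ 2 - (m : ℂ) ^ 2‖} ⊆
        UnboundedOperator.pseudospectrum (RelativisticOscillator.diracOscillator θ m) ε) ∧
    (∀ ε > (0 : ℝ),
      UnboundedOperator.pseudospectrum (RelativisticOscillator.diracOscillator θ m) ε ⊆
        {z : ℂ | (1 - |Real.tan (θ / 2)|) * |z.im| ≤ (|z.re| + m) * |Real.tan (θ / 2)| + ε}) ∧
    (∀ z : ℂ, |Real.tan (θ / 2)| * (m + |z.re|) < (1 - |Real.tan (θ / 2)|) * |z.im| →
      z ∈ UnboundedOperator.resolventSet (RelativisticOscillator.diracOscillator θ m) ∧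
      ‖UnboundedOperator.resolvent (RelativisticOscillator.diracOscillator θ m) z‖ ≤
        1 / ((1 - |Real.tan (θ / 2)|) * |z.im| - |Real.tan (θ / 2)| * (m + |z.re|))) ∧
    (∀ ϑ : ℝ, 0 < |ϑ| → |ϑ| < |θ| / 2 → ∀ s : ℝ, s = m ∨ s = -m →
      ∀ l : Filter ℝ, l = atTop ∨ l = atBot →
        (∀ᶠ r : ℝ in l, (s : ℂ) + r * Complex.exp (Complex.I * ϑ) ∈
          UnboundedOperator.resolventSet (RelativisticOscillator.diracOscillator θ m)) ∧
        Tendsto (fun r : ℝ => ‖UnboundedOperator.resolvent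
            (RelativisticOscillator.diracOscillator θ m)
            ((s : ℂ) + r * Complex.exp (Complex.I * ϑ))‖) l atTop) := by
  refine ⟨fun δ hδ => ?_, fun ε hε z hz => ?_, fun z hz => ?_, fun ϑ h0 h1 s hs l hl => ?_⟩
  · obtain ⟨C₁, hC₁, c, hc, H⟩ :=
      RelativisticOscillator.exists_exp_le_norm_resolvent hθ hm hδ
    refine ⟨C₁, hC₁, 1 / (2 * c), by positivity, fun ε hε z hz => ?_⟩
    exact RelativisticOscillator.mem_pseudospectrum_of_exp hε hc
      (fun R hR => H z R hR hz.1 hz.2.1) hz.2.2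
  · exact RelativisticOscillator.pseudospectrum_subset hθ hm hε hz
  · obtain ⟨R, hR, hRn⟩ := RelativisticOscillator.exists_isResolventAt_of_lower_bound hθ hm hz
    exact ⟨⟨R, hR⟩, by rwa [hR.resolvent_eq]⟩
  · refine RelativisticOscillator.tendsto_norm_resolvent_ray hθ hm h0 h1 hs ?_
    rcases hl with rfl | rfl
    · exact tendsto_abs_atTop_atTop
    · exact tendsto_abs_atBot_atTop
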